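/- Let $n>1$, let $M$ be a non-empty smooth ($C^\infty$, Hausdorff) manifold of dimension $n$, and let $\nabla$ be a smooth torsion-free affine connection on $M$ with Christoffel symbols $\Gamma_{ij}^k$. Let $\mathcal F_\lambda(M)$ be the space of smooth $\lambda$-densities ($\lambda\in\mathbb R$; components in coordinates are multiplied by powers $|\det|^\lambda$ of the Jacobian determinant), with $\nabla_i\varphi=\partial_i\varphi-\lambda\Gamma^m_{im}\varphi$; let $\mathcal D^3_{\lambda,\mu}(M)$ be the space of linear differential operators of order at most three $\mathcal F_\lambda(M)\to\mathcal F_\mu(M)$; and let $\mathrm{Pol}^3_\delta(T^*M)$ be the space of smooth symmetric contravariant tensor fields $P^{ijk}$ of degree three with values in $\delta$-densities. Two connections $\nabla,\tilde\nabla$ are projectively equivalent if $\tilde\Gamma^k_{ij}=\Gamma^k_{ij}+\delta^k_i\omega_j+\delta^k_j\omega_i$ for a smooth $1$-form $\omega$. The Ricci tensor is taken with the sign convention $R_{jk}=R^i{}_{jki}$, where $R(\partial_k,\partial_l)\partial_j=R^i{}_{jkl}\,\partial_i$ and $R(X,Y)=[\nabla_X,\nabla_Y]-\nabla_{[X,Y]}$.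 For real constants $\alpha,\beta_1,\beta_2,\eta_1,\eta_2,\eta_3$ consider $$ \begin{aligned} Q^\nabla:\ P^{ijk}\mapsto{}& P^{ijk}\nabla_i\nabla_j\nabla_k+\alpha\,\nabla_kP^{ijk}\,\nabla_i\nabla_j+\left(\beta_1\nabla_i\nabla_jP^{ijk}+\beta_2P^{ijk}R_{ij}\right)\nabla_k\\ &+\left(\eta_1\nabla_i\nabla_j\nabla_kP^{ijk}+\eta_2R_{ij}\nabla_kP^{ijk}+\eta_3\nabla_iR_{jk}\,P^{ijk}\right). \end{aligned}\tag{main} $$ (a) For every row of the following table and every $t\in\mathbb R$, formula (main) with the constants of that row defines a linear map $Q_t:\mathrm{Pol}^3_\delta(T^*M)\to\mathcal D^3_{\lambda,\mu}(M)$ that preserves principal symbols and depends only on the projective class of $\nabla$ (it is given by the same formula written with any connection projectively equivalent to $\nabla$). For a fixed row, different values of $t$ give different maps, so the map is not unique. $$ \begin{array}{c|c|c|c|c|c|c|c|c} \delta&\lambda&\mu&\alpha&\beta_1&\beta_2&\eta_1&\eta_2&\eta_3\\\hline \frac{n+5}{n+1}&\frac{-2}{n+1}&\frac{n+3}{n+1}&t&t&\frac{4}{1-n}&\frac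 t3&\frac43\frac{t}{1-n}&\frac{2}{1-n}\\ \frac{n+4}{n+1}&\frac{-2}{n+1}&\frac{n+2}{n+1}&0&t&\frac{4+t}{1-n}&\frac23t&\frac23\frac{t}{1-n}&\frac{6+2t}{3-3n}\\ \frac{n+4}{n+1}&\frac{-1}{n+1}&\frac{n+3}{n+1}&3&t&\frac{1+t}{1-n}&\frac13t&\frac{9+t}{3-3n}&\frac{3+t}{3-3n}\\ \frac{n+3}{n+1}&\frac{-2}{n+1}&\frac{n+1}{n+1}&0&0&\frac{4}{1-n}&t&\frac{4}{1-n}t&2\,\frac{1+t}{1-n}\\ \frac{n+3}{n+1}&\frac{-1}{n+1}&\frac{n+2}{n+1}&\frac32&0&\frac{1}{1-n}&t&\frac12\frac{8t+3}{1-n}&\frac{1+2t}{1-n}\\ \frac{n+3}{n+1}&0&\frac{n+3}{n+1}&3&3&\frac{4}{1-n}&t&\frac{4}{1-n}t&\frac{2}{1-n}t \end{array} $$ (b) Conversely, if $\delta\in\left\{\frac{n+3}{n+1},\frac{n+4}{n+1},\frac{n+5}{n+1}\right\}$ and, for some real $\lambda,\mu$ and some real constants $\alpha,\dots,\eta_3$,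 formula (main) defines such a principal-symbol-preserving map $\mathrm{Pol}^3_\delta(T^*M)\to\mathcal D^3_{\lambda,\mu}(M)$ depending only on the projective class of $\nabla$, then $(\delta,\lambda,\mu,\alpha,\dots,\eta_3)$ is given by a row of the table for some $t\in\mathbb R$. (c) If $M=\mathbb R^n$ with its flat projective structure (that is, $\nabla$ is projectively equivalent to the standard flat connection), then for every row of the table and every $t$ the map (main) is equivariant with respect to the Lie algebra $\mathrm{sl}_{n+1}(\mathbb R)\subset\mathrm{Vect}(\mathbb R^n)$ spanned by $\partial_i$, $x^i\partial_j$ and $x^i\sum_jx^j\partial_j$: $Q(L_XP)=L_X\circ Q(P)-Q(P)\circ L_X$, where $L_X$ denotes the Lie derivative on $\mathrm{Pol}^3_\delta$, $\mathcal F_\mu$ and $\mathcal F_\lambda$ respectively. -/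

import Mathlib

open scoped Manifold ContDiff

noncomputable section

namespace ProjQuant

/-! ### Local calculus in `ℝⁿ` -/

/-- The coordinate space `ℝⁿ`. -/
abbrev Coord (n : ℕ) : Type := EuclideanSpace ℝ (Fin n)

/-- Components of a tensor with `p` upper and `q` lower indices, as functions of the coordinates:
`T a b x = T^{a₀ … a_{p-1}}_{b₀ … b_{q-1}}(x)`. -/
abbrev LocalTensor (n p q : ℕ) : Type :=
  (Fin p → Fin n) → (Fin q → Fin n) → Coord n → ℝ

/-- Christoffel symbols as functions of the coordinates: `Γ k i j x = Γ^k_{ij}(x)`. -/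
abbrev LocalConn (n : ℕ) : Type := Fin n → Fin n → Fin n → Coord n → ℝ

/-- The partial derivative `∂ᵢ f`. -/
def pd {n : ℕ} (i : Fin n) (f : Coord n → ℝ) : Coord n → ℝ :=
  fun x => fderiv ℝ f x (EuclideanSpace.single i 1)

/-- Covariant derivative of a tensor density of weight `w`. The new lower index is the first one:
`covD Γ w T a (i, b) = ∇ᵢ T^a_b`, so that `covD Γ w (covD Γ w T) a (i, j, b) = ∇ᵢ ∇ⱼ T^a_b`.
On a scalar density of weight `w` it is `∇ᵢ φ = ∂ᵢ φ - w Γ^m_{im} φ`. -/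
def covD {n p q : ℕ} (Γ : LocalConn n) (w : ℝ) (T : LocalTensor n p q) :
    LocalTensor n p (q + 1) :=
  fun a b x =>
    pd (b 0) (T a (Fin.tail b)) x
      + ∑ s : Fin p, ∑ m : Fin n, Γ (a s) (b 0) m x * T (Function.update a s m) (Fin.tail b) x
      - ∑ s : Fin q, ∑ m : Fin n,
          Γ m (b 0) (Fin.tail b s) x * T a (Function.update (Fin.tail b) s m) x
      - w * (∑ m : Fin n, Γ m (b 0) m x) * T a (Fin.tail b) x

/-- The curvature `R^i_{jkl}`, i.e. `R(∂_k, ∂_l) ∂_j = R^i_{jkl} ∂_i` with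
`R(X, Y) = [∇_X, ∇_Y] - ∇_{[X, Y]}`. -/
def curvature {n : ℕ} (Γ : LocalConn n) (i j k l : Fin n) : Coord n → ℝ :=
  fun x => pd k (Γ i l j) x - pd l (Γ i k j) x
    + ∑ m : Fin n, (Γ i k m x * Γ m l j x - Γ i l m x * Γ m k j x)

/-- The Ricci tensor with the sign convention `R_{jk} = R^i_{jki}`, i.e. `Ric(Y, Z)` is the trace
of `X ↦ R(Z, X) Y`. -/
def ricci {n : ℕ} (Γ : LocalConn n) : LocalTensor n 0 2 :=
  fun _ b x => ∑ i : Fin n, curvature Γ i (b 0) (b 1) i x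

/-- The six constants of the quantization formula. -/
@[ext] structure Coeffs where
  α : ℝ
  β₁ : ℝ
  β₂ : ℝ
  η₁ : ℝ
  η₂ : ℝ
  η₃ : ℝ

/-- The quantization formula in coordinates: the symbol `P` of weight `δ = del` acts on the
density `φ` of weight `λ = lam` by
`P^{ijk} ∇ᵢ∇ⱼ∇ₖ φ + α ∇ₖ P^{ijk} ∇ᵢ∇ⱼ φ + (β₁ ∇ᵢ∇ⱼ P^{ijk} + β₂ P^{ijk} R_{ij}) ∇ₖ φ
+ (η₁ ∇ᵢ∇ⱼ∇ₖ P^{ijk} + η₂ R_{ij} ∇ₖ P^{ijk} + η₃ ∇ᵢ R_{jk} P^{ijk}) φ`. -/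
def quantLocal {n : ℕ} (κ : Coeffs) (lam del : ℝ) (Γ : LocalConn n)
    (P : LocalTensor n 3 0) (φ : LocalTensor n 0 0) : LocalTensor n 0 0 :=
  fun _ _ x =>
    (∑ i, ∑ j, ∑ k, P ![i, j, k] ![] x
        * covD Γ lam (covD Γ lam (covD Γ lam φ)) ![] ![i, j, k] x)
    + κ.α * (∑ i, ∑ j, ∑ k, covD Γ del P ![i, j, k] ![k] x
        * covD Γ lam (covD Γ lam φ) ![] ![i, j] x)
    + (∑ i, ∑ j, ∑ k,
        (κ.β₁ * covD Γ del (covD Γ del P) ![i, j, k] ![i, j] x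
          + κ.β₂ * (P ![i, j, k] ![] x * ricci Γ ![] ![i, j] x))
        * covD Γ lam φ ![] ![k] x)
    + (∑ i, ∑ j, ∑ k,
        (κ.η₁ * covD Γ del (covD Γ del (covD Γ del P)) ![i, j, k] ![i, j, k] x
          + κ.η₂ * (ricci Γ ![] ![i, j] x * covD Γ del P ![i, j, k] ![k] x)
          + κ.η₃ * (covD Γ 0 (ricci Γ) ![] ![i, j, k] x * P ![i, j, k] ![] x)))
        * φ ![] ![] x

/-- The Lie derivative of a tensor density of weight `w` along the vector field `X`. -/
def lieD {n p q : ℕ} (X : Fin n → Coord n → ℝ) (w : ℝ) (T : LocalTensor n p q) :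
    LocalTensor n p q :=
  fun a b x =>
    (∑ m : Fin n, X m x * pd m (T a b) x)
      - ∑ s : Fin p, ∑ m : Fin n, pd m (X (a s)) x * T (Function.update a s m) b x
      + ∑ s : Fin q, ∑ m : Fin n, pd (b s) (X m) x * T a (Function.update b s m) x
      + w * (∑ m : Fin n, pd m (X m) x) * T a b x

/-- The Lie algebra `sl_{n+1}(ℝ)` of projective vector fields on `ℝⁿ`, spanned by
`∂ᵢ`, `xⁱ ∂ⱼ` and `xⁱ ∑ⱼ xʲ ∂ⱼ`. -/
def projectiveFields (n : ℕ) : Submodule ℝ (Fin n → Coord n → ℝ) :=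
  Submodule.span ℝ
    (Set.range (fun i : Fin n => fun k _ => if k = i then (1 : ℝ) else 0)
      ∪ Set.range (fun ij : Fin n × Fin n => fun k x => if k = ij.2 then x ij.1 else 0)
      ∪ Set.range (fun i : Fin n => fun k x => x i * x k))

/-- The Christoffel symbols `δ^k_i θ_j + δ^k_j θ_i`. -/
def projShift {n : ℕ} (θ : LocalTensor n 0 1) : LocalConn n :=
  fun k i j x => (if k = i then θ ![] ![j] x else 0) + (if k = j then θ ![] ![i] x else 0)

/-- The flat projective class on `ℝⁿ`: the smooth torsion-free connections projectively
equivalent to the standard flat connection. -/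
def IsFlatClass {n : ℕ} (Γ : LocalConn n) : Prop :=
  ∃ θ : LocalTensor n 0 1, (∀ a b, ContDiff ℝ ∞ (θ a b)) ∧ Γ = projShift θ

/-- `sl_{n+1}`-equivariance of the quantization formula on `ℝⁿ` with Christoffel symbols `Γ`:
`Q(L_X P) = L_X^μ ∘ Q(P) - Q(P) ∘ L_X^λ` for all projective vector fields `X` and all smooth
symbols `P` of weight `δ`. -/
def IsSlEquivariant {n : ℕ} (κ : Coeffs) (lam mu del : ℝ) (Γ : LocalConn n) : Prop :=
  ∀ X ∈ projectiveFields n, ∀ P : LocalTensor n 3 0, (∀ a b, ContDiff ℝ ∞ (P a b)) →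
    (∀ (σ : Equiv.Perm (Fin 3)) a b, P (a ∘ σ) b = P a b) →
    ∀ φ : LocalTensor n 0 0, (∀ a b, ContDiff ℝ ∞ (φ a b)) →
      quantLocal κ lam del Γ (lieD X del P) φ
        = lieD X mu (quantLocal κ lam del Γ P φ) - quantLocal κ lam del Γ P (lieD X lam φ)

/-! ### Tensor densities, connections and differential operators on a manifold

A geometric object on `M` is given by its components in all charts of the maximal smooth atlas,
subject to the transformation law under changes of charts. -/

section Manifold

variable (n : ℕ) (M : Type*) [TopologicalSpace M] [ChartedSpace (Coord n) M]

/-- The charts of the maximal smooth atlas of `M`. -/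
abbrev Chart : Type _ :=
  {c : OpenPartialHomeomorph M (Coord n) // c ∈ IsManifold.maximalAtlas (𝓡 n) ∞ M}

variable {n M}

/-- The change of coordinates from the chart `c` to the chart `c'`. -/
def transition (c c' : Chart n M) : Coord n → Coord n := fun x => c'.1 (c.1.symm x)

/-- The domain of the change of coordinates from `c` to `c'`. -/
def overlap (c c' : Chart n M) : Set (Coord n) := (c.1.symm.trans c'.1).source

/-- The Jacobian matrix `J^i_j = ∂ⱼ τⁱ` of the change of coordinates `τ`. -/
def jac (c c' : Chart n M) (x : Coord n) : Matrix (Fin n) (Fin n) ℝ :=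
  Matrix.of fun i j => pd j (fun y => transition c c' y i) x

variable (n M)

/-- The space of smooth tensor densities of weight `w` with `p` upper and `q` lower indices.
With `τ` the change of coordinates and `J` its Jacobian matrix, the transformation law is
`∑_a (∏ J^{a'}_a) T_c^a_b(x) = |det J|^w ∑_{b'} (∏ J^{b'}_b) T_{c'}^{a'}_{b'}(τ x)`. Components
are extended by zero outside the range of the chart. -/
def TensorDensity (p q : ℕ) (w : ℝ) : Submodule ℝ (Chart n M → LocalTensor n p q) where
  carrier := {T |
    (∀ c a b, ContDiffOn ℝ ∞ (T c a b) c.1.target) ∧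
    (∀ c a b x, x ∉ c.1.target → T c a b x = 0) ∧
    ∀ c c', ∀ x ∈ overlap c c', ∀ (a' : Fin p → Fin n) (b : Fin q → Fin n),
      ∑ a : Fin p → Fin n, (∏ s, jac c c' x (a' s) (a s)) * T c a b x
        = |(jac c c' x).det| ^ w
          * ∑ b' : Fin q → Fin n,
              (∏ s, jac c c' x (b' s) (b s)) * T c' a' b' (transition c c' x)}
  zero_mem' := by
    refine ⟨fun c a b => contDiffOn_const, fun c a b x _ => rfl, fun c c' x _ a' b => ?_⟩
    simp
  add_mem' := by
    rintro S T ⟨hS, hS0, hS'⟩ ⟨hT, hT0, hT'⟩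
    refine ⟨fun c a b => (hS c a b).add (hT c a b), fun c a b x hx => ?_,
      fun c c' x hx a' b => ?_⟩
    · simp [hS0 c a b x hx, hT0 c a b x hx]
    · simp only [Pi.add_apply, mul_add, Finset.sum_add_distrib]
      rw [hS' c c' x hx, hT' c c' x hx]
  smul_mem' := by
    rintro r T ⟨hT, hT0, hT'⟩
    refine ⟨fun c a b => contDiffOn_const.mul (hT c a b), fun c a b x hx => ?_,
      fun c c' x hx a' b => ?_⟩
    · simp [hT0 c a b x hx]
    · simp only [Pi.smul_apply, smul_eq_mul, mul_left_comm _ r, ← Finset.mul_sum]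
      rw [hT' c c' x hx]

/-- The space `F_λ(M)` of `λ`-densities. -/
abbrev Density (lam : ℝ) : Submodule ℝ (Chart n M → LocalTensor n 0 0) :=
  TensorDensity n M 0 0 lam

/-- The space `Pol³_δ(T*M)` of symbols of degree three: symmetric contravariant tensor densities
of degree three and weight `δ`. -/
def Symbol3 (del : ℝ) : Submodule ℝ (Chart n M → LocalTensor n 3 0) where
  carrier := {P | P ∈ TensorDensity n M 3 0 del ∧
    ∀ c (σ : Equiv.Perm (Fin 3)) a b, P c (a ∘ σ) b = P c a b}
  zero_mem' := ⟨Submodule.zero_mem _, fun _ _ _ _ => rfl⟩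
  add_mem' := by
    rintro S T ⟨hS, hS'⟩ ⟨hT, hT'⟩
    exact ⟨Submodule.add_mem _ hS hT, fun c σ a b => by
      simp only [Pi.add_apply, hS', hT']⟩
  smul_mem' := by
    rintro r T ⟨hT, hT'⟩
    exact ⟨Submodule.smul_mem _ r hT, fun c σ a b => by
      simp only [Pi.smul_apply, hT']⟩

variable {n M}

/-- The third-order expression `∑ a₃^{ijk} ∂ᵢ∂ⱼ∂ₖ f + ∑ a₂^{ij} ∂ᵢ∂ⱼ f
+ ∑ a₁^i ∂ᵢ f + a₀ f`. -/
def thirdOrder (a₃ : Fin n → Fin n → Fin n → Coord n → ℝ) (a₂ : Fin n → Fin n → Coord n → ℝ)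
    (a₁ : Fin n → Coord n → ℝ) (a₀ : Coord n → ℝ) (f : Coord n → ℝ) : Coord n → ℝ :=
  fun x => (∑ i, ∑ j, ∑ k, a₃ i j k x * pd i (pd j (pd k f)) x)
    + (∑ i, ∑ j, a₂ i j x * pd i (pd j f) x) + (∑ i, a₁ i x * pd i f x) + a₀ x * f x

variable (n M)

/-- The space `D³_{λ,μ}(M)` of linear differential operators of order at most three from
`λ`-densities to `μ`-densities: in each chart the operator has the form `thirdOrder` with smooth
coefficients. -/
def DiffOp3 (lam mu : ℝ) : Submodule ℝ (Density n M lam →ₗ[ℝ] Density n M mu) where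
  carrier := {A | ∀ c : Chart n M, ∃ a₃ a₂ a₁ a₀,
    (∀ i j k, ContDiffOn ℝ ∞ (a₃ i j k) c.1.target) ∧
    (∀ i j, ContDiffOn ℝ ∞ (a₂ i j) c.1.target) ∧
    (∀ i, ContDiffOn ℝ ∞ (a₁ i) c.1.target) ∧ ContDiffOn ℝ ∞ a₀ c.1.target ∧
    ∀ φ : Density n M lam, ∀ x ∈ c.1.target,
      (A φ).1 c ![] ![] x = thirdOrder a₃ a₂ a₁ a₀ (φ.1 c ![] ![]) x}
  zero_mem' := fun c => ⟨0, 0, 0, 0, fun _ _ _ => contDiffOn_const, fun _ _ => contDiffOn_const,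
    fun _ => contDiffOn_const, contDiffOn_const, fun φ x _ => by simp [thirdOrder]⟩
  add_mem' := by
    intro A B hA hB c
    obtain ⟨a₃, a₂, a₁, a₀, h₃, h₂, h₁, h₀, h⟩ := hA c
    obtain ⟨b₃, b₂, b₁, b₀, k₃, k₂, k₁, k₀, k⟩ := hB c
    refine ⟨a₃ + b₃, a₂ + b₂, a₁ + b₁, a₀ + b₀, fun i j l => (h₃ i j l).add (k₃ i j l),
      fun i j => (h₂ i j).add (k₂ i j), fun i => (h₁ i).add (k₁ i), h₀.add k₀,
      fun φ x hx => ?_⟩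
    have e : ((A + B) φ).1 c ![] ![] x = (A φ).1 c ![] ![] x + (B φ).1 c ![] ![] x := rfl
    rw [e, h φ x hx, k φ x hx]
    simp only [thirdOrder, Pi.add_apply, add_mul, Finset.sum_add_distrib]
    ring
  smul_mem' := by
    intro r A hA c
    obtain ⟨a₃, a₂, a₁, a₀, h₃, h₂, h₁, h₀, h⟩ := hA c
    refine ⟨r • a₃, r • a₂, r • a₁, r • a₀, fun i j l => contDiffOn_const.mul (h₃ i j l),
      fun i j => contDiffOn_const.mul (h₂ i j), fun i => contDiffOn_const.mul (h₁ i),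
      contDiffOn_const.mul h₀, fun φ x hx => ?_⟩
    have e : ((r • A) φ).1 c ![] ![] x = r * (A φ).1 c ![] ![] x := rfl
    rw [e, h φ x hx]
    simp only [thirdOrder, Pi.smul_apply, smul_eq_mul, mul_assoc, ← Finset.mul_sum]
    ring

variable {n M}

/-- The operator `A` of order at most three has principal symbol `P`: in each chart its third-order
coefficients can be taken to be the components of `P`. -/
def HasPrincipalSymbol {lam mu del : ℝ} (A : DiffOp3 n M lam mu) (P : Symbol3 n M del) : Prop :=
  ∀ c : Chart n M, ∃ a₂ a₁ a₀,
    (∀ i j, ContDiffOn ℝ ∞ (a₂ i j) c.1.target) ∧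
    (∀ i, ContDiffOn ℝ ∞ (a₁ i) c.1.target) ∧ ContDiffOn ℝ ∞ a₀ c.1.target ∧
    ∀ φ : Density n M lam, ∀ x ∈ c.1.target,
      (A.1 φ).1 c ![] ![] x
        = thirdOrder (fun i j k => P.1 c ![i, j, k] ![]) a₂ a₁ a₀ (φ.1 c ![] ![]) x

variable (n M)

/-- A smooth torsion-free affine connection on `M`, through its Christoffel symbols in all charts,
with the law `∑ₘ J^k_m Γ^m_{ij} = ∂ᵢ∂ⱼ τ^k + ∑_{l,m} J^l_i J^m_j Γ'^k_{lm} ∘ τ`. -/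
structure Connection where
  Γ : Chart n M → LocalConn n
  smooth : ∀ c k i j, ContDiffOn ℝ ∞ (Γ c k i j) c.1.target
  symm : ∀ c k i j, ∀ x ∈ c.1.target, Γ c k i j x = Γ c k j i x
  law : ∀ c c', ∀ x ∈ overlap c c', ∀ k i j,
    ∑ m, jac c c' x k m * Γ c m i j x
      = pd i (pd j (fun y => transition c c' y k)) x
        + ∑ l, ∑ m, jac c c' x l i * jac c c' x m j * Γ c' k l m (transition c c' x)

variable {n M}

/-- Projective equivalence: `Γ̃^k_{ij} = Γ^k_{ij} + δ^k_i θ_j + δ^k_j θ_i` for a smooth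
`1`-form `θ` on `M`. -/
def ProjEquiv (D D' : Connection n M) : Prop :=
  ∃ θ : TensorDensity n M 0 1 0, ∀ c : Chart n M, ∀ x ∈ c.1.target, ∀ k i j,
    D'.Γ c k i j x = D.Γ c k i j x + projShift (θ.1 c) k i j x

/-- The map `Q` is given by the quantization formula with constants `κ` written with the
connection `D`. -/
def IsGivenBy {lam mu del : ℝ} (κ : Coeffs) (D : Connection n M)
    (Q : Symbol3 n M del →ₗ[ℝ] DiffOp3 n M lam mu) : Prop :=
  ∀ (P : Symbol3 n M del) (φ : Density n M lam) (c : Chart n M), ∀ x ∈ c.1.target,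
    ((Q P).1 φ).1 c ![] ![] x = quantLocal κ lam del (D.Γ c) (P.1 c) (φ.1 c) ![] ![] x

/-- `Q` is a projectively invariant quantization map with constants `κ` for the projective class
of `D`: it preserves principal symbols, and it is given by the quantization formula written with
any connection of the class. -/
def IsProjQuantization {lam mu del : ℝ} (κ : Coeffs) (D : Connection n M)
    (Q : Symbol3 n M del →ₗ[ℝ] DiffOp3 n M lam mu) : Prop :=
  (∀ P, HasPrincipalSymbol (Q P) P) ∧ ∀ D', ProjEquiv D D' → IsGivenBy κ D' Q

end Manifold

/-! ### The table of special values -/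

/-- The six rows of the table. -/
inductive Row
  | r1 | r2 | r3 | r4 | r5 | r6

/-- The column `δ`. -/
def Row.del (n : ℕ) : Row → ℝ
  | .r1 => (n + 5) / (n + 1)
  | .r2 => (n + 4) / (n + 1)
  | .r3 => (n + 4) / (n + 1)
  | .r4 => (n + 3) / (n + 1)
  | .r5 => (n + 3) / (n + 1)
  | .r6 => (n + 3) / (n + 1)

/-- The column `λ`. -/
def Row.lam (n : ℕ) : Row → ℝ
  | .r1 => -2 / (n + 1)
  | .r2 => -2 / (n + 1)
  | .r3 => -1 / (n + 1)
  | .r4 => -2 / (n + 1)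
  | .r5 => -1 / (n + 1)
  | .r6 => 0

/-- The column `μ`. -/
def Row.mu (n : ℕ) : Row → ℝ
  | .r1 => (n + 3) / (n + 1)
  | .r2 => (n + 2) / (n + 1)
  | .r3 => (n + 3) / (n + 1)
  | .r4 => (n + 1) / (n + 1)
  | .r5 => (n + 2) / (n + 1)
  | .r6 => (n + 3) / (n + 1)

/-- The columns `α, β₁, β₂, η₁, η₂, η₃`. -/
def Row.coeffs (n : ℕ) (t : ℝ) : Row → Coeffs
  | .r1 => ⟨t, t, 4 / (1 - n), t / 3, 4 / 3 * (t / (1 - n)), 2 / (1 - n)⟩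
  | .r2 => ⟨0, t, (4 + t) / (1 - n), 2 / 3 * t, 2 / 3 * (t / (1 - n)), (6 + 2 * t) / (3 - 3 * n)⟩
  | .r3 => ⟨3, t, (1 + t) / (1 - n), t / 3, (9 + t) / (3 - 3 * n), (3 + t) / (3 - 3 * n)⟩
  | .r4 => ⟨0, 0, 4 / (1 - n), t, 4 / (1 - n) * t, 2 * ((1 + t) / (1 - n))⟩
  | .r5 => ⟨3 / 2, 0, 1 / (1 - n), t, 1 / 2 * ((8 * t + 3) / (1 - n)), (1 + 2 * t) / (1 - n)⟩
  | .r6 => ⟨3, 3, 4 / (1 - n), t, 4 / (1 - n) * t, 2 / (1 - n) * t⟩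

end ProjQuant

end

noncomputable section

namespace ProjQuant

/-! ### Partial derivatives -/

section Pd

variable {n : ℕ}

/-! The theorem rests on one computation: how the quantization formula changes when the connection
is shifted by a one-form θ. Put a = (n+1)λ and e = n+5-(n+1)δ. Shifting the connection adds e θ·P to
the divergence of P. In the second and third divergences, θ is contracted with the first and the
second divergence with the factors 2e-2 and 3e-6. Derivatives of the density change by terms
governed by a, and the symmetrised Ricci tensor changes by (n-1)(∇θ - θ⊗θ). Because P is symmetric,
all changes can be sorted into eleven scalar contractions `shiftTerm` with coefficients
`shiftCoeff`; this is `quantDiv_sh`.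

The three values of δ are e = 2, 1, 0, the zeros of 3e-6, 2e-2 and e. At such a value the constant
η₁, β₁ or α, respectively, drops out of the equation that would otherwise determine it. It becomes
the free parameter t, and that equation turns into a condition on a: a(a+1)(a+2) = 0, (a+1)(a+2) = 0
or a+2 = 0. These have 3+2+1 solutions, the six rows. The equations containing ∇θ or ∇∇θ then
determine β₂, η₂ and η₃, since n-1 is nonzero.

For existence, `shiftCoeff_row` checks that all eleven coefficients vanish on every row. The local
formula is a density of weight λ+δ under changes of coordinates (`quantLocal_law`, which rests on
`TensorLaw.covD` and `ricci_law`), so it glues to a global map `quantMap`. Its third-order part is P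
by `quantLocal_eq_thirdOrder`. Distinct parameters give distinct maps because t can be recovered
from α, β₁ or η₁, and these constants are values of the map on monomials
(`coeffs_congr_of_quantLocal_eq`).

For the converse, powers of one centred coordinate are used for P, φ and θ near a point of a chart,
and cutoffs extend them to the Hausdorff manifold. Each of the six contractions linear in θ and free
of curvature is isolated by one choice of exponents, so its coefficient vanishes
(`shiftCoeff_eq_zero`). These six equations already give the table
(`exists_row_of_shiftCoeff_eq_zero`). The weight μ is found by comparing a chart with its dilation
(`mu_eq_of_isGivenBy`).

For equivariance, invariance under shifts replaces the connection by the zero one. A projective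
field X has ∂ᵢ∂ⱼXᵏ = δᵏᵢcⱼ + δᵏⱼcᵢ with c constant, so commuting the Lie derivative past a partial
derivative produces the same terms as a projective shift by c, with the opposite sign. The defect is
linear in c and involves only three of the eleven coefficients (`quantDiv_zero_equivariant`). -/

lemma pd_add {i : Fin n} {f g : Coord n → ℝ} {x : Coord n} (hf : DifferentiableAt ℝ f x)
    (hg : DifferentiableAt ℝ g x) : pd i (fun y => f y + g y) x = pd i f x + pd i g x := by
  simp only [pd, fderiv_fun_add hf hg, add_apply]

lemma pd_sub {i : Fin n} {f g : Coord n → ℝ} {x : Coord n} (hf : DifferentiableAt ℝ f x)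
    (hg : DifferentiableAt ℝ g x) : pd i (fun y => f y - g y) x = pd i f x - pd i g x := by
  simp only [pd, fderiv_fun_sub hf hg, sub_apply]

lemma pd_mul {i : Fin n} {f g : Coord n → ℝ} {x : Coord n} (hf : DifferentiableAt ℝ f x)
    (hg : DifferentiableAt ℝ g x) :
    pd i (fun y => f y * g y) x = pd i f x * g x + f x * pd i g x := by
  simp only [pd, fderiv_fun_mul hf hg, add_apply,
    smul_apply, smul_eq_mul]
  ring

lemma pd_const (i : Fin n) (c : ℝ) (x : Coord n) : pd i (fun _ => c) x = 0 := by
  simp [pd]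

lemma pd_const_mul {i : Fin n} (c : ℝ) {f : Coord n → ℝ} {x : Coord n}
    (hf : DifferentiableAt ℝ f x) : pd i (fun y => c * f y) x = c * pd i f x := by
  rw [pd_mul (differentiableAt_const c) hf, pd_const, zero_mul, zero_add]

lemma pd_sum {ι : Type*} {s : Finset ι} {i : Fin n} {f : ι → Coord n → ℝ} {x : Coord n}
    (hf : ∀ k ∈ s, DifferentiableAt ℝ (f k) x) :
    pd i (fun y => ∑ k ∈ s, f k y) x = ∑ k ∈ s, pd i (f k) x := by
  simp only [pd, fderiv_fun_sum hf, sum_apply]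

lemma pd_congr {i : Fin n} {f g : Coord n → ℝ} {x : Coord n} (h : f =ᶠ[nhds x] g) :
    pd i f =ᶠ[nhds x] pd i g := by
  filter_upwards [h.fderiv (𝕜 := ℝ)] with y hy
  simp only [pd, hy]

lemma pd_comm {i j : Fin n} {f : Coord n → ℝ} {x : Coord n} (hf : ContDiffAt ℝ 2 f x) :
    pd i (pd j f) x = pd j (pd i f) x := by
  have h1 : DifferentiableAt ℝ (fderiv ℝ f) x :=
    (hf.fderiv_right (m := 1) (by norm_num)).differentiableAt (by norm_num)
  have key : ∀ v w : Coord n, fderiv ℝ (fun y => fderiv ℝ f y v) x w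
      = fderiv ℝ (fderiv ℝ f) x w v := by
    intro v w
    rw [fderiv_clm_apply h1 (differentiableAt_const v)]
    simp
  have hs := hf.isSymmSndFDerivAt (by simp)
  show fderiv ℝ (fun y => fderiv ℝ f y _) x _ = fderiv ℝ (fun y => fderiv ℝ f y _) x _
  rw [key, key]
  exact hs.eq _ _

@[fun_prop]
lemma contDiff_pd {i : Fin n} {f : Coord n → ℝ} (hf : ContDiff ℝ ∞ f) :
    ContDiff ℝ ∞ (pd i f) := by
  unfold pd
  exact (hf.fderiv_right (m := ∞) (by simp)).clm_apply contDiff_const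

lemma contDiffOn_pd {i : Fin n} {f : Coord n → ℝ} {U : Set (Coord n)} (hU : IsOpen U)
    (hf : ContDiffOn ℝ ∞ f U) : ContDiffOn ℝ ∞ (pd i f) U := by
  unfold pd
  exact (hf.fderiv_of_isOpen hU (m := ∞) (by simp)).clm_apply contDiffOn_const

lemma ContDiff.diffAt {f : Coord n → ℝ} (hf : ContDiff ℝ ∞ f) (x : Coord n) :
    DifferentiableAt ℝ f x := (hf.differentiable (by simp)) x

end Pd

/-! ### Covariant derivatives of tensors of low rank -/

section LowRank

variable {n : ℕ}

/-- The trace `Γ^m_{im}`. -/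
def gam (Γ : LocalConn n) (i : Fin n) : Coord n → ℝ := fun x => ∑ m, Γ m i m x

/-- `Γ^k_{ij} + δ^k_i θ_j + δ^k_j θ_i`. -/
def sh (Γ : LocalConn n) (θ : Fin n → Coord n → ℝ) : LocalConn n := fun k i j x =>
  Γ k i j x + ((if k = i then θ j x else 0) + (if k = j then θ i x else 0))

/-- The maps `cv0`, `cv1`, `cv2` are the cases of `covD` without upper indices and with at most two
lower ones, written with separate indices so that Kronecker sums collapse by simplification. The
derivative index is the first one. -/
def cv0 (Γ : LocalConn n) (w : ℝ) (φ : Coord n → ℝ) : Fin n → Coord n → ℝ := fun i x =>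
  pd i φ x - w * gam Γ i x * φ x

def cv1 (Γ : LocalConn n) (w : ℝ) (f : Fin n → Coord n → ℝ) : Fin n → Fin n → Coord n → ℝ :=
  fun i j x => pd i (f j) x - ∑ m, Γ m i j x * f m x - w * gam Γ i x * f j x

def cv2 (Γ : LocalConn n) (w : ℝ) (f : Fin n → Fin n → Coord n → ℝ) :
    Fin n → Fin n → Fin n → Coord n → ℝ :=
  fun i j k x => pd i (f j k) x - ∑ m, Γ m i j x * f m k x - ∑ m, Γ m i k x * f j m x
    - w * gam Γ i x * f j k x

/-- The maps `dv1`, `dv2`, `dv3` always contract the last upper index. On symmetric tensors this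
choice is immaterial, and they can then be iterated. -/
def dv1 (Γ : LocalConn n) (w : ℝ) (V : Fin n → Coord n → ℝ) : Coord n → ℝ := fun x =>
  ∑ j, (pd j (V j) x + ∑ m, Γ j j m x * V m x - w * gam Γ j x * V j x)

def dv2 (Γ : LocalConn n) (w : ℝ) (B : Fin n → Fin n → Coord n → ℝ) : Fin n → Coord n → ℝ :=
  fun i x => ∑ j, (pd j (B i j) x + ∑ m, Γ i j m x * B m j x + ∑ m, Γ j j m x * B i m x
    - w * gam Γ j x * B i j x)

def dv3 (Γ : LocalConn n) (w : ℝ) (P : Fin n → Fin n → Fin n → Coord n → ℝ) :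
    Fin n → Fin n → Coord n → ℝ :=
  fun i j x => ∑ k, (pd k (P i j k) x + ∑ m, Γ i k m x * P m j k x + ∑ m, Γ j k m x * P i m k x
    + ∑ m, Γ k k m x * P i j m x - w * gam Γ k x * P i j k x)

variable {Γ : LocalConn n} {w : ℝ} {θ : Fin n → Coord n → ℝ}

lemma gam_sh (i : Fin n) (x : Coord n) :
    gam (sh Γ θ) i x = gam Γ i x + (n + 1) * θ i x := by
  simp only [gam, sh, Finset.sum_add_distrib]
  simp
  ring

lemma cv0_sh (φ : Coord n → ℝ) :
    cv0 (sh Γ θ) w φ = fun i x => cv0 Γ w φ i x - w * (n + 1) * (θ i x * φ x) := by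
  funext i x
  simp only [cv0, gam_sh]
  ring

/-- The Kronecker symbols collapse the sum over `m`. A lower index contributes one term in which it
is exchanged with the derivative index and one copy of θᵢf, and the density weight contributes
w(n+1) further copies. -/
lemma cv1_sh (f : Fin n → Coord n → ℝ) :
    cv1 (sh Γ θ) w f = fun i j x => cv1 Γ w f i j x - θ j x * f i x
      - (1 + w * (n + 1)) * (θ i x * f j x) := by
  funext i j x
  simp only [cv1, gam_sh]
  simp only [sh, add_mul, Finset.sum_add_distrib, ite_mul, zero_mul, Finset.sum_ite_eq',
    Finset.mem_univ, if_true]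
  ring

lemma cv2_sh (f : Fin n → Fin n → Coord n → ℝ) :
    cv2 (sh Γ θ) w f = fun i j k x => cv2 Γ w f i j k x - θ j x * f i k x - θ k x * f j i x
      - (2 + w * (n + 1)) * (θ i x * f j k x) := by
  funext i j k x
  simp only [cv2, gam_sh]
  simp only [sh, add_mul, Finset.sum_add_distrib, ite_mul, zero_mul, Finset.sum_ite_eq',
    Finset.mem_univ, if_true]
  ring

lemma dv1_sh (V : Fin n → Coord n → ℝ) :
    dv1 (sh Γ θ) w V = fun x => dv1 Γ w V x
      + (n + 1 - w * (n + 1)) * ∑ k, θ k x * V k x := by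
  funext x
  simp only [dv1, gam_sh]
  simp only [sh, add_mul, Finset.sum_add_distrib, ite_mul, zero_mul, Finset.sum_ite_eq,
    Finset.mem_univ, if_true, Finset.sum_sub_distrib, mul_add, Finset.mul_sum, Finset.sum_const,
    Finset.card_univ, Fintype.card_fin, nsmul_eq_mul, sub_mul, one_mul, mul_assoc]
  ring

lemma dv2_sh (B : Fin n → Fin n → Coord n → ℝ)
    (hB : ∀ i j x, B i j x = B j i x) :
    dv2 (sh Γ θ) w B = fun i x => dv2 Γ w B i x
      + (n + 3 - w * (n + 1)) * ∑ k, θ k x * B i k x := by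
  funext i x
  simp only [dv2, gam_sh]
  simp only [sh, add_mul, Finset.sum_add_distrib, ite_mul, zero_mul, Finset.sum_ite_eq,
    Finset.mem_univ, if_true, Finset.sum_sub_distrib, mul_add, Finset.mul_sum, Finset.sum_const,
    Finset.card_univ, Fintype.card_fin, nsmul_eq_mul, sub_mul, one_mul, mul_assoc,
    Finset.sum_ite_irrel, mul_zero, Finset.sum_ite_eq, Finset.mem_univ, if_true]
  have e1 : ∀ m, B m i x = B i m x := fun m => hB _ _ _
  simp only [e1, ← Finset.mul_sum]
  ring

/-- The contracted index contributes n+1 copies of θ·P. Each of the two free indices contributes two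
more, which agree with the others only because P is symmetric. The resulting constant is the
quantity called e later. -/
lemma dv3_sh (P : Fin n → Fin n → Fin n → Coord n → ℝ)
    (h12 : ∀ i j k x, P i j k x = P j i k x) (h23 : ∀ i j k x, P i j k x = P i k j x) :
    dv3 (sh Γ θ) w P = fun i j x => dv3 Γ w P i j x
      + (n + 5 - w * (n + 1)) * ∑ k, θ k x * P i j k x := by
  funext i j x
  simp only [dv3, gam_sh]
  simp only [sh, add_mul, Finset.sum_add_distrib, ite_mul, zero_mul, Finset.sum_ite_eq,
    Finset.mem_univ, if_true, Finset.sum_sub_distrib, mul_add, Finset.mul_sum, Finset.sum_const,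
    Finset.card_univ, Fintype.card_fin, nsmul_eq_mul, sub_mul, one_mul, mul_assoc,
    Finset.sum_ite_irrel, mul_zero, Finset.sum_ite_eq, Finset.mem_univ, if_true]
  have e1 : ∀ m, P m j i x = P i j m x := fun m => by rw [h23, h12, h23, h12, h23, h12, h12]
  have e2 : ∀ m, P i m j x = P i j m x := fun m => by rw [h23]
  simp only [e1, e2, ← Finset.mul_sum]
  ring

end LowRank

/-! ### Linearity and Leibniz rules, and the Ricci tensor under a projective shift. -/

section Leibniz

variable {n : ℕ} {Γ : LocalConn n} {w : ℝ} {θ : Fin n → Coord n → ℝ}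

@[fun_prop]
lemma contDiff_gam (hΓ : ∀ k i j, ContDiff ℝ ∞ (Γ k i j)) (i : Fin n) :
    ContDiff ℝ ∞ (gam Γ i) := by
  unfold gam; fun_prop

@[fun_prop]
lemma contDiff_cv0 (hΓ : ∀ k i j, ContDiff ℝ ∞ (Γ k i j)) {φ : Coord n → ℝ}
    (hφ : ContDiff ℝ ∞ φ) (i : Fin n) : ContDiff ℝ ∞ (cv0 Γ w φ i) := by
  unfold cv0; fun_prop

@[fun_prop]
lemma contDiff_cv1 (hΓ : ∀ k i j, ContDiff ℝ ∞ (Γ k i j)) {f : Fin n → Coord n → ℝ}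
    (hf : ∀ i, ContDiff ℝ ∞ (f i)) (i j : Fin n) : ContDiff ℝ ∞ (cv1 Γ w f i j) := by
  unfold cv1; fun_prop

@[fun_prop]
lemma contDiff_dv3 (hΓ : ∀ k i j, ContDiff ℝ ∞ (Γ k i j)) {P : Fin n → Fin n → Fin n → Coord n → ℝ}
    (hP : ∀ i j k, ContDiff ℝ ∞ (P i j k)) (i j : Fin n) : ContDiff ℝ ∞ (dv3 Γ w P i j) := by
  unfold dv3; fun_prop

@[fun_prop]
lemma contDiff_dv2 (hΓ : ∀ k i j, ContDiff ℝ ∞ (Γ k i j)) {B : Fin n → Fin n → Coord n → ℝ}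
    (hB : ∀ i j, ContDiff ℝ ∞ (B i j)) (i : Fin n) : ContDiff ℝ ∞ (dv2 Γ w B i) := by
  unfold dv2; fun_prop

/-- Stated for `f + c * g` because the later expansions are left-nested sums of this shape, from
which the summands are peeled off one at a time. -/
lemma cv1_lin {f g : Fin n → Coord n → ℝ} (c : ℝ) (hf : ∀ i, ContDiff ℝ ∞ (f i))
    (hg : ∀ i, ContDiff ℝ ∞ (g i)) :
    cv1 Γ w (fun j x => f j x + c * g j x)
      = fun i j x => cv1 Γ w f i j x + c * cv1 Γ w g i j x := by
  funext i j x
  have hd := fun i => ContDiff.diffAt (hf i) x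
  have he := fun i => ContDiff.diffAt (hg i) x
  simp only [cv1]
  rw [pd_add (hd _) ((he _).const_mul c), pd_const_mul c (he _)]
  simp only [mul_add, Finset.sum_add_distrib, mul_left_comm _ c, ← Finset.mul_sum]
  ring

lemma cv2_lin {f g : Fin n → Fin n → Coord n → ℝ} (c : ℝ) (hf : ∀ i j, ContDiff ℝ ∞ (f i j))
    (hg : ∀ i j, ContDiff ℝ ∞ (g i j)) :
    cv2 Γ w (fun j k x => f j k x + c * g j k x)
      = fun i j k x => cv2 Γ w f i j k x + c * cv2 Γ w g i j k x := by
  funext i j k x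
  have hd := fun i j => ContDiff.diffAt (hf i j) x
  have he := fun i j => ContDiff.diffAt (hg i j) x
  simp only [cv2]
  rw [pd_add (hd _ _) ((he _ _).const_mul c), pd_const_mul c (he _ _)]
  simp only [mul_add, Finset.sum_add_distrib, mul_left_comm _ c, ← Finset.mul_sum]
  ring

lemma dv1_lin {f g : Fin n → Coord n → ℝ} (c : ℝ) (hf : ∀ i, ContDiff ℝ ∞ (f i))
    (hg : ∀ i, ContDiff ℝ ∞ (g i)) :
    dv1 Γ w (fun j x => f j x + c * g j x) = fun x => dv1 Γ w f x + c * dv1 Γ w g x := by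
  funext x
  have hd := fun i => ContDiff.diffAt (hf i) x
  have he := fun i => ContDiff.diffAt (hg i) x
  simp only [dv1, fun j => pd_add (i := j) (hd j) ((he j).const_mul c),
    fun j => pd_const_mul (i := j) c (he j)]
  rw [Finset.mul_sum, ← Finset.sum_add_distrib]
  refine Finset.sum_congr rfl fun j _ => ?_
  simp only [mul_add, Finset.sum_add_distrib, mul_left_comm _ c, ← Finset.mul_sum]
  ring

lemma dv2_lin {f g : Fin n → Fin n → Coord n → ℝ} (c : ℝ) (hf : ∀ i j, ContDiff ℝ ∞ (f i j))
    (hg : ∀ i j, ContDiff ℝ ∞ (g i j)) :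
    dv2 Γ w (fun i j x => f i j x + c * g i j x)
      = fun i x => dv2 Γ w f i x + c * dv2 Γ w g i x := by
  funext i x
  have hd := fun i j => ContDiff.diffAt (hf i j) x
  have he := fun i j => ContDiff.diffAt (hg i j) x
  simp only [dv2, fun i j => pd_add (i := j) (hd i j) ((he i j).const_mul c),
    fun i j => pd_const_mul (i := j) c (he i j)]
  rw [Finset.mul_sum, ← Finset.sum_add_distrib]
  refine Finset.sum_congr rfl fun j _ => ?_
  simp only [mul_add, Finset.sum_add_distrib, mul_left_comm _ c, ← Finset.mul_sum]
  ring

/-- The weight is carried entirely by the density: θ is differentiated with weight zero, and the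
trace term stays with φ. -/
lemma cv1_form_mul {φ : Coord n → ℝ} (hθ : ∀ i, ContDiff ℝ ∞ (θ i)) (hφ : ContDiff ℝ ∞ φ) :
    cv1 Γ w (fun j x => θ j x * φ x)
      = fun i j x => cv1 Γ 0 θ i j x * φ x + θ j x * cv0 Γ w φ i x := by
  funext i j x
  simp only [cv1, cv0]
  rw [pd_mul (ContDiff.diffAt (hθ _) x) (ContDiff.diffAt hφ x)]
  simp only [← mul_assoc, ← Finset.sum_mul]
  ring

lemma cv2_form_mul {φ : Coord n → ℝ} {A : Fin n → Fin n → Coord n → ℝ}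
    (hA : ∀ i j, ContDiff ℝ ∞ (A i j)) (hφ : ContDiff ℝ ∞ φ) :
    cv2 Γ w (fun j k x => A j k x * φ x)
      = fun i j k x => cv2 Γ 0 A i j k x * φ x + A j k x * cv0 Γ w φ i x := by
  funext i j k x
  simp only [cv2, cv0]
  rw [pd_mul (ContDiff.diffAt (hA _ _) x) (ContDiff.diffAt hφ x)]
  simp only [← mul_assoc, ← Finset.sum_mul]
  ring

lemma cv2_form_tmul {f : Fin n → Coord n → ℝ} (hθ : ∀ i, ContDiff ℝ ∞ (θ i))
    (hf : ∀ i, ContDiff ℝ ∞ (f i)) :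
    cv2 Γ w (fun j k x => θ j x * f k x)
      = fun i j k x => cv1 Γ 0 θ i j x * f k x + θ j x * cv1 Γ w f i k x := by
  funext i j k x
  simp only [cv2, cv1]
  rw [pd_mul (ContDiff.diffAt (hθ _) x) (ContDiff.diffAt (hf _) x)]
  simp only [mul_left_comm _ (θ j x), ← Finset.mul_sum]
  simp only [← mul_assoc, ← Finset.sum_mul]
  ring

lemma cv2_form_tmul_swap {f : Fin n → Coord n → ℝ} (hθ : ∀ i, ContDiff ℝ ∞ (θ i))
    (hf : ∀ i, ContDiff ℝ ∞ (f i)) :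
    cv2 Γ w (fun j k x => θ k x * f j x)
      = fun i j k x => cv1 Γ 0 θ i k x * f j x + θ k x * cv1 Γ w f i j x := by
  funext i j k x
  simp only [cv2, cv1]
  rw [pd_mul (ContDiff.diffAt (hθ _) x) (ContDiff.diffAt (hf _) x)]
  simp only [mul_left_comm _ (θ k x), ← Finset.mul_sum]
  simp only [← mul_assoc, ← Finset.sum_mul]
  ring

lemma sum_reverse₃ {ι : Type*} [Fintype ι] (f : ι → ι → ι → ℝ) :
    ∑ i, ∑ j, ∑ k, f i j k = ∑ k, ∑ j, ∑ i, f i j k := by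
  rw [Finset.sum_comm]
  conv_lhs => enter [2, j]; rw [Finset.sum_comm]
  rw [Finset.sum_comm]

/-- Contraction is parallel. For the summed index `k`, the Christoffel terms in the derivative of θ
and in that of B cancel after renaming dummy indices (`hc`), so only the two Leibniz terms remain.
-/
lemma dv1_form_contract {B : Fin n → Fin n → Coord n → ℝ} (hθ : ∀ i, ContDiff ℝ ∞ (θ i))
    (hB : ∀ i j, ContDiff ℝ ∞ (B i j)) :
    dv1 Γ w (fun j x => ∑ k, θ k x * B k j x)
      = fun x => (∑ k, ∑ j, cv1 Γ 0 θ j k x * B k j x) + ∑ k, θ k x * dv2 Γ w B k x := by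
  funext x
  have hd := fun i => ContDiff.diffAt (hθ i) x
  have he := fun i j => ContDiff.diffAt (hB i j) x
  have hp : ∀ j, pd j (fun y => ∑ k, θ k y * B k j y) x
      = ∑ k, (pd j (θ k) x * B k j x + θ k x * pd j (B k j) x) := by
    intro j
    rw [pd_sum (f := fun k y => θ k y * B k j y) fun k _ => (hd k).mul (he k j)]
    exact Finset.sum_congr rfl fun k _ => pd_mul (hd k) (he k j)
  have hc : ∑ k, ∑ j, (∑ m, Γ m j k x * θ m x) * B k j x
      = ∑ k, ∑ j, θ k x * ∑ m, Γ k j m x * B m j x := by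
    simp only [Finset.sum_mul, Finset.mul_sum]
    rw [sum_reverse₃]
    simp only [mul_assoc, mul_left_comm (θ _ x)]
  have hm : ∀ j, ∑ m, Γ j j m x * ∑ k, θ k x * B k m x
      = ∑ k, θ k x * ∑ m, Γ j j m x * B k m x := by
    intro j
    simp only [Finset.mul_sum]
    rw [Finset.sum_comm]
    simp only [mul_left_comm (θ _ x)]
  simp only [dv1, hp, hm]
  simp only [Finset.mul_sum, ← Finset.sum_add_distrib, ← Finset.sum_sub_distrib]
  rw [Finset.sum_comm]
  simp only [cv1, dv2, sub_mul, Finset.sum_sub_distrib, Finset.sum_add_distrib, hc]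
  simp only [Finset.mul_sum, ← Finset.sum_add_distrib, ← Finset.sum_sub_distrib]
  refine Finset.sum_congr rfl fun k _ => Finset.sum_congr rfl fun j _ => ?_
  simp only [← Finset.mul_sum]
  ring

/-- The divergence here runs over the middle index of P, whereas `dv3` runs over the last one; this
is where symmetry in the last two indices enters. -/
lemma dv2_form_contract {P : Fin n → Fin n → Fin n → Coord n → ℝ}
    (h23 : ∀ i j k x, P i j k x = P i k j x) (hθ : ∀ i, ContDiff ℝ ∞ (θ i))
    (hP : ∀ i j k, ContDiff ℝ ∞ (P i j k)) :
    dv2 Γ w (fun i j x => ∑ k, θ k x * P i j k x)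
      = fun i x => (∑ j, ∑ k, cv1 Γ 0 θ j k x * P i j k x) + ∑ k, θ k x * dv3 Γ w P i k x := by
  funext i x
  have hd := fun i => ContDiff.diffAt (hθ i) x
  have he := fun i j k => ContDiff.diffAt (hP i j k) x
  have hP' : ∀ i j k, P i j k = P i k j := fun i j k => funext (h23 i j k)
  have hp : ∀ j, pd j (fun y => ∑ k, θ k y * P i j k y) x
      = ∑ k, (pd j (θ k) x * P i j k x + θ k x * pd j (P i k j) x) := by
    intro j
    rw [pd_sum (f := fun k y => θ k y * P i j k y) fun k _ => (hd k).mul (he i j k)]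
    refine Finset.sum_congr rfl fun k _ => ?_
    rw [pd_mul (hd k) (he i j k), hP' i k j]
  have hc : ∑ k, ∑ j, (∑ m, Γ m j k x * θ m x) * P i j k x
      = ∑ k, ∑ j, θ k x * ∑ m, Γ k j m x * P i m j x := by
    simp only [Finset.sum_mul, Finset.mul_sum]
    rw [sum_reverse₃]
    refine Finset.sum_congr rfl fun k _ => Finset.sum_congr rfl fun j _ =>
      Finset.sum_congr rfl fun m _ => ?_
    rw [h23]
    ring
  have hm : ∀ j, ∑ m, Γ j j m x * ∑ k, θ k x * P i m k x
      = ∑ k, θ k x * ∑ m, Γ j j m x * P i k m x := by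
    intro j
    simp only [Finset.mul_sum]
    rw [Finset.sum_comm]
    refine Finset.sum_congr rfl fun k _ => Finset.sum_congr rfl fun m _ => ?_
    rw [h23]; ring
  have hm' : ∀ j, ∑ m, Γ i j m x * ∑ k, θ k x * P m j k x
      = ∑ k, θ k x * ∑ m, Γ i j m x * P m k j x := by
    intro j
    simp only [Finset.mul_sum]
    rw [Finset.sum_comm]
    refine Finset.sum_congr rfl fun k _ => Finset.sum_congr rfl fun m _ => ?_
    rw [h23]; ring
  rw [Finset.sum_comm (f := fun j k => cv1 Γ 0 θ j k x * P i j k x)]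
  simp only [dv2, hp, hm, hm']
  simp only [Finset.mul_sum, ← Finset.sum_add_distrib, ← Finset.sum_sub_distrib]
  rw [Finset.sum_comm]
  simp only [cv1, dv3, sub_mul, Finset.sum_sub_distrib, Finset.sum_add_distrib, hc]
  simp only [Finset.mul_sum, ← Finset.sum_add_distrib, ← Finset.sum_sub_distrib]
  refine Finset.sum_congr rfl fun k _ => Finset.sum_congr rfl fun j _ => ?_
  simp only [← Finset.mul_sum]
  rw [h23 i j k]
  ring

lemma dv1_form_contract₂ {P : Fin n → Fin n → Fin n → Coord n → ℝ} {A : Fin n → Fin n → Coord n → ℝ}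
    (hA : ∀ i j, ContDiff ℝ ∞ (A i j)) (hP : ∀ i j k, ContDiff ℝ ∞ (P i j k)) :
    dv1 Γ w (fun i x => ∑ j, ∑ k, A j k x * P j k i x)
      = fun x => (∑ j, ∑ k, ∑ i, cv2 Γ 0 A i j k x * P j k i x)
        + ∑ j, ∑ k, A j k x * dv3 Γ w P j k x := by
  funext x
  have hd := fun i j => ContDiff.diffAt (hA i j) x
  have he := fun i j k => ContDiff.diffAt (hP i j k) x
  have hp : ∀ i, pd i (fun y => ∑ j, ∑ k, A j k y * P j k i y) x
      = ∑ j, ∑ k, (pd i (A j k) x * P j k i x + A j k x * pd i (P j k i) x) := by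
    intro i
    rw [pd_sum (f := fun j y => ∑ k, A j k y * P j k i y) fun j _ => by
      exact DifferentiableAt.fun_sum fun k _ => (hd j k).mul (he j k i)]
    refine Finset.sum_congr rfl fun j _ => ?_
    rw [pd_sum (f := fun k y => A j k y * P j k i y) fun k _ => (hd j k).mul (he j k i)]
    exact Finset.sum_congr rfl fun k _ => pd_mul (hd j k) (he j k i)
  have hc1 : ∑ j, ∑ k, ∑ i, (∑ m, Γ m i j x * A m k x) * P j k i x
      = ∑ j, ∑ k, ∑ i, A j k x * ∑ m, Γ j i m x * P m k i x := by
    rw [Finset.sum_comm]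
    conv_rhs => rw [Finset.sum_comm]
    refine Finset.sum_congr rfl fun k _ => ?_
    simp only [Finset.sum_mul, Finset.mul_sum]
    rw [sum_reverse₃]
    simp only [mul_assoc, mul_left_comm (A _ _ x)]
  have hc2 : ∑ j, ∑ k, ∑ i, (∑ m, Γ m i k x * A j m x) * P j k i x
      = ∑ j, ∑ k, ∑ i, A j k x * ∑ m, Γ k i m x * P j m i x := by
    refine Finset.sum_congr rfl fun j _ => ?_
    simp only [Finset.sum_mul, Finset.mul_sum]
    rw [sum_reverse₃]
    simp only [mul_assoc, mul_left_comm (A _ _ x)]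
  have hm : ∀ i, ∑ m, Γ i i m x * ∑ j, ∑ k, A j k x * P j k m x
      = ∑ j, ∑ k, A j k x * ∑ m, Γ i i m x * P j k m x := by
    intro i
    simp only [Finset.mul_sum]
    rw [Finset.sum_comm]
    refine Finset.sum_congr rfl fun j _ => ?_
    rw [Finset.sum_comm]
    simp only [mul_left_comm (A _ _ x)]
  simp only [dv1, hp, hm]
  simp only [Finset.mul_sum, ← Finset.sum_add_distrib, ← Finset.sum_sub_distrib]
  rw [Finset.sum_comm]
  conv_lhs => enter [2, j]; rw [Finset.sum_comm]
  simp only [cv2, dv3, sub_mul, Finset.sum_sub_distrib, Finset.sum_add_distrib, hc1, hc2]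
  simp only [Finset.mul_sum, ← Finset.sum_add_distrib, ← Finset.sum_sub_distrib]
  refine Finset.sum_congr rfl fun j _ => Finset.sum_congr rfl fun k _ =>
    Finset.sum_congr rfl fun i _ => ?_
  simp only [← Finset.mul_sum]
  ring

/-- The Ricci tensor `R_{jk}`. -/
def ric (Γ : LocalConn n) (j k : Fin n) : Coord n → ℝ := fun x => ricci Γ ![] ![j, k] x

lemma ric_apply (Γ : LocalConn n) (j k : Fin n) (x : Coord n) :
    ric Γ j k x = ∑ i, (pd k (Γ i i j) x - pd i (Γ i k j) x
      + ∑ m, (Γ i k m x * Γ m i j x - Γ i i m x * Γ m k j x)) := rfl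

/-- Torsion-freeness lets the derivatives of θ be assembled into covariant ones. The signs reflect
the convention R_{jk} = R^i_{jki}. The part symmetric in `j`, `k` is (n-1)(∇θ - θ⊗θ), and only this
part survives contraction with a symmetric tensor. -/
lemma ric_sh (hs : ∀ k i j x, Γ k i j x = Γ k j i x) (hΓ : ∀ k i j, ContDiff ℝ ∞ (Γ k i j))
    (hθ : ∀ i, ContDiff ℝ ∞ (θ i)) :
    ric (sh Γ θ) = fun j k x => ric Γ j k x + n * cv1 Γ 0 θ k j x - cv1 Γ 0 θ j k x
      - (n - 1) * (θ j x * θ k x) := by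
  funext j k x
  have hd := fun k i j => ContDiff.diffAt (hΓ k i j) x
  have he := fun i => ContDiff.diffAt (hθ i) x
  have hit : ∀ (p : Prop) [Decidable p] i, DifferentiableAt ℝ (fun y => if p then θ i y else 0) x := by
    intro p _ i
    split_ifs
    · exact he i
    · exact differentiableAt_const _
  have hpi : ∀ (p : Prop) [Decidable p] i l,
      pd l (fun y => if p then θ i y else 0) x = if p then pd l (θ i) x else 0 := by
    intro p _ i l
    split_ifs
    · rfl
    · exact pd_const _ _ _
  have hp : ∀ l k i j, pd l (sh Γ θ k i j) x = pd l (Γ k i j) x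
      + ((if k = i then pd l (θ j) x else 0) + (if k = j then pd l (θ i) x else 0)) := by
    intro l k i j
    unfold sh
    rw [pd_add (hd _ _ _) (DifferentiableAt.fun_add (hit _ _) (hit _ _)),
      pd_add (hit _ _) (hit _ _), hpi, hpi]
  simp only [ric_apply, hp]
  simp only [sh, add_mul, mul_add, Finset.sum_add_distrib, Finset.sum_sub_distrib, ite_mul, mul_ite, zero_mul,
    mul_zero, Finset.sum_ite_eq, Finset.sum_ite_eq', Finset.mem_univ, if_true, cv1,
    Finset.sum_const, Finset.card_univ, Fintype.card_fin, nsmul_eq_mul, Finset.sum_ite_irrel]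
  simp only [hs _ j k, fun m i => hs m m i, ← Finset.mul_sum, ← Finset.sum_mul, fun m => mul_comm (θ m x) (Γ m k j x)]
  ring

end Leibniz

/-! ### Iterated derivatives and divergences under a projective shift. -/

section Shift

variable {n : ℕ} {Γ : LocalConn n} {w : ℝ} {θ : Fin n → Coord n → ℝ}

lemma cv1_cv0_sh (hΓ : ∀ k i j, ContDiff ℝ ∞ (Γ k i j)) (hθ : ∀ i, ContDiff ℝ ∞ (θ i))
    {φ : Coord n → ℝ} (hφ : ContDiff ℝ ∞ φ) {a : ℝ} (ha : a = w * (n + 1)) :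
    cv1 (sh Γ θ) w (cv0 (sh Γ θ) w φ) = fun i j x =>
      cv1 Γ w (cv0 Γ w φ) i j x + (-a) * (cv1 Γ 0 θ i j x * φ x)
        + (-(1 + a)) * (θ i x * cv0 Γ w φ j x) + (-(1 + a)) * (θ j x * cv0 Γ w φ i x)
        + (a * (2 + a)) * (θ i x * (θ j x * φ x)) := by
  have e0 : cv0 (sh Γ θ) w φ = fun i x => cv0 Γ w φ i x + (-a) * (θ i x * φ x) := by
    rw [cv0_sh]; funext i x; rw [ha]; ring
  rw [cv1_sh, e0, cv1_lin, cv1_form_mul hθ hφ]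
  · funext i j x
    rw [← ha]
    ring
  all_goals fun_prop

/-- The last three terms keep the shifted second derivative unexpanded. They come from the outermost
shift and are expanded only after contraction with a symmetric symbol, where index permutations no
longer matter. -/
lemma cv2_cv1_cv0_sh (hΓ : ∀ k i j, ContDiff ℝ ∞ (Γ k i j)) (hθ : ∀ i, ContDiff ℝ ∞ (θ i))
    {φ : Coord n → ℝ} (hφ : ContDiff ℝ ∞ φ) {a : ℝ} (ha : a = w * (n + 1)) (i j k : Fin n)
    (x : Coord n) :
    cv2 (sh Γ θ) w (cv1 (sh Γ θ) w (cv0 (sh Γ θ) w φ)) i j k x =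
      cv2 Γ w (cv1 Γ w (cv0 Γ w φ)) i j k x
        + (-a) * (cv2 Γ 0 (cv1 Γ 0 θ) i j k x * φ x + cv1 Γ 0 θ j k x * cv0 Γ w φ i x)
        + (-(1 + a)) * (cv1 Γ 0 θ i j x * cv0 Γ w φ k x + θ j x * cv1 Γ w (cv0 Γ w φ) i k x)
        + (-(1 + a)) * (cv1 Γ 0 θ i k x * cv0 Γ w φ j x + θ k x * cv1 Γ w (cv0 Γ w φ) i j x)
        + (a * (2 + a)) * (cv1 Γ 0 θ i j x * (θ k x * φ x)
            + θ j x * (cv1 Γ 0 θ i k x * φ x + θ k x * cv0 Γ w φ i x))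
        - θ j x * cv1 (sh Γ θ) w (cv0 (sh Γ θ) w φ) i k x
        - θ k x * cv1 (sh Γ θ) w (cv0 (sh Γ θ) w φ) j i x
        - (2 + a) * (θ i x * cv1 (sh Γ θ) w (cv0 (sh Γ θ) w φ) j k x) := by
  rw [cv2_sh, ← ha]
  beta_reduce
  congr 3
  rw [cv1_cv0_sh hΓ hθ hφ ha, cv2_lin, cv2_lin, cv2_lin, cv2_lin, cv2_form_mul, cv2_form_tmul hθ,
    cv2_form_tmul_swap hθ, cv2_form_tmul hθ, cv1_form_mul hθ hφ]
  all_goals fun_prop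

variable {P : Fin n → Fin n → Fin n → Coord n → ℝ}

lemma dv3_symm (h12 : ∀ i j k x, P i j k x = P j i k x)
    (i j : Fin n) (x : Coord n) : dv3 Γ w P i j x = dv3 Γ w P j i x := by
  have h12' : ∀ i j k, P i j k = P j i k := fun i j k => funext (h12 i j k)
  simp only [dv3]
  refine Finset.sum_congr rfl fun k _ => ?_
  have e1 : ∑ m, Γ i k m x * P m j k x = ∑ m, Γ i k m x * P j m k x :=
    Finset.sum_congr rfl fun m _ => by rw [h12]
  have e2 : ∑ m, Γ j k m x * P i m k x = ∑ m, Γ j k m x * P m i k x :=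
    Finset.sum_congr rfl fun m _ => by rw [h12]
  have e3 : ∑ m, Γ k k m x * P i j m x = ∑ m, Γ k k m x * P j i m x :=
    Finset.sum_congr rfl fun m _ => by rw [h12]
  rw [h12' i j k, e1, e2, e3]
  ring

lemma sum_rotate₃ {ι : Type*} [Fintype ι] (f : ι → ι → ι → ℝ) :
    ∑ i, ∑ j, ∑ k, f i j k = ∑ k, ∑ i, ∑ j, f i j k := by
  conv_lhs => enter [2, j]; rw [Finset.sum_comm]
  rw [Finset.sum_comm]

/-- The constant of the rank-two divergence is e-2. The contraction of θ with the first divergence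
arises once from the inner shift, with factor e, and once from the outer shift, with factor e-2; the
sum 2e-2 vanishes at e = 1. -/
lemma dv2_dv3_sh (h12 : ∀ i j k x, P i j k x = P j i k x) (h23 : ∀ i j k x, P i j k x = P i k j x)
    (hΓ : ∀ k i j, ContDiff ℝ ∞ (Γ k i j)) (hθ : ∀ i, ContDiff ℝ ∞ (θ i))
    (hP : ∀ i j k, ContDiff ℝ ∞ (P i j k)) {e : ℝ} (he : e = n + 5 - w * (n + 1)) :
    dv2 (sh Γ θ) w (dv3 (sh Γ θ) w P) = fun i x => dv2 Γ w (dv3 Γ w P) i x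
      + e * (∑ j, ∑ k, cv1 Γ 0 θ j k x * P i j k x)
      + (2 * e - 2) * (∑ k, θ k x * dv3 Γ w P i k x)
      + (e * (e - 2)) * (∑ j, θ j x * ∑ k, θ k x * P i j k x) := by
  rw [dv3_sh P h12 h23, ← he, dv2_sh, dv2_lin, dv2_form_contract h23 hθ hP]
  · have h2 : (n : ℝ) + 3 - w * (n + 1) = e - 2 := by rw [he]; ring
    funext i x
    rw [h2]
    simp only [mul_add, Finset.sum_add_distrib, mul_left_comm (θ _ x) e, ← Finset.mul_sum]
    ring
  · fun_prop
  · fun_prop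
  · intro i j x
    rw [dv3_symm h12 i j x]
    simp only [h12 i j]

/-- The three levels of divergence have constants e, e-2 and e-4. Their sum 3e-6 multiplies the
contraction of θ with the second divergence and vanishes at e = 2. -/
lemma dv1_dv2_dv3_sh (h12 : ∀ i j k x, P i j k x = P j i k x)
    (h23 : ∀ i j k x, P i j k x = P i k j x)
    (hΓ : ∀ k i j, ContDiff ℝ ∞ (Γ k i j)) (hθ : ∀ i, ContDiff ℝ ∞ (θ i))
    (hP : ∀ i j k, ContDiff ℝ ∞ (P i j k)) {e : ℝ} (he : e = n + 5 - w * (n + 1)) (x : Coord n) :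
    dv1 (sh Γ θ) w (dv2 (sh Γ θ) w (dv3 (sh Γ θ) w P)) x = dv1 Γ w (dv2 Γ w (dv3 Γ w P)) x
      + e * (∑ i, ∑ j, ∑ k, P i j k x * cv2 Γ 0 (cv1 Γ 0 θ) i j k x)
      + (3 * e - 2) * (∑ i, ∑ j, dv3 Γ w P i j x * cv1 Γ 0 θ i j x)
      + (3 * e - 6) * (∑ k, dv2 Γ w (dv3 Γ w P) k x * θ k x)
      + (e * (3 * e - 8)) * (∑ i, ∑ j, ∑ k, P i j k x * (θ i x * cv1 Γ 0 θ j k x))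
      + (e * (e - 2) + (e - 4) * (2 * e - 2)) * (∑ i, ∑ j, dv3 Γ w P i j x * (θ i x * θ j x))
      + (e * (e - 2) * (e - 4)) * (∑ i, ∑ j, ∑ k, P i j k x * (θ i x * (θ j x * θ k x))) := by
  have hr : ∀ i j k, P i j k = P j k i := fun i j k => funext fun x => by rw [h12, h23]
  have hB : ∀ i j, dv3 Γ w P i j = dv3 Γ w P j i := fun i j => funext fun x => dv3_symm h12 i j x
  have E1 : dv1 Γ w (fun i x => ∑ j, ∑ k, cv1 Γ 0 θ j k x * P i j k x) x
      = (∑ i, ∑ j, ∑ k, P i j k x * cv2 Γ 0 (cv1 Γ 0 θ) i j k x)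
        + ∑ i, ∑ j, dv3 Γ w P i j x * cv1 Γ 0 θ i j x := by
    have h : (fun i x => ∑ j, ∑ k, cv1 Γ 0 θ j k x * P i j k x)
        = fun i x => ∑ j, ∑ k, cv1 Γ 0 θ j k x * P j k i x := by
      funext i x; simp only [hr i]
    rw [h, dv1_form_contract₂ (by fun_prop) hP]
    beta_reduce
    congr 1
    · rw [sum_rotate₃]
      exact Finset.sum_congr rfl fun i _ => Finset.sum_congr rfl fun j _ =>
        Finset.sum_congr rfl fun k _ => by rw [hr i j k, mul_comm]
    · exact Finset.sum_congr rfl fun i _ => Finset.sum_congr rfl fun j _ => mul_comm _ _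
  have E2 : dv1 Γ w (fun i x => ∑ k, θ k x * dv3 Γ w P i k x) x
      = (∑ i, ∑ j, dv3 Γ w P i j x * cv1 Γ 0 θ i j x) + ∑ k, dv2 Γ w (dv3 Γ w P) k x * θ k x := by
    have h : (fun i x => ∑ k, θ k x * dv3 Γ w P i k x)
        = fun i x => ∑ k, θ k x * dv3 Γ w P k i x := by
      funext i x
      exact Finset.sum_congr rfl fun k _ => by rw [hB]
    rw [h, dv1_form_contract hθ (by fun_prop)]
    beta_reduce
    congr 1
    · rw [Finset.sum_comm]
      exact Finset.sum_congr rfl fun i _ => Finset.sum_congr rfl fun j _ => by rw [hB, mul_comm]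
    · exact Finset.sum_congr rfl fun i _ => mul_comm _ _
  -- Either of the two factors θ may be differentiated, and by the symmetry of P the two results
  -- agree; hence the factor 2.
  have E3 : dv1 Γ w (fun i x => ∑ j, θ j x * ∑ k, θ k x * P i j k x) x
      = 2 * (∑ i, ∑ j, ∑ k, P i j k x * (θ i x * cv1 Γ 0 θ j k x))
        + ∑ i, ∑ j, dv3 Γ w P i j x * (θ i x * θ j x) := by
    have h : (fun i x => ∑ j, θ j x * ∑ k, θ k x * P i j k x)
        = fun i x => ∑ j, θ j x * (fun j i x => ∑ k, θ k x * P j i k x) j i x := by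
      funext i x
      exact Finset.sum_congr rfl fun j _ => by beta_reduce; simp only [fun k => h12 i j k x]
    rw [h, dv1_form_contract hθ (by fun_prop), dv2_form_contract h23 hθ hP]
    beta_reduce
    simp only [mul_add, Finset.sum_add_distrib, two_mul, add_assoc]
    congr 1
    · simp only [Finset.mul_sum]
      rw [sum_reverse₃]
      exact Finset.sum_congr rfl fun i _ => Finset.sum_congr rfl fun j _ =>
        Finset.sum_congr rfl fun k _ => by rw [← hr, hr i, h12, hr i j k]; ring
    congr 1
    · simp only [Finset.mul_sum]
      exact Finset.sum_congr rfl fun i _ => Finset.sum_congr rfl fun j _ =>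
        Finset.sum_congr rfl fun k _ => by ring
    · simp only [Finset.mul_sum]
      exact Finset.sum_congr rfl fun i _ => Finset.sum_congr rfl fun j _ => by ring
  rw [dv2_dv3_sh h12 h23 hΓ hθ hP he, dv1_sh, dv1_lin, dv1_lin, dv1_lin]
  · beta_reduce
    rw [E1, E2, E3]
    have h3 : (n : ℝ) + 1 - w * (n + 1) = e - 4 := by rw [he]; ring
    have e1 : ∑ k, θ k x * (dv2 Γ w (dv3 Γ w P) k x
        + e * (∑ i, ∑ j, cv1 Γ 0 θ i j x * P k i j x)
        + (2 * e - 2) * (∑ j, θ j x * dv3 Γ w P k j x)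
        + (e * (e - 2)) * (∑ j, θ j x * ∑ i, θ i x * P k j i x))
        = (∑ k, dv2 Γ w (dv3 Γ w P) k x * θ k x)
          + e * (∑ i, ∑ j, ∑ k, P i j k x * (θ i x * cv1 Γ 0 θ j k x))
          + (2 * e - 2) * (∑ i, ∑ j, dv3 Γ w P i j x * (θ i x * θ j x))
          + (e * (e - 2)) * (∑ i, ∑ j, ∑ k, P i j k x * (θ i x * (θ j x * θ k x))) := by
      simp only [Finset.mul_sum, ← Finset.sum_add_distrib]
      refine Finset.sum_congr rfl fun k _ => ?_
      simp only [mul_add, Finset.mul_sum, ← Finset.sum_add_distrib, add_assoc]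
      rw [mul_comm (θ k x) (dv2 _ _ _ _ _)]
      refine congrArg _ (Finset.sum_congr rfl fun i _ => ?_)
      simp only [← add_assoc, ← Finset.mul_sum]
      have s1 : ∑ l, P k i l x * (θ k x * cv1 Γ 0 θ i l x)
          = θ k x * ∑ l, cv1 Γ 0 θ i l x * P k i l x := by
        rw [Finset.mul_sum]; exact Finset.sum_congr rfl fun l _ => by ring
      have s2 : ∑ l, P k i l x * (θ k x * (θ i x * θ l x))
          = θ k x * (θ i x * ∑ l, θ l x * P k i l x) := by
        simp only [Finset.mul_sum]; exact Finset.sum_congr rfl fun l _ => by ring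
      rw [s1, s2]
      ring
    rw [h3, e1]
    ring
  all_goals fun_prop

end Shift

/-! ### Full contractions with symmetric tensors. -/

section Contraction

variable {ι : Type*} [Fintype ι]

/-- Full contraction of two tensors of rank three. -/
def dot₃ (P X : ι → ι → ι → ℝ) : ℝ := ∑ i, ∑ j, ∑ k, P i j k * X i j k

/-- Full contraction of two tensors of rank two. -/
def dot₂ (B X : ι → ι → ℝ) : ℝ := ∑ i, ∑ j, B i j * X i j

/-- Full contraction of two tensors of rank one. -/
def dot₁ (V X : ι → ℝ) : ℝ := ∑ i, V i * X i

lemma dot₃_add_mul (P X Y : ι → ι → ι → ℝ) (c : ℝ) :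
    dot₃ P (fun i j k => X i j k + c * Y i j k) = dot₃ P X + c * dot₃ P Y := by
  simp only [dot₃, mul_add, Finset.sum_add_distrib, mul_left_comm _ c, ← Finset.mul_sum]

lemma dot₂_add_mul (P X Y : ι → ι → ℝ) (c : ℝ) :
    dot₂ P (fun i j => X i j + c * Y i j) = dot₂ P X + c * dot₂ P Y := by
  simp only [dot₂, mul_add, Finset.sum_add_distrib, mul_left_comm _ c, ← Finset.mul_sum]

/-- A symmetric P sees only the symmetrisation of the other factor. An identity of contractions thus
reduces to an identity between components summed over the six permutations, which `ring` can decide.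
-/
lemma dot₃_eq_of_symm {P : ι → ι → ι → ℝ} (h12 : ∀ i j k, P i j k = P j i k)
    (h23 : ∀ i j k, P i j k = P i k j) {X Y : ι → ι → ι → ℝ}
    (h : ∀ i j k, X i j k + X i k j + X j i k + X j k i + X k i j + X k j i
      = Y i j k + Y i k j + Y j i k + Y j k i + Y k i j + Y k j i) : dot₃ P X = dot₃ P Y := by
  have s23 : ∀ Z : ι → ι → ι → ℝ, dot₃ P Z = dot₃ P (fun i j k => Z i k j) := by
    intro Z
    unfold dot₃
    refine Finset.sum_congr rfl fun i _ => ?_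
    rw [Finset.sum_comm]
    exact Finset.sum_congr rfl fun j _ => Finset.sum_congr rfl fun k _ => by rw [h23]
  have s12 : ∀ Z : ι → ι → ι → ℝ, dot₃ P Z = dot₃ P (fun i j k => Z j i k) := by
    intro Z
    unfold dot₃
    rw [Finset.sum_comm]
    exact Finset.sum_congr rfl fun i _ => Finset.sum_congr rfl fun j _ =>
      Finset.sum_congr rfl fun k _ => by rw [h12]
  -- The two transpositions generate all six permutations, and each leaves the contraction with P
  -- unchanged.
  have key : ∀ Z : ι → ι → ι → ℝ, 6 * dot₃ P Z = dot₃ P (fun i j k =>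
      Z i j k + Z i k j + Z j i k + Z j k i + Z k i j + Z k j i) := by
    intro Z
    have e : dot₃ P (fun i j k => Z i j k + Z i k j + Z j i k + Z j k i + Z k i j + Z k j i)
        = dot₃ P Z + dot₃ P (fun i j k => Z i k j) + dot₃ P (fun i j k => Z j i k)
          + dot₃ P (fun i j k => Z j k i) + dot₃ P (fun i j k => Z k i j)
          + dot₃ P (fun i j k => Z k j i) := by
      simp only [dot₃, mul_add, Finset.sum_add_distrib]
    have e1 := s23 Z
    have e2 := s12 Z
    have e3 := s23 (fun i j k => Z j i k)
    have e4 := s12 (fun i j k => Z i k j)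
    have e5 := s12 (fun i j k => Z k i j)
    beta_reduce at e3 e4 e5
    rw [e]
    linarith
  have := key X
  have h' := key Y
  simp only [h] at this
  linarith

lemma dot₂_eq_of_symm {B : ι → ι → ℝ} (hB : ∀ i j, B i j = B j i) {X Y : ι → ι → ℝ}
    (h : ∀ i j, X i j + X j i = Y i j + Y j i) : dot₂ B X = dot₂ B Y := by
  have s : ∀ Z : ι → ι → ℝ, dot₂ B Z = dot₂ B (fun i j => Z j i) := by
    intro Z
    unfold dot₂
    rw [Finset.sum_comm]
    exact Finset.sum_congr rfl fun i _ => Finset.sum_congr rfl fun j _ => by rw [hB]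
  have e : ∀ Z : ι → ι → ℝ, dot₂ B (fun i j => Z i j + Z j i)
      = dot₂ B Z + dot₂ B (fun i j => Z j i) := by
    intro Z
    simp only [dot₂, mul_add, Finset.sum_add_distrib]
  have h1 := e X
  have h2 := e Y
  have h3 := s X
  have h4 := s Y
  simp only [h] at h1
  linarith

end Contraction

/-! ### The quantization formula in terms of iterated divergences. -/

section Formula

variable {n : ℕ}

/-- The quantization formula written with divergences of the symbol. -/
def quantDiv (κ : Coeffs) (lam del : ℝ) (Γ : LocalConn n) (P : Fin n → Fin n → Fin n → Coord n → ℝ)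
    (φ : Coord n → ℝ) (x : Coord n) : ℝ :=
  dot₃ (fun i j k => P i j k x) (fun i j k => cv2 Γ lam (cv1 Γ lam (cv0 Γ lam φ)) i j k x)
    + κ.α * dot₂ (fun i j => dv3 Γ del P i j x) (fun i j => cv1 Γ lam (cv0 Γ lam φ) i j x)
    + (κ.β₁ * dot₁ (fun k => dv2 Γ del (dv3 Γ del P) k x) (fun k => cv0 Γ lam φ k x)
      + κ.β₂ * dot₃ (fun i j k => P i j k x) (fun i j k => ric Γ i j x * cv0 Γ lam φ k x))
    + (κ.η₁ * dv1 Γ del (dv2 Γ del (dv3 Γ del P)) x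
      + κ.η₂ * dot₂ (fun i j => dv3 Γ del P i j x) (fun i j => ric Γ i j x)
      + κ.η₃ * dot₃ (fun i j k => P i j k x) (fun i j k => cv2 Γ 0 (ric Γ) i j k x)) * φ x

lemma covD_zero_zero (Γ : LocalConn n) (w : ℝ) (φ : LocalTensor n 0 0) (a : Fin 0 → Fin n)
    (b : Fin 1 → Fin n) : covD Γ w φ a b = cv0 Γ w (φ ![] ![]) (b 0) := by
  funext x
  simp [covD, cv0, gam, Subsingleton.elim (Fin.tail b) ![], Subsingleton.elim a ![]]

lemma covD_zero_one (Γ : LocalConn n) (w : ℝ) (f : LocalTensor n 0 1) (i j : Fin n) :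
    covD Γ w f ![] ![i, j] = cv1 Γ w (fun i => f ![] ![i]) i j := by
  have e1 : Fin.tail ![i, j] = ![j] := rfl
  have e2 : ∀ m, Function.update ![j] 0 m = ![m] := fun m => by ext s; fin_cases s; rfl
  funext x
  simp [covD, cv1, gam, e1, e2]

lemma covD_zero_two (Γ : LocalConn n) (w : ℝ) (f : LocalTensor n 0 2) (i j k : Fin n) :
    covD Γ w f ![] ![i, j, k] = cv2 Γ w (fun i j => f ![] ![i, j]) i j k := by
  have e1 : Fin.tail ![i, j, k] = ![j, k] := rfl
  have e2 : ∀ m, Function.update ![j, k] 0 m = ![m, k] := fun m => by ext s; fin_cases s <;> rfl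
  have e3 : ∀ m, Function.update ![j, k] 1 m = ![j, m] := fun m => by ext s; fin_cases s <;> rfl
  funext x
  simp [covD, cv2, gam, e1, e2, e3, Fin.sum_univ_two]
  ring

lemma update_three (i j k m : Fin n) : Function.update ![i, j, k] 0 m = ![m, j, k] ∧
    Function.update ![i, j, k] 1 m = ![i, m, k] ∧ Function.update ![i, j, k] 2 m = ![i, j, m] := by
  refine ⟨?_, ?_, ?_⟩ <;> · ext s; fin_cases s <;> rfl

lemma covD_three (Γ : LocalConn n) (w : ℝ) {q : ℕ} (T : LocalTensor n 3 q) (i j k : Fin n)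
    (b : Fin (q + 1) → Fin n) (x : Coord n) : covD Γ w T ![i, j, k] b x =
    pd (b 0) (T ![i, j, k] (Fin.tail b)) x
      + ∑ m, Γ i (b 0) m x * T ![m, j, k] (Fin.tail b) x
      + ∑ m, Γ j (b 0) m x * T ![i, m, k] (Fin.tail b) x
      + ∑ m, Γ k (b 0) m x * T ![i, j, m] (Fin.tail b) x
      - w * gam Γ (b 0) x * T ![i, j, k] (Fin.tail b) x
      - ∑ s, ∑ m, Γ m (b 0) (Fin.tail b s) x *
          T ![i, j, k] (Function.update (Fin.tail b) s m) x := by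
  simp only [covD, Fin.sum_univ_three, (update_three i j k _).1, (update_three i j k _).2.1,
    (update_three i j k _).2.2, gam]
  simp
  ring

lemma sum_covD_three (Γ : LocalConn n) (w : ℝ) (P : LocalTensor n 3 0) (i j : Fin n) :
    (fun x => ∑ k, covD Γ w P ![i, j, k] ![k] x) = dv3 Γ w (fun i j k => P ![i, j, k] ![]) i j := by
  funext x
  simp only [dv3]
  refine Finset.sum_congr rfl fun k _ => ?_
  rw [covD_three]
  simp [Subsingleton.elim (Fin.tail ![k]) ![]]

/-- A trace commutes with covariant differentiation: the Christoffel terms of the upper and of the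
lower copy of the summed index cancel (`c2`). -/
lemma sum_covD_contract_one (Γ : LocalConn n) (w : ℝ) (T : LocalTensor n 3 1) (i k l : Fin n)
    (x : Coord n) (hT : ∀ a b, DifferentiableAt ℝ (T a b) x) :
    ∑ j, covD Γ w T ![i, j, k] ![l, j] x
      = pd l (fun x => ∑ j, T ![i, j, k] ![j] x) x
        + ∑ m, Γ i l m x * (∑ j, T ![m, j, k] ![j] x)
        + ∑ m, Γ k l m x * (∑ j, T ![i, j, m] ![j] x)
        - w * gam Γ l x * ∑ j, T ![i, j, k] ![j] x := by
  have e1 : ∀ j : Fin n, Fin.tail ![l, j] = ![j] := fun j => rfl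
  have e2 : ∀ j m : Fin n, Function.update ![j] 0 m = ![m] := fun j m => by ext s; fin_cases s; rfl
  rw [pd_sum (f := fun j => T ![i, j, k] ![j]) fun j _ => hT _ _]
  have c1 : ∑ j, ∑ m, Γ i l m x * T ![m, j, k] ![j] x
      = ∑ m, Γ i l m x * (∑ j, T ![m, j, k] ![j] x) := by
    simp only [Finset.mul_sum]
    exact Finset.sum_comm
  have c2 : ∑ j, ∑ m, Γ j l m x * T ![i, m, k] ![j] x
      = ∑ j, ∑ m, Γ m l j x * T ![i, j, k] ![m] x := Finset.sum_comm
  have c3 : ∑ j, ∑ m, Γ k l m x * T ![i, j, m] ![j] x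
      = ∑ m, Γ k l m x * (∑ j, T ![i, j, m] ![j] x) := by
    simp only [Finset.mul_sum]
    exact Finset.sum_comm
  simp only [covD_three, e1, Fin.sum_univ_one, e2, Matrix.cons_val_zero, Finset.sum_add_distrib,
    Finset.sum_sub_distrib]
  simp [c1, c2, c3, ← Finset.mul_sum]
  ring

lemma sum_covD_contract_two (Γ : LocalConn n) (w : ℝ) (T : LocalTensor n 3 2) (i l : Fin n)
    (x : Coord n) (hT : ∀ a b, DifferentiableAt ℝ (T a b) x) :
    ∑ j, ∑ k, covD Γ w T ![i, j, k] ![l, j, k] x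
      = pd l (fun x => ∑ j, ∑ k, T ![i, j, k] ![j, k] x) x
        + ∑ m, Γ i l m x * (∑ j, ∑ k, T ![m, j, k] ![j, k] x)
        - w * gam Γ l x * ∑ j, ∑ k, T ![i, j, k] ![j, k] x := by
  have e1 : ∀ j k : Fin n, Fin.tail ![l, j, k] = ![j, k] := fun j k => rfl
  have e2 : ∀ j k m : Fin n, Function.update ![j, k] 0 m = ![m, k] := fun j k m => by
    ext s; fin_cases s <;> rfl
  have e3 : ∀ j k m : Fin n, Function.update ![j, k] 1 m = ![j, m] := fun j k m => by
    ext s; fin_cases s <;> rfl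
  rw [pd_sum (f := fun j x => ∑ k, T ![i, j, k] ![j, k] x) fun j _ =>
    DifferentiableAt.fun_sum fun k _ => hT _ _]
  have e4 : ∀ j, pd l (fun x => ∑ k, T ![i, j, k] ![j, k] x) x
      = ∑ k, pd l (T ![i, j, k] ![j, k]) x := fun j =>
    pd_sum (f := fun k => T ![i, j, k] ![j, k]) fun k _ => hT _ _
  have c1 : ∑ j, ∑ k, ∑ m, Γ i l m x * T ![m, j, k] ![j, k] x
      = ∑ m, Γ i l m x * (∑ j, ∑ k, T ![m, j, k] ![j, k] x) := by
    simp only [Finset.mul_sum]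
    exact sum_rotate₃ _
  have c2 : ∑ j, ∑ k, ∑ m, Γ j l m x * T ![i, m, k] ![j, k] x
      = ∑ j, ∑ k, ∑ m, Γ m l j x * T ![i, j, k] ![m, k] x := sum_reverse₃ _
  have c3 : ∑ j, ∑ k, ∑ m, Γ k l m x * T ![i, j, m] ![j, k] x
      = ∑ j, ∑ k, ∑ m, Γ m l k x * T ![i, j, k] ![j, m] x :=
    Finset.sum_congr rfl fun j _ => Finset.sum_comm
  simp only [covD_three, e1, Fin.sum_univ_two, e2, e3, e4, Matrix.cons_val_zero,
    Matrix.cons_val_one, Finset.sum_add_distrib, Finset.sum_sub_distrib]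
  simp [c1, c2, c3, ← Finset.mul_sum]
  ring

/-- Covariant differentiation treats all upper slots alike, so a symmetry of the upper indices
survives any number of derivatives. -/
lemma covD_swap {q : ℕ} {Γ : LocalConn n} {w : ℝ} {T : LocalTensor n 3 q}
    (h : ∀ i j k b, T ![i, j, k] b = T ![i, k, j] b) (i j k : Fin n) (b : Fin (q + 1) → Fin n) :
    covD Γ w T ![i, j, k] b = covD Γ w T ![i, k, j] b := by
  funext x
  simp only [covD_three, h i k j, fun m => h m k j, fun m => h i m j, fun m => h i k m]
  ring

lemma covD_swap' {q : ℕ} {Γ : LocalConn n} {w : ℝ} {T : LocalTensor n 3 q}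
    (h : ∀ i j k b, T ![i, j, k] b = T ![j, i, k] b) (i j k : Fin n) (b : Fin (q + 1) → Fin n) :
    covD Γ w T ![i, j, k] b = covD Γ w T ![j, i, k] b := by
  funext x
  simp only [covD_three, h j i k, fun m => h j i m, fun m => h m i k, fun m => h j m k]
  ring

lemma contDiff_covD {p q : ℕ} {Γ : LocalConn n} (hΓ : ∀ k i j, ContDiff ℝ ∞ (Γ k i j)) (w : ℝ)
    {T : LocalTensor n p q} (hT : ∀ a b, ContDiff ℝ ∞ (T a b)) (a : Fin p → Fin n)
    (b : Fin (q + 1) → Fin n) : ContDiff ℝ ∞ (covD Γ w T a b) := by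
  unfold covD
  fun_prop

lemma symbol_perm {P : LocalTensor n 3 0}
    (hs : ∀ (σ : Equiv.Perm (Fin 3)) a b, P (a ∘ σ) b = P a b) (i j k : Fin n) :
    P ![i, j, k] ![] = P ![j, i, k] ![] ∧ P ![i, j, k] ![] = P ![i, k, j] ![] := by
  constructor
  · rw [← hs (Equiv.swap 0 1) ![j, i, k]]
    congr 1; ext s; fin_cases s <;> rfl
  · rw [← hs (Equiv.swap 1 2) ![i, k, j]]
    congr 1; ext s; fin_cases s <;> rfl

/-- The original formula first takes all derivatives of P and then contracts. Since traces commute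
with derivatives, each contraction can be moved inside, and since P is symmetric it can be placed in
the last slot. In this form the effect of a shift is governed by the constants of the successive
divergences. -/
lemma quantLocal_eq_quantDiv (κ : Coeffs) (lam del : ℝ) {Γ : LocalConn n}
    (hΓ : ∀ k i j, ContDiff ℝ ∞ (Γ k i j)) {P : LocalTensor n 3 0}
    (hP : ∀ a b, ContDiff ℝ ∞ (P a b)) (hs : ∀ (σ : Equiv.Perm (Fin 3)) a b, P (a ∘ σ) b = P a b)
    (φ : LocalTensor n 0 0) (a b : Fin 0 → Fin n) (x : Coord n) :
    quantLocal κ lam del Γ P φ a b x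
      = quantDiv κ lam del Γ (fun i j k => P ![i, j, k] ![]) (φ ![] ![]) x := by
  have hsym := symbol_perm hs
  have h1 := contDiff_covD hΓ del hP
  have h2 := contDiff_covD hΓ del h1
  have F1 : ∀ k, covD Γ lam φ ![] ![k] = cv0 Γ lam (φ ![] ![]) k := fun k =>
    covD_zero_zero Γ lam φ ![] ![k]
  have F2 : ∀ i j, covD Γ lam (covD Γ lam φ) ![] ![i, j] = cv1 Γ lam (cv0 Γ lam (φ ![] ![])) i j :=
    fun i j => by rw [covD_zero_one]; simp only [F1]
  have F3 : ∀ i j k, covD Γ lam (covD Γ lam (covD Γ lam φ)) ![] ![i, j, k]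
      = cv2 Γ lam (cv1 Γ lam (cv0 Γ lam (φ ![] ![]))) i j k :=
    fun i j k => by rw [covD_zero_two]; simp only [F2]
  have G1 : ∀ i j, (fun x => ∑ k, covD Γ del P ![i, j, k] ![k] x)
      = dv3 Γ del (fun i j k => P ![i, j, k] ![]) i j := sum_covD_three Γ del P
  have t0 : ∀ i j k b, P ![i, j, k] b = P ![i, k, j] b := fun i j k b => by
    rw [Subsingleton.elim b ![]]; exact (hsym i j k).2
  have t0' : ∀ i j k b, P ![i, j, k] b = P ![j, i, k] b := fun i j k b => by
    rw [Subsingleton.elim b ![]]; exact (hsym i j k).1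
  have t1 := covD_swap (Γ := Γ) (w := del) t0
  have t2 := covD_swap (Γ := Γ) (w := del) t1
  have t2' := covD_swap' (Γ := Γ) (w := del) (covD_swap' (Γ := Γ) (w := del) t0')
  have G1' : ∀ i k, (fun x => ∑ j, covD Γ del P ![i, j, k] ![j] x)
      = dv3 Γ del (fun i j k => P ![i, j, k] ![]) i k := by
    intro i k
    rw [← G1]
    funext x
    exact Finset.sum_congr rfl fun j _ => by rw [t1]
  have G1x : ∀ i k x, ∑ j, covD Γ del P ![i, j, k] ![j] x
      = dv3 Γ del (fun i j k => P ![i, j, k] ![]) i k x := fun i k => congrFun (G1' i k)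
  have hB : ∀ i j, dv3 Γ del (fun i j k => P ![i, j, k] ![]) i j
      = dv3 Γ del (fun i j k => P ![i, j, k] ![]) j i := fun i j => funext fun x =>
    dv3_symm (fun i j k x => congrFun (hsym i j k).1 x) i j x
  have G2 : ∀ k, (fun x => ∑ i, ∑ j, covD Γ del (covD Γ del P) ![i, j, k] ![i, j] x)
      = dv2 Γ del (dv3 Γ del (fun i j k => P ![i, j, k] ![])) k := by
    intro k
    funext x
    simp only [dv2]
    refine Finset.sum_congr rfl fun i _ => ?_
    rw [sum_covD_contract_one Γ del _ i k i x fun a b => ContDiff.diffAt (h1 a b) x]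
    simp only [G1x]
    have e : ∑ m, Γ i i m x * dv3 Γ del (fun i j k => P ![i, j, k] ![]) m k x
        = ∑ m, Γ i i m x * dv3 Γ del (fun i j k => P ![i, j, k] ![]) k m x :=
      Finset.sum_congr rfl fun m _ => by rw [hB]
    have e' : ∑ m, Γ k i m x * dv3 Γ del (fun i j k => P ![i, j, k] ![]) i m x
        = ∑ m, Γ k i m x * dv3 Γ del (fun i j k => P ![i, j, k] ![]) m i x :=
      Finset.sum_congr rfl fun m _ => by rw [hB]
    rw [hB i k, e, e']
    ring
  have G2x : ∀ i x, ∑ j, ∑ k, covD Γ del (covD Γ del P) ![i, j, k] ![j, k] x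
      = dv2 Γ del (dv3 Γ del (fun i j k => P ![i, j, k] ![])) i x := by
    intro i x
    rw [← G2]
    exact Finset.sum_congr rfl fun j _ => Finset.sum_congr rfl fun k _ => by rw [t2', t2]
  have G3 : ∑ i, ∑ j, ∑ k, covD Γ del (covD Γ del (covD Γ del P)) ![i, j, k] ![i, j, k] x
      = dv1 Γ del (dv2 Γ del (dv3 Γ del (fun i j k => P ![i, j, k] ![]))) x := by
    simp only [dv1]
    refine Finset.sum_congr rfl fun i _ => ?_
    rw [sum_covD_contract_two Γ del _ i i x fun a b => ContDiff.diffAt (h2 a b) x]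
    simp only [G2x]
  have hr : ∀ i j, ricci Γ ![] ![i, j] = ric Γ i j := fun i j => rfl
  have hcr : ∀ i j k, covD Γ 0 (ricci Γ) ![] ![i, j, k] = cv2 Γ 0 (ric Γ) i j k := fun i j k =>
    covD_zero_two Γ 0 (ricci Γ) i j k
  have T2 : ∀ S : Fin n → Fin n → ℝ, ∑ i, ∑ j, ∑ k, covD Γ del P ![i, j, k] ![k] x * S i j
      = dot₂ (fun i j => dv3 Γ del (fun i j k => P ![i, j, k] ![]) i j x) S := by
    intro S
    simp only [← Finset.sum_mul, fun i j => congrFun (G1 i j) x]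
    rfl
  have T3 : ∑ i, ∑ j, ∑ k, covD Γ del (covD Γ del P) ![i, j, k] ![i, j] x
        * cv0 Γ lam (φ ![] ![]) k x
      = dot₁ (fun k => dv2 Γ del (dv3 Γ del (fun i j k => P ![i, j, k] ![])) k x)
        (fun k => cv0 Γ lam (φ ![] ![]) k x) := by
    rw [sum_rotate₃]
    simp only [← Finset.sum_mul, fun k => congrFun (G2 k) x]
    rfl
  simp only [quantLocal, quantDiv, F1, F2, F3, hr, hcr]
  rw [← T3, ← T2, ← T2]
  simp only [add_mul, Finset.sum_add_distrib, mul_assoc κ.β₁, mul_assoc κ.β₂, ← Finset.mul_sum, G3,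
    mul_assoc (P _ _ x), mul_comm (ric Γ _ _ x) (covD _ _ _ _ _ _), mul_comm _ (P _ _ x)]
  rfl

end Formula

/-! ### The change of the formula under a projective shift. -/

section ShiftFormula

variable {n : ℕ}

/-- The eleven coefficients of the change of the quantization formula under a projective change of
the connection, as functions of the constants `κ`, of `a = (n+1)λ`, `e = n+5-(n+1)δ` and
`r = n-1`. -/
def shiftCoeff (κ : Coeffs) (a e r : ℝ) : Fin 11 → ℝ :=
  ![κ.α * e - 6 - 3 * a,
    -κ.α * (2 + 2 * a) + κ.β₁ * (2 * e - 2),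
    -(2 + 3 * a) + κ.β₁ * e + κ.β₂ * r,
    a * (2 + a) + (4 + a) * (2 + 2 * a) - κ.α * e * (2 + 2 * a) + κ.β₁ * (e * (e - 2)) - κ.β₂ * r,
    -a * κ.β₁ + κ.η₁ * (3 * e - 6),
    -κ.α * a + κ.η₁ * (3 * e - 2) + κ.η₂ * r,
    κ.α * (a * (2 + a)) - a * κ.β₁ * (2 * e - 2)
      + κ.η₁ * (e * (e - 2) + (e - 4) * (2 * e - 2)) - κ.η₂ * r,
    -a + κ.η₁ * e + κ.η₃ * r,
    2 * a * (2 + a) + a * (4 + a) - κ.α * e * a - a * κ.β₁ * e - a * κ.β₂ * r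
      + κ.η₁ * (e * (3 * e - 8)) + κ.η₂ * r * e - 6 * κ.η₃ * r,
    -a * (4 + a) * (2 + a) + κ.α * e * (a * (2 + a)) - a * κ.β₁ * (e * (e - 2)) + a * κ.β₂ * r
      + κ.η₁ * (e * (e - 2) * (e - 4)) - κ.η₂ * r * e + 4 * κ.η₃ * r,
    -a * κ.β₂ + e * κ.η₂ - 4 * κ.η₃]

/-- The tensors whose contractions make up the change of the quantization formula. -/
def shiftTerm (lam del : ℝ) (Γ : LocalConn n) (θ : Fin n → Coord n → ℝ)
    (P : Fin n → Fin n → Fin n → Coord n → ℝ) (φ : Coord n → ℝ) (x : Coord n) : Fin 11 → ℝ :=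
  ![dot₃ (fun i j k => P i j k x) (fun i j k => θ i x * cv1 Γ lam (cv0 Γ lam φ) j k x),
    dot₂ (fun i j => dv3 Γ del P i j x) (fun i j => θ i x * cv0 Γ lam φ j x),
    dot₃ (fun i j k => P i j k x) (fun i j k => cv1 Γ 0 θ i j x * cv0 Γ lam φ k x),
    dot₃ (fun i j k => P i j k x) (fun i j k => θ i x * θ j x * cv0 Γ lam φ k x),
    dot₁ (fun k => dv2 Γ del (dv3 Γ del P) k x) (fun k => θ k x) * φ x,
    dot₂ (fun i j => dv3 Γ del P i j x) (fun i j => cv1 Γ 0 θ i j x) * φ x,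
    dot₂ (fun i j => dv3 Γ del P i j x) (fun i j => θ i x * θ j x) * φ x,
    dot₃ (fun i j k => P i j k x) (fun i j k => cv2 Γ 0 (cv1 Γ 0 θ) i j k x) * φ x,
    dot₃ (fun i j k => P i j k x) (fun i j k => θ i x * cv1 Γ 0 θ j k x) * φ x,
    dot₃ (fun i j k => P i j k x) (fun i j k => θ i x * (θ j x * θ k x)) * φ x,
    dot₃ (fun i j k => P i j k x) (fun i j k => θ i x * ric Γ j k x) * φ x]

variable {Γ : LocalConn n} {θ : Fin n → Coord n → ℝ}

lemma cv2_swap (w : ℝ) (A : Fin n → Fin n → Coord n → ℝ) :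
    cv2 Γ w (fun j k => A k j) = fun i j k => cv2 Γ w A i k j := by
  funext i j k x
  simp only [cv2]
  ring

lemma contDiff_ric (hΓ : ∀ k i j, ContDiff ℝ ∞ (Γ k i j)) (i j : Fin n) :
    ContDiff ℝ ∞ (ric Γ i j) := by
  have : ric Γ i j = fun x => ∑ m, (pd j (Γ m m i) x - pd m (Γ m j i) x
      + ∑ l, (Γ m j l x * Γ l m i x - Γ m m l x * Γ l j i x)) := rfl
  rw [this]
  fun_prop

lemma cv2_ric_sh (hs : ∀ k i j x, Γ k i j x = Γ k j i x) (hΓ : ∀ k i j, ContDiff ℝ ∞ (Γ k i j))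
    (hθ : ∀ i, ContDiff ℝ ∞ (θ i)) (i j k : Fin n) (x : Coord n) :
    cv2 (sh Γ θ) 0 (ric (sh Γ θ)) i j k x = cv2 Γ 0 (ric Γ) i j k x
      + n * cv2 Γ 0 (cv1 Γ 0 θ) i k j x + (-1) * cv2 Γ 0 (cv1 Γ 0 θ) i j k x
      + (-(n - 1)) * (cv1 Γ 0 θ i j x * θ k x + θ j x * cv1 Γ 0 θ i k x)
      - θ j x * ric (sh Γ θ) i k x - θ k x * ric (sh Γ θ) j i x
      - 2 * (θ i x * ric (sh Γ θ) j k x) := by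
  have hR := contDiff_ric hΓ
  rw [cv2_sh]
  beta_reduce
  rw [zero_mul, add_zero]
  congr 3
  have e : ric (sh Γ θ) = fun j k x => ric Γ j k x + n * cv1 Γ 0 θ k j x + (-1) * cv1 Γ 0 θ j k x
      + (-(n - 1)) * (θ j x * θ k x) := by
    rw [ric_sh hs hΓ hθ]
    funext j k x
    ring
  have e' : cv2 Γ 0 (fun j k x => cv1 Γ 0 θ k j x) = fun i j k => cv2 Γ 0 (cv1 Γ 0 θ) i k j :=
    cv2_swap 0 (cv1 Γ 0 θ)
  rw [e, cv2_lin, cv2_lin, cv2_lin, cv2_form_tmul hθ hθ, e']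
  all_goals fun_prop

lemma dot₃_mul_right {ι : Type*} [Fintype ι] (P X : ι → ι → ι → ℝ) (c : ℝ) :
    dot₃ P (fun i j k => X i j k * c) = dot₃ P X * c := by
  simp only [dot₃, ← mul_assoc, ← Finset.sum_mul]

lemma dot₂_mul_right {ι : Type*} [Fintype ι] (P X : ι → ι → ℝ) (c : ℝ) :
    dot₂ P (fun i j => X i j * c) = dot₂ P X * c := by
  simp only [dot₂, ← mul_assoc, ← Finset.sum_mul]

lemma dot₁_add_mul {ι : Type*} [Fintype ι] (P X Y : ι → ℝ) (c : ℝ) :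
    dot₁ P (fun i => X i + c * Y i) = dot₁ P X + c * dot₁ P Y := by
  simp only [dot₁, mul_add, Finset.sum_add_distrib, mul_left_comm _ c, ← Finset.mul_sum]

lemma dot₁_mul_right {ι : Type*} [Fintype ι] (P X : ι → ℝ) (c : ℝ) :
    dot₁ P (fun i => X i * c) = dot₁ P X * c := by
  simp only [dot₁, ← mul_assoc, ← Finset.sum_mul]

/-- Every contraction in the shifted formula is a linear combination of contractions in the original
one and of the eleven terms of `shiftTerm`. Collecting the combinations yields the coefficients. -/
lemma quantDiv_sh (κ : Coeffs) (lam del : ℝ) (hs : ∀ k i j x, Γ k i j x = Γ k j i x)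
    (hΓ : ∀ k i j, ContDiff ℝ ∞ (Γ k i j)) (hθ : ∀ i, ContDiff ℝ ∞ (θ i))
    {P : Fin n → Fin n → Fin n → Coord n → ℝ}
    (h12 : ∀ i j k x, P i j k x = P j i k x) (h23 : ∀ i j k x, P i j k x = P i k j x)
    (hP : ∀ i j k, ContDiff ℝ ∞ (P i j k)) {φ : Coord n → ℝ} (hφ : ContDiff ℝ ∞ φ) (x : Coord n) :
    quantDiv κ lam del (sh Γ θ) P φ x = quantDiv κ lam del Γ P φ x
      + ∑ s, shiftCoeff κ (lam * (n + 1)) (n + 5 - del * (n + 1)) (n - 1) s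
          * shiftTerm lam del Γ θ P φ x s := by
  obtain ⟨a, ha⟩ : ∃ a, a = lam * (n + 1) := ⟨_, rfl⟩
  obtain ⟨e, he⟩ : ∃ e, e = n + 5 - del * (n + 1) := ⟨_, rfl⟩
  have hB : ∀ i j, dv3 Γ del P i j x = dv3 Γ del P j i x := fun i j => dv3_symm h12 i j x
  have hc3 := fun X Y h => dot₃_eq_of_symm (P := fun i j k => P i j k x) (fun i j k => h12 i j k x)
    (fun i j k => h23 i j k x) (X := X) (Y := Y) h
  have hc2 := fun X Y h => dot₂_eq_of_symm (B := fun i j => dv3 Γ del P i j x) hB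
    (X := X) (Y := Y) h
  -- contraction of the shifted first divergence
  have D1 : ∀ X : Fin n → Fin n → ℝ, dot₂ (fun i j => dv3 (sh Γ θ) del P i j x) X
      = dot₂ (fun i j => dv3 Γ del P i j x) X
        + e * dot₃ (fun i j k => P i j k x) (fun i j k => X i j * θ k x) := by
    intro X
    rw [dv3_sh P h12 h23, ← he]
    simp only [dot₂, dot₃, add_mul, Finset.sum_add_distrib, Finset.mul_sum, Finset.sum_mul]
    congr 1
    exact Finset.sum_congr rfl fun i _ => Finset.sum_congr rfl fun j _ =>
      Finset.sum_congr rfl fun k _ => by ring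
  have D2 : ∀ X : Fin n → ℝ, dot₁ (fun k => dv2 (sh Γ θ) del (dv3 (sh Γ θ) del P) k x) X
      = dot₁ (fun k => dv2 Γ del (dv3 Γ del P) k x) X
        + e * dot₃ (fun i j k => P i j k x) (fun i j k => cv1 Γ 0 θ j k x * X i)
        + (2 * e - 2) * dot₂ (fun i j => dv3 Γ del P i j x) (fun i j => θ j x * X i)
        + (e * (e - 2)) * dot₃ (fun i j k => P i j k x) (fun i j k => θ j x * θ k x * X i) := by
    intro X
    rw [dv2_dv3_sh h12 h23 hΓ hθ hP he]
    simp only [dot₁, dot₂, dot₃, add_mul, Finset.sum_add_distrib, Finset.mul_sum, Finset.sum_mul]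
    congr 1
    · congr 1
      · congr 1
        exact Finset.sum_congr rfl fun i _ => Finset.sum_congr rfl fun j _ =>
          Finset.sum_congr rfl fun k _ => by ring
      · exact Finset.sum_congr rfl fun i _ => Finset.sum_congr rfl fun j _ => by ring
    · exact Finset.sum_congr rfl fun i _ => Finset.sum_congr rfl fun j _ =>
          Finset.sum_congr rfl fun k _ => by ring
  have Z3 : dot₃ (fun i j k => P i j k x) (fun _ _ _ => 0) = 0 := by simp [dot₃]
  have Z2 : dot₂ (fun i j => dv3 Γ del P i j x) (fun _ _ => 0) = 0 := by simp [dot₂]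
  -- The identities `M1` to `M11` other than `M4` follow one pattern: an expression with the same
  -- symmetrisation is proposed, `ring` compares the sums over permutations, and the contraction is
  -- split by linearity.
  have M1 : dot₃ (fun i j k => P i j k x) (fun i j k => cv2 (sh Γ θ) lam (cv1 (sh Γ θ) lam (cv0 (sh Γ θ) lam φ)) i j k x)
      = dot₃ (fun i j k => P i j k x) (fun i j k => cv2 Γ lam (cv1 Γ lam (cv0 Γ lam φ)) i j k x)
        + (-6 - 3 * a) * dot₃ (fun i j k => P i j k x) (fun i j k => θ i x * cv1 Γ lam (cv0 Γ lam φ) j k x)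
        + (-(2 + 3 * a)) * dot₃ (fun i j k => P i j k x) (fun i j k => cv1 Γ 0 θ i j x * cv0 Γ lam φ k x)
        + (a * (2 + a) + (4 + a) * (2 + 2 * a)) * dot₃ (fun i j k => P i j k x) (fun i j k => θ i x * θ j x * cv0 Γ lam φ k x)
        + (2 * a * (2 + a) + a * (4 + a)) * (dot₃ (fun i j k => P i j k x) (fun i j k => θ i x * cv1 Γ 0 θ j k x) * φ x)
        + (-a) * (dot₃ (fun i j k => P i j k x) (fun i j k => cv2 Γ 0 (cv1 Γ 0 θ) i j k x) * φ x)
        + (-(a * (2 + a) * (4 + a))) * (dot₃ (fun i j k => P i j k x) (fun i j k => θ i x * (θ j x * θ k x)) * φ x) := by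
    rw [hc3 _ (fun i j k => cv2 Γ lam (cv1 Γ lam (cv0 Γ lam φ)) i j k x
        + (-6 - 3 * a) * (θ i x * cv1 Γ lam (cv0 Γ lam φ) j k x)
        + (-(2 + 3 * a)) * (cv1 Γ 0 θ i j x * cv0 Γ lam φ k x)
        + (a * (2 + a) + (4 + a) * (2 + 2 * a)) * (θ i x * θ j x * cv0 Γ lam φ k x)
        + (2 * a * (2 + a) + a * (4 + a)) * ((θ i x * cv1 Γ 0 θ j k x) * φ x)
        + (-a) * ((cv2 Γ 0 (cv1 Γ 0 θ) i j k x) * φ x)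
        + (-(a * (2 + a) * (4 + a))) * ((θ i x * (θ j x * θ k x)) * φ x)) (by
      intro i j k
      simp only [cv2_cv1_cv0_sh hΓ hθ hφ ha]
      simp only [cv1_cv0_sh hΓ hθ hφ ha]
      ring), dot₃_add_mul, dot₃_add_mul, dot₃_add_mul, dot₃_add_mul, dot₃_add_mul, dot₃_add_mul, dot₃_mul_right, dot₃_mul_right, dot₃_mul_right]
  have M2 : dot₂ (fun i j => dv3 Γ del P i j x) (fun i j => cv1 (sh Γ θ) lam (cv0 (sh Γ θ) lam φ) i j x)
      = dot₂ (fun i j => dv3 Γ del P i j x) (fun i j => cv1 Γ lam (cv0 Γ lam φ) i j x)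
        + (-(2 + 2 * a)) * dot₂ (fun i j => dv3 Γ del P i j x) (fun i j => θ i x * cv0 Γ lam φ j x)
        + (-a) * (dot₂ (fun i j => dv3 Γ del P i j x) (fun i j => cv1 Γ 0 θ i j x) * φ x)
        + (a * (2 + a)) * (dot₂ (fun i j => dv3 Γ del P i j x) (fun i j => θ i x * θ j x) * φ x) := by
    rw [hc2 _ (fun i j => cv1 Γ lam (cv0 Γ lam φ) i j x
        + (-(2 + 2 * a)) * (θ i x * cv0 Γ lam φ j x)
        + (-a) * ((cv1 Γ 0 θ i j x) * φ x)
        + (a * (2 + a)) * ((θ i x * θ j x) * φ x)) (by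
      intro i j
      simp only [cv1_cv0_sh hΓ hθ hφ ha]
      ring), dot₂_add_mul, dot₂_add_mul, dot₂_add_mul, dot₂_mul_right, dot₂_mul_right]
  -- The leading 0 and the factor 1 give the sum the shape `X + c * Y` from the first summand on, so
  -- that `dot₃_add_mul` applies throughout.
  have M3 : dot₃ (fun i j k => P i j k x) (fun i j k => cv1 (sh Γ θ) lam (cv0 (sh Γ θ) lam φ) i j x * θ k x)
      = 0
        + 1 * dot₃ (fun i j k => P i j k x) (fun i j k => θ i x * cv1 Γ lam (cv0 Γ lam φ) j k x)
        + (-(2 + 2 * a)) * dot₃ (fun i j k => P i j k x) (fun i j k => θ i x * θ j x * cv0 Γ lam φ k x)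
        + (-a) * (dot₃ (fun i j k => P i j k x) (fun i j k => θ i x * cv1 Γ 0 θ j k x) * φ x)
        + (a * (2 + a)) * (dot₃ (fun i j k => P i j k x) (fun i j k => θ i x * (θ j x * θ k x)) * φ x) := by
    rw [hc3 _ (fun i j k => 0
        + 1 * (θ i x * cv1 Γ lam (cv0 Γ lam φ) j k x)
        + (-(2 + 2 * a)) * (θ i x * θ j x * cv0 Γ lam φ k x)
        + (-a) * ((θ i x * cv1 Γ 0 θ j k x) * φ x)
        + (a * (2 + a)) * ((θ i x * (θ j x * θ k x)) * φ x)) (by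
      intro i j k
      simp only [cv1_cv0_sh hΓ hθ hφ ha]
      ring), dot₃_add_mul, dot₃_add_mul, dot₃_add_mul, dot₃_add_mul, dot₃_mul_right, dot₃_mul_right, Z3]
  have M4 : dot₁ (fun k => dv2 Γ del (dv3 Γ del P) k x) (fun k => cv0 (sh Γ θ) lam φ k x)
      = dot₁ (fun k => dv2 Γ del (dv3 Γ del P) k x) (fun k => cv0 Γ lam φ k x)
        + (-a) * (dot₁ (fun k => dv2 Γ del (dv3 Γ del P) k x) (fun k => θ k x) * φ x) := by
    have e : (fun k => cv0 (sh Γ θ) lam φ k x) = fun k => cv0 Γ lam φ k x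
        + (-a) * ((θ k x) * φ x) := by
      funext k
      simp only [cv0_sh, ← ha]
      ring
    rw [e, dot₁_add_mul, dot₁_mul_right]
  have M5 : dot₃ (fun i j k => P i j k x) (fun i j k => cv1 Γ 0 θ j k x * cv0 (sh Γ θ) lam φ i x)
      = 0
        + 1 * dot₃ (fun i j k => P i j k x) (fun i j k => cv1 Γ 0 θ i j x * cv0 Γ lam φ k x)
        + (-a) * (dot₃ (fun i j k => P i j k x) (fun i j k => θ i x * cv1 Γ 0 θ j k x) * φ x) := by
    rw [hc3 _ (fun i j k => 0
        + 1 * (cv1 Γ 0 θ i j x * cv0 Γ lam φ k x)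
        + (-a) * ((θ i x * cv1 Γ 0 θ j k x) * φ x)) (by
      intro i j k
      simp only [cv0_sh, ← ha]
      ring), dot₃_add_mul, dot₃_add_mul, dot₃_mul_right, Z3]
  have M6 : dot₂ (fun i j => dv3 Γ del P i j x) (fun i j => θ j x * cv0 (sh Γ θ) lam φ i x)
      = 0
        + 1 * dot₂ (fun i j => dv3 Γ del P i j x) (fun i j => θ i x * cv0 Γ lam φ j x)
        + (-a) * (dot₂ (fun i j => dv3 Γ del P i j x) (fun i j => θ i x * θ j x) * φ x) := by
    rw [hc2 _ (fun i j => 0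
        + 1 * (θ i x * cv0 Γ lam φ j x)
        + (-a) * ((θ i x * θ j x) * φ x)) (by
      intro i j
      simp only [cv0_sh, ← ha]
      ring), dot₂_add_mul, dot₂_add_mul, dot₂_mul_right, Z2]
  have M7 : dot₃ (fun i j k => P i j k x) (fun i j k => θ j x * θ k x * cv0 (sh Γ θ) lam φ i x)
      = 0
        + 1 * dot₃ (fun i j k => P i j k x) (fun i j k => θ i x * θ j x * cv0 Γ lam φ k x)
        + (-a) * (dot₃ (fun i j k => P i j k x) (fun i j k => θ i x * (θ j x * θ k x)) * φ x) := by
    rw [hc3 _ (fun i j k => 0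
        + 1 * (θ i x * θ j x * cv0 Γ lam φ k x)
        + (-a) * ((θ i x * (θ j x * θ k x)) * φ x)) (by
      intro i j k
      simp only [cv0_sh, ← ha]
      ring), dot₃_add_mul, dot₃_add_mul, dot₃_mul_right, Z3]
  have M8 : dot₃ (fun i j k => P i j k x) (fun i j k => ric (sh Γ θ) i j x * cv0 (sh Γ θ) lam φ k x)
      = dot₃ (fun i j k => P i j k x) (fun i j k => ric Γ i j x * cv0 Γ lam φ k x)
        + (-a) * (dot₃ (fun i j k => P i j k x) (fun i j k => θ i x * ric Γ j k x) * φ x)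
        + ((n : ℝ) - 1) * dot₃ (fun i j k => P i j k x) (fun i j k => cv1 Γ 0 θ i j x * cv0 Γ lam φ k x)
        + (-((n : ℝ) - 1)) * dot₃ (fun i j k => P i j k x) (fun i j k => θ i x * θ j x * cv0 Γ lam φ k x)
        + (-(a * ((n : ℝ) - 1))) * (dot₃ (fun i j k => P i j k x) (fun i j k => θ i x * cv1 Γ 0 θ j k x) * φ x)
        + (a * ((n : ℝ) - 1)) * (dot₃ (fun i j k => P i j k x) (fun i j k => θ i x * (θ j x * θ k x)) * φ x) := by
    rw [hc3 _ (fun i j k => ric Γ i j x * cv0 Γ lam φ k x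
        + (-a) * ((θ i x * ric Γ j k x) * φ x)
        + ((n : ℝ) - 1) * (cv1 Γ 0 θ i j x * cv0 Γ lam φ k x)
        + (-((n : ℝ) - 1)) * (θ i x * θ j x * cv0 Γ lam φ k x)
        + (-(a * ((n : ℝ) - 1))) * ((θ i x * cv1 Γ 0 θ j k x) * φ x)
        + (a * ((n : ℝ) - 1)) * ((θ i x * (θ j x * θ k x)) * φ x)) (by
      intro i j k
      simp only [ric_sh hs hΓ hθ, cv0_sh, ← ha]
      ring), dot₃_add_mul, dot₃_add_mul, dot₃_add_mul, dot₃_add_mul, dot₃_add_mul, dot₃_mul_right, dot₃_mul_right, dot₃_mul_right]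
  -- The terms with factors n and -1 in the shift of the Ricci tensor differ by a transposition, so
  -- under a symmetric contraction they merge into n-1.
  have M9 : dot₂ (fun i j => dv3 Γ del P i j x) (fun i j => ric (sh Γ θ) i j x)
      = dot₂ (fun i j => dv3 Γ del P i j x) (fun i j => ric Γ i j x)
        + ((n : ℝ) - 1) * dot₂ (fun i j => dv3 Γ del P i j x) (fun i j => cv1 Γ 0 θ i j x)
        + (-((n : ℝ) - 1)) * dot₂ (fun i j => dv3 Γ del P i j x) (fun i j => θ i x * θ j x) := by
    rw [hc2 _ (fun i j => ric Γ i j x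
        + ((n : ℝ) - 1) * (cv1 Γ 0 θ i j x)
        + (-((n : ℝ) - 1)) * (θ i x * θ j x)) (by
      intro i j
      simp only [ric_sh hs hΓ hθ]
      ring), dot₂_add_mul, dot₂_add_mul]
  have M10 : dot₃ (fun i j k => P i j k x) (fun i j k => ric (sh Γ θ) i j x * θ k x)
      = 0
        + 1 * dot₃ (fun i j k => P i j k x) (fun i j k => θ i x * ric Γ j k x)
        + ((n : ℝ) - 1) * dot₃ (fun i j k => P i j k x) (fun i j k => θ i x * cv1 Γ 0 θ j k x)
        + (-((n : ℝ) - 1)) * dot₃ (fun i j k => P i j k x) (fun i j k => θ i x * (θ j x * θ k x)) := by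
    rw [hc3 _ (fun i j k => 0
        + 1 * (θ i x * ric Γ j k x)
        + ((n : ℝ) - 1) * (θ i x * cv1 Γ 0 θ j k x)
        + (-((n : ℝ) - 1)) * (θ i x * (θ j x * θ k x))) (by
      intro i j k
      simp only [ric_sh hs hΓ hθ]
      ring), dot₃_add_mul, dot₃_add_mul, dot₃_add_mul, Z3]
  have M11 : dot₃ (fun i j k => P i j k x) (fun i j k => cv2 (sh Γ θ) 0 (ric (sh Γ θ)) i j k x)
      = dot₃ (fun i j k => P i j k x) (fun i j k => cv2 Γ 0 (ric Γ) i j k x)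
        + (-4) * dot₃ (fun i j k => P i j k x) (fun i j k => θ i x * ric Γ j k x)
        + ((n : ℝ) - 1) * dot₃ (fun i j k => P i j k x) (fun i j k => cv2 Γ 0 (cv1 Γ 0 θ) i j k x)
        + (-6 * ((n : ℝ) - 1)) * dot₃ (fun i j k => P i j k x) (fun i j k => θ i x * cv1 Γ 0 θ j k x)
        + (4 * ((n : ℝ) - 1)) * dot₃ (fun i j k => P i j k x) (fun i j k => θ i x * (θ j x * θ k x)) := by
    rw [hc3 _ (fun i j k => cv2 Γ 0 (ric Γ) i j k x
        + (-4) * (θ i x * ric Γ j k x)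
        + ((n : ℝ) - 1) * (cv2 Γ 0 (cv1 Γ 0 θ) i j k x)
        + (-6 * ((n : ℝ) - 1)) * (θ i x * cv1 Γ 0 θ j k x)
        + (4 * ((n : ℝ) - 1)) * (θ i x * (θ j x * θ k x))) (by
      intro i j k
      simp only [cv2_ric_sh hs hΓ hθ]
      simp only [ric_sh hs hΓ hθ]
      ring), dot₃_add_mul, dot₃_add_mul, dot₃_add_mul, dot₃_add_mul]
  have D3 : dv1 (sh Γ θ) del (dv2 (sh Γ θ) del (dv3 (sh Γ θ) del P)) x
      = dv1 Γ del (dv2 Γ del (dv3 Γ del P)) x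
      + e * dot₃ (fun i j k => P i j k x) (fun i j k => cv2 Γ 0 (cv1 Γ 0 θ) i j k x)
      + (3 * e - 2) * dot₂ (fun i j => dv3 Γ del P i j x) (fun i j => cv1 Γ 0 θ i j x)
      + (3 * e - 6) * dot₁ (fun k => dv2 Γ del (dv3 Γ del P) k x) (fun k => θ k x)
      + (e * (3 * e - 8)) * dot₃ (fun i j k => P i j k x) (fun i j k => θ i x * cv1 Γ 0 θ j k x)
      + (e * (e - 2) + (e - 4) * (2 * e - 2))
        * dot₂ (fun i j => dv3 Γ del P i j x) (fun i j => θ i x * θ j x)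
      + (e * (e - 2) * (e - 4))
        * dot₃ (fun i j k => P i j k x) (fun i j k => θ i x * (θ j x * θ k x)) :=
    dv1_dv2_dv3_sh h12 h23 hΓ hθ hP he x
  rw [← ha, ← he, quantDiv, M1, D1, M2, M3, D2, M4, M5, M6, M7, M8, D1, M9, M10, M11, D3]
  simp only [Fin.sum_univ_succ, shiftCoeff, shiftTerm, quantDiv]
  simp
  ring

end ShiftFormula

/-! ### Invariance of the formula for the rows of the table. -/

section Rows

variable {n : ℕ}

/-- On the table a is one of 0, -1, -2 and e is one of 0, 1, 2. Each coefficient is then an explicit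
expression in t and n, in which n-1 cancels the denominators 1-n. -/
lemma shiftCoeff_row (hn : 1 < n) (r : Row) (t : ℝ) (s : Fin 11) :
    shiftCoeff (r.coeffs n t) (r.lam n * (n + 1)) (n + 5 - r.del n * (n + 1)) (n - 1) s = 0 := by
  have h1 : (n : ℝ) + 1 ≠ 0 := by positivity
  have hn' : (1 : ℝ) < n := by exact_mod_cast hn
  have h2 : (1 : ℝ) - n ≠ 0 := by linarith
  have h3 : (3 : ℝ) - 3 * n ≠ 0 := by linarith
  have h4 : (3 : ℝ) - 3 * n = 3 * (1 - n) := by ring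
  have ha : ∀ c : ℝ, c / (n + 1) * (n + 1) = c := fun c => by field_simp
  cases r <;> fin_cases s <;>
    simp only [shiftCoeff, Row.coeffs, Row.lam, Row.del, ha, h4, Fin.zero_eta, Fin.mk_one,
      Fin.reduceFinMk, Matrix.cons_val, zero_mul] <;> field_simp <;> ring

lemma quantDiv_sh_row (hn : 1 < n) (r : Row) (t : ℝ) {Γ : LocalConn n} {θ : Fin n → Coord n → ℝ}
    (hs : ∀ k i j x, Γ k i j x = Γ k j i x)
    (hΓ : ∀ k i j, ContDiff ℝ ∞ (Γ k i j)) (hθ : ∀ i, ContDiff ℝ ∞ (θ i))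
    {P : Fin n → Fin n → Fin n → Coord n → ℝ}
    (h12 : ∀ i j k x, P i j k x = P j i k x) (h23 : ∀ i j k x, P i j k x = P i k j x)
    (hP : ∀ i j k, ContDiff ℝ ∞ (P i j k)) {φ : Coord n → ℝ} (hφ : ContDiff ℝ ∞ φ) (x : Coord n) :
    quantDiv (r.coeffs n t) (r.lam n) (r.del n) (sh Γ θ) P φ x
      = quantDiv (r.coeffs n t) (r.lam n) (r.del n) Γ P φ x := by
  rw [quantDiv_sh _ _ _ hs hΓ hθ h12 h23 hP hφ]
  simp [shiftCoeff_row hn]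

end Rows

/-! ### Projective vector fields -/

section Lie

variable {n : ℕ}

/-- The divergence of a vector field. -/
def divX (X : Fin n → Coord n → ℝ) : Coord n → ℝ := fun x => ∑ m, pd m (X m) x

/-- The transport term `X^m ∂ₘ f`. -/
def transport (X : Fin n → Coord n → ℝ) (f : Coord n → ℝ) : Coord n → ℝ := fun x =>
  ∑ m, X m x * pd m f x

/-- The second derivatives of X are the Lie derivative of the flat connection along X. The condition
says that this is a projective shift by a constant one-form c; nothing beyond it and smoothness is
used about the projective fields. -/
structure IsProjField (X : Fin n → Coord n → ℝ) (c : Fin n → ℝ) : Prop where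
  smooth : ∀ k, ContDiff ℝ ∞ (X k)
  second : ∀ i j k x, pd i (pd j (X k)) x
    = (if k = i then c j else 0) + (if k = j then c i else 0)

/-- `lieF0` to `lieF3` act on covariant and `lieV1` to `lieV3` on contravariant tensor densities of
weight w, with separate indices instead of tuples. -/
def lieF0 (X : Fin n → Coord n → ℝ) (w : ℝ) (f : Coord n → ℝ) : Coord n → ℝ := fun x =>
  transport X f x + w * (divX X x * f x)

def lieF1 (X : Fin n → Coord n → ℝ) (w : ℝ) (f : Fin n → Coord n → ℝ) : Fin n → Coord n → ℝ :=
  fun i x => transport X (f i) x + ∑ m, pd i (X m) x * f m x + w * (divX X x * f i x)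

def lieF2 (X : Fin n → Coord n → ℝ) (w : ℝ) (f : Fin n → Fin n → Coord n → ℝ) :
    Fin n → Fin n → Coord n → ℝ := fun i j x =>
  transport X (f i j) x + ∑ m, pd i (X m) x * f m j x + ∑ m, pd j (X m) x * f i m x
    + w * (divX X x * f i j x)

def lieF3 (X : Fin n → Coord n → ℝ) (w : ℝ) (f : Fin n → Fin n → Fin n → Coord n → ℝ) :
    Fin n → Fin n → Fin n → Coord n → ℝ := fun i j k x =>
  transport X (f i j k) x + ∑ m, pd i (X m) x * f m j k x + ∑ m, pd j (X m) x * f i m k x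
    + ∑ m, pd k (X m) x * f i j m x + w * (divX X x * f i j k x)

def lieV1 (X : Fin n → Coord n → ℝ) (w : ℝ) (f : Fin n → Coord n → ℝ) : Fin n → Coord n → ℝ :=
  fun i x => transport X (f i) x - ∑ m, pd m (X i) x * f m x + w * (divX X x * f i x)

def lieV2 (X : Fin n → Coord n → ℝ) (w : ℝ) (f : Fin n → Fin n → Coord n → ℝ) :
    Fin n → Fin n → Coord n → ℝ := fun i j x =>
  transport X (f i j) x - ∑ m, pd m (X i) x * f m j x - ∑ m, pd m (X j) x * f i m x
    + w * (divX X x * f i j x)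

def lieV3 (X : Fin n → Coord n → ℝ) (w : ℝ) (f : Fin n → Fin n → Fin n → Coord n → ℝ) :
    Fin n → Fin n → Fin n → Coord n → ℝ := fun i j k x =>
  transport X (f i j k) x - ∑ m, pd m (X i) x * f m j k x - ∑ m, pd m (X j) x * f i m k x
    - ∑ m, pd m (X k) x * f i j m x + w * (divX X x * f i j k x)

@[fun_prop]
lemma contDiff_divX {X : Fin n → Coord n → ℝ} (hX : ∀ k, ContDiff ℝ ∞ (X k)) :
    ContDiff ℝ ∞ (divX X) := by
  unfold divX; fun_prop

@[fun_prop]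
lemma contDiff_transport {X : Fin n → Coord n → ℝ} (hX : ∀ k, ContDiff ℝ ∞ (X k))
    {f : Coord n → ℝ} (hf : ContDiff ℝ ∞ f) : ContDiff ℝ ∞ (transport X f) := by
  unfold transport; fun_prop

variable {X : Fin n → Coord n → ℝ} {c : Fin n → ℝ} {w : ℝ}

lemma pd_transport (hX : IsProjField X c) {f : Coord n → ℝ} (hf : ContDiff ℝ ∞ f) (i : Fin n)
    (x : Coord n) : pd i (transport X f) x
      = transport X (pd i f) x + ∑ m, pd i (X m) x * pd m f x := by
  have h := hX.smooth
  unfold transport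
  rw [pd_sum (f := fun m x => X m x * pd m f x) fun m _ =>
    ContDiff.diffAt (f := fun x => X m x * pd m f x) (by fun_prop) x]
  rw [← Finset.sum_add_distrib]
  refine Finset.sum_congr rfl fun m _ => ?_
  rw [pd_mul (ContDiff.diffAt (h m) x) (ContDiff.diffAt (contDiff_pd hf) x),
    pd_comm (hf.contDiffAt.of_le (by norm_cast))]
  ring

lemma pd_sum_form (hX : IsProjField X c) {g : Fin n → Coord n → ℝ} (hg : ∀ m, ContDiff ℝ ∞ (g m))
    (i j : Fin n) (x : Coord n) : pd i (fun x => ∑ m, pd j (X m) x * g m x) x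
      = c j * g i x + c i * g j x + ∑ m, pd j (X m) x * pd i (g m) x := by
  have h := hX.smooth
  rw [pd_sum (f := fun m x => pd j (X m) x * g m x) fun m _ =>
    ContDiff.diffAt (f := fun x => pd j (X m) x * g m x) (by fun_prop) x]
  have e : ∀ m, pd i (fun x => pd j (X m) x * g m x) x
      = ((if m = i then c j else 0) + (if m = j then c i else 0)) * g m x
        + pd j (X m) x * pd i (g m) x := fun m => by
    rw [pd_mul (ContDiff.diffAt (contDiff_pd (h m)) x) (ContDiff.diffAt (hg m) x), hX.second]
  simp [e, add_mul, Finset.sum_add_distrib]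

lemma pd_sum_vec (hX : IsProjField X c) {g : Fin n → Coord n → ℝ} (hg : ∀ m, ContDiff ℝ ∞ (g m))
    (k i : Fin n) (x : Coord n) : pd k (fun x => ∑ m, pd m (X i) x * g m x) x
      = (if i = k then ∑ m, c m * g m x else 0) + c k * g i x
        + ∑ m, pd m (X i) x * pd k (g m) x := by
  have h := hX.smooth
  rw [pd_sum (f := fun m x => pd m (X i) x * g m x) fun m _ =>
    ContDiff.diffAt (f := fun x => pd m (X i) x * g m x) (by fun_prop) x]
  have e : ∀ m, pd k (fun x => pd m (X i) x * g m x) x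
      = ((if i = k then c m else 0) + (if i = m then c k else 0)) * g m x
        + pd m (X i) x * pd k (g m) x := fun m => by
    rw [pd_mul (ContDiff.diffAt (contDiff_pd (h i)) x) (ContDiff.diffAt (hg m) x), hX.second]
  simp [e, add_mul, Finset.sum_add_distrib, Finset.sum_ite_irrel]

lemma pd_divX_mul (hX : IsProjField X c) {g : Coord n → ℝ} (hg : ContDiff ℝ ∞ g)
    (i : Fin n) (x : Coord n) : pd i (fun x => w * (divX X x * g x)) x
      = w * (n + 1) * (c i * g x) + w * (divX X x * pd i g x) := by
  have h := hX.smooth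
  have e : pd i (divX X) x = (n + 1) * c i := by
    unfold divX
    rw [pd_sum (f := fun m => pd m (X m)) fun m _ => ContDiff.diffAt (contDiff_pd (h m)) x]
    simp [hX.second, Finset.sum_add_distrib]
    ring
  rw [pd_const_mul _ (ContDiff.diffAt (f := fun x => divX X x * g x) (by fun_prop) x),
    pd_mul (ContDiff.diffAt (contDiff_divX h) x) (ContDiff.diffAt hg x), e]
  ring

/-! Flat derivatives of Lie derivatives. -/

/-- The failure of ∂ to commute with the Lie derivative comes from the second derivatives of X
alone. It is the correction term of `cv0_sh` with c in place of θ and the opposite sign; the rules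
for one-forms and two-tensors correspond to `cv1_sh` and `cv2_sh` in the same way. -/
lemma pd_lieF0 (hX : IsProjField X c) {f : Coord n → ℝ} (hf : ContDiff ℝ ∞ f) :
    (fun i => pd i (lieF0 X w f)) = fun i x => lieF1 X w (fun i => pd i f) i x
      + w * (n + 1) * (c i * f x) := by
  have h := hX.smooth
  funext i x
  unfold lieF0
  rw [pd_add (ContDiff.diffAt (contDiff_transport h hf) x)
    (ContDiff.diffAt (f := fun x => w * (divX X x * f x)) (by fun_prop) x),
    pd_transport hX hf, pd_divX_mul hX hf]
  simp only [lieF1]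
  ring

lemma pd_lieF1 (hX : IsProjField X c) {f : Fin n → Coord n → ℝ} (hf : ∀ i, ContDiff ℝ ∞ (f i)) :
    (fun i j => pd i (lieF1 X w f j)) = fun i j x => lieF2 X w (fun i j => pd i (f j)) i j x
      + (c j * f i x + (1 + w * (n + 1)) * (c i * f j x)) := by
  have h := hX.smooth
  funext i j x
  unfold lieF1
  rw [pd_add (ContDiff.diffAt (f := fun x => transport X (f j) x + ∑ m, pd j (X m) x * f m x)
      (by fun_prop) x) (ContDiff.diffAt (f := fun x => w * (divX X x * f j x)) (by fun_prop) x),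
    pd_add (ContDiff.diffAt (contDiff_transport h (hf j)) x)
      (ContDiff.diffAt (f := fun x => ∑ m, pd j (X m) x * f m x) (by fun_prop) x),
    pd_transport hX (hf j), pd_divX_mul hX (hf j), pd_sum_form hX hf]
  simp only [lieF2]
  ring

lemma pd_lieF2 (hX : IsProjField X c) {f : Fin n → Fin n → Coord n → ℝ}
    (hf : ∀ i j, ContDiff ℝ ∞ (f i j)) :
    (fun i j k => pd i (lieF2 X w f j k)) = fun i j k x =>
      lieF3 X w (fun i j k => pd i (f j k)) i j k x
      + (c j * f i k x + c k * f j i x + (2 + w * (n + 1)) * (c i * f j k x)) := by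
  have h := hX.smooth
  funext i j k x
  unfold lieF2
  rw [pd_add (ContDiff.diffAt (f := fun x => transport X (f j k) x + ∑ m, pd j (X m) x * f m k x
        + ∑ m, pd k (X m) x * f j m x)
      (by fun_prop) x) (ContDiff.diffAt (f := fun x => w * (divX X x * f j k x)) (by fun_prop) x),
    pd_add (ContDiff.diffAt (f := fun x => transport X (f j k) x + ∑ m, pd j (X m) x * f m k x)
      (by fun_prop) x) (ContDiff.diffAt (f := fun x => ∑ m, pd k (X m) x * f j m x)
      (by fun_prop) x),
    pd_add (ContDiff.diffAt (contDiff_transport h (hf j k)) x)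
      (ContDiff.diffAt (f := fun x => ∑ m, pd j (X m) x * f m k x) (by fun_prop) x),
    pd_transport hX (hf j k), pd_divX_mul hX (hf j k), pd_sum_form hX (fun m => hf m k),
    pd_sum_form hX (fun m => hf j m)]
  simp only [lieF3]
  ring

end Lie

/-! ### Divergences and Lie derivatives along projective fields. -/

section LieDiv

variable {n : ℕ} {X : Fin n → Coord n → ℝ} {c : Fin n → ℝ} {w : ℝ}

lemma transport_sum {ι : Type*} (s : Finset ι) {f : ι → Coord n → ℝ}
    (hf : ∀ k, ContDiff ℝ ∞ (f k)) (x : Coord n) :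
    transport X (fun x => ∑ k ∈ s, f k x) x = ∑ k ∈ s, transport X (f k) x := by
  unfold transport
  rw [Finset.sum_comm]
  refine Finset.sum_congr rfl fun m _ => ?_
  rw [pd_sum fun k _ => ContDiff.diffAt (hf k) x, Finset.mul_sum]

lemma div_lieV1 (hX : IsProjField X c) {f : Fin n → Coord n → ℝ} (hf : ∀ i, ContDiff ℝ ∞ (f i))
    (x : Coord n) : ∑ j, pd j (lieV1 X w f j) x
      = lieF0 X w (fun x => ∑ j, pd j (f j) x) x
        + (-(n + 1 - w * (n + 1))) * ∑ k, c k * f k x := by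
  have h := hX.smooth
  have e : ∀ j, pd j (lieV1 X w f j) x = transport X (pd j (f j)) x
      + ∑ m, pd j (X m) x * pd m (f j) x
      - (∑ m, c m * f m x + c j * f j x + ∑ m, pd m (X j) x * pd j (f m) x)
      + (w * (n + 1) * (c j * f j x) + w * (divX X x * pd j (f j) x)) := by
    intro j
    unfold lieV1
    rw [pd_add (ContDiff.diffAt (f := fun x => transport X (f j) x - ∑ m, pd m (X j) x * f m x)
        (by fun_prop) x) (ContDiff.diffAt (f := fun x => w * (divX X x * f j x)) (by fun_prop) x),
      pd_sub (ContDiff.diffAt (contDiff_transport h (hf j)) x)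
        (ContDiff.diffAt (f := fun x => ∑ m, pd m (X j) x * f m x) (by fun_prop) x),
      pd_transport hX (hf j), pd_divX_mul hX (hf j), pd_sum_vec hX hf, if_pos rfl]
  have hsw : ∑ j, ∑ m, pd j (X m) x * pd m (f j) x = ∑ j, ∑ m, pd m (X j) x * pd j (f m) x :=
    Finset.sum_comm
  simp only [e, lieF0, transport_sum _ (fun j => contDiff_pd (hf j)), Finset.sum_add_distrib,
    Finset.sum_sub_distrib, hsw, ← Finset.mul_sum, Finset.sum_const, Finset.card_univ,
    Fintype.card_fin, nsmul_eq_mul]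
  ring

lemma div_lieV2 (hX : IsProjField X c) {f : Fin n → Fin n → Coord n → ℝ}
    (hs : ∀ i j, f i j = f j i) (hf : ∀ i j, ContDiff ℝ ∞ (f i j)) (i : Fin n)
    (x : Coord n) : ∑ j, pd j (lieV2 X w f i j) x
      = lieV1 X w (fun i x => ∑ j, pd j (f i j) x) i x
        + (-(n + 3 - w * (n + 1))) * ∑ k, c k * f i k x := by
  have h := hX.smooth
  have e : ∀ j, pd j (lieV2 X w f i j) x = transport X (pd j (f i j)) x
      + ∑ m, pd j (X m) x * pd m (f i j) x
      - ((if i = j then ∑ m, c m * f m j x else 0) + c j * f i j x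
        + ∑ m, pd m (X i) x * pd j (f m j) x)
      - (∑ m, c m * f i m x + c j * f i j x + ∑ m, pd m (X j) x * pd j (f i m) x)
      + (w * (n + 1) * (c j * f i j x) + w * (divX X x * pd j (f i j) x)) := by
    intro j
    unfold lieV2
    rw [pd_add (ContDiff.diffAt (f := fun x => transport X (f i j) x - ∑ m, pd m (X i) x * f m j x
          - ∑ m, pd m (X j) x * f i m x)
        (by fun_prop) x) (ContDiff.diffAt (f := fun x => w * (divX X x * f i j x)) (by fun_prop) x),
      pd_sub (ContDiff.diffAt (f := fun x => transport X (f i j) x - ∑ m, pd m (X i) x * f m j x)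
          (by fun_prop) x) (ContDiff.diffAt (f := fun x => ∑ m, pd m (X j) x * f i m x)
          (by fun_prop) x),
      pd_sub (ContDiff.diffAt (contDiff_transport h (hf i j)) x)
        (ContDiff.diffAt (f := fun x => ∑ m, pd m (X i) x * f m j x) (by fun_prop) x),
      pd_transport hX (hf i j), pd_divX_mul hX (hf i j), pd_sum_vec hX fun m => hf m j,
      pd_sum_vec hX fun m => hf i m, if_pos rfl]
  have hsw : ∑ j, ∑ m, pd j (X m) x * pd m (f i j) x = ∑ j, ∑ m, pd m (X j) x * pd j (f i m) x :=
    Finset.sum_comm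
  have hsw' : ∑ j, ∑ m, pd m (X i) x * pd j (f m j) x = ∑ m, ∑ j, pd m (X i) x * pd j (f m j) x :=
    Finset.sum_comm
  simp only [e, lieV1, transport_sum _ (fun j => contDiff_pd (hf i j)), Finset.sum_add_distrib,
    Finset.sum_sub_distrib, hsw, hsw', ← Finset.mul_sum, Finset.sum_const, Finset.card_univ,
    Fintype.card_fin, nsmul_eq_mul, Finset.sum_ite_eq, Finset.mem_univ, if_true, hs _ i]
  ring

/-- First derivatives of X pair off between the transport term and the contracted index. Its second
derivatives leave the constant of `dv3_sh`, with the opposite sign and again by symmetry of the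
tensor. -/
lemma div_lieV3 (hX : IsProjField X c) {f : Fin n → Fin n → Fin n → Coord n → ℝ}
    (h12 : ∀ i j k, f i j k = f j i k) (h23 : ∀ i j k, f i j k = f i k j)
    (hf : ∀ i j k, ContDiff ℝ ∞ (f i j k)) (i j : Fin n)
    (x : Coord n) : ∑ k, pd k (lieV3 X w f i j k) x
      = lieV2 X w (fun i j x => ∑ k, pd k (f i j k) x) i j x
        + (-(n + 5 - w * (n + 1))) * ∑ k, c k * f i j k x := by
  have h := hX.smooth
  have e : ∀ k, pd k (lieV3 X w f i j k) x = transport X (pd k (f i j k)) x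
      + ∑ m, pd k (X m) x * pd m (f i j k) x
      - ((if i = k then ∑ m, c m * f m j k x else 0) + c k * f i j k x
        + ∑ m, pd m (X i) x * pd k (f m j k) x)
      - ((if j = k then ∑ m, c m * f i m k x else 0) + c k * f i j k x
        + ∑ m, pd m (X j) x * pd k (f i m k) x)
      - (∑ m, c m * f i j m x + c k * f i j k x + ∑ m, pd m (X k) x * pd k (f i j m) x)
      + (w * (n + 1) * (c k * f i j k x) + w * (divX X x * pd k (f i j k) x)) := by
    intro k
    unfold lieV3
    rw [pd_add (ContDiff.diffAt (f := fun x => transport X (f i j k) x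
          - ∑ m, pd m (X i) x * f m j k x - ∑ m, pd m (X j) x * f i m k x
          - ∑ m, pd m (X k) x * f i j m x) (by fun_prop) x)
        (ContDiff.diffAt (f := fun x => w * (divX X x * f i j k x)) (by fun_prop) x),
      pd_sub (ContDiff.diffAt (f := fun x => transport X (f i j k) x
          - ∑ m, pd m (X i) x * f m j k x - ∑ m, pd m (X j) x * f i m k x) (by fun_prop) x)
        (ContDiff.diffAt (f := fun x => ∑ m, pd m (X k) x * f i j m x) (by fun_prop) x),
      pd_sub (ContDiff.diffAt (f := fun x => transport X (f i j k) x
          - ∑ m, pd m (X i) x * f m j k x) (by fun_prop) x)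
        (ContDiff.diffAt (f := fun x => ∑ m, pd m (X j) x * f i m k x) (by fun_prop) x),
      pd_sub (ContDiff.diffAt (contDiff_transport h (hf i j k)) x)
        (ContDiff.diffAt (f := fun x => ∑ m, pd m (X i) x * f m j k x) (by fun_prop) x),
      pd_transport hX (hf i j k), pd_divX_mul hX (hf i j k), pd_sum_vec hX fun m => hf m j k,
      pd_sum_vec hX fun m => hf i m k, pd_sum_vec hX fun m => hf i j m, if_pos rfl]
  have hsw : ∑ k, ∑ m, pd k (X m) x * pd m (f i j k) x
      = ∑ k, ∑ m, pd m (X k) x * pd k (f i j m) x := Finset.sum_comm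
  have hsw1 : ∑ k, ∑ m, pd m (X i) x * pd k (f m j k) x
      = ∑ m, ∑ k, pd m (X i) x * pd k (f m j k) x := Finset.sum_comm
  have hsw2 : ∑ k, ∑ m, pd m (X j) x * pd k (f i m k) x
      = ∑ m, ∑ k, pd m (X j) x * pd k (f i m k) x := Finset.sum_comm
  have e1 : ∀ m, f m j i x = f i j m x := fun m => by rw [h12, h23, h12]
  have e2 : ∀ m, f i m j x = f i j m x := fun m => by rw [h23]
  simp only [e, lieV2, transport_sum _ (fun k => contDiff_pd (hf i j k)), Finset.sum_add_distrib,
    Finset.sum_sub_distrib, hsw, hsw1, hsw2, ← Finset.mul_sum, Finset.sum_const, Finset.card_univ,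
    Fintype.card_fin, nsmul_eq_mul, Finset.sum_ite_eq, Finset.mem_univ, if_true, e1, e2]
  ring

/-! Lie derivatives of full contractions. -/

lemma transport_mul {f g : Coord n → ℝ} (hf : ContDiff ℝ ∞ f) (hg : ContDiff ℝ ∞ g) (x : Coord n) :
    transport X (fun x => f x * g x) x = transport X f x * g x + f x * transport X g x := by
  unfold transport
  rw [Finset.sum_mul, Finset.mul_sum, ← Finset.sum_add_distrib]
  refine Finset.sum_congr rfl fun m _ => ?_
  rw [pd_mul (ContDiff.diffAt hf x) (ContDiff.diffAt hg x)]
  ring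

lemma lie_mul {w' : ℝ} {f g : Coord n → ℝ} (hf : ContDiff ℝ ∞ f) (hg : ContDiff ℝ ∞ g)
    (x : Coord n) : lieF0 X (w + w') (fun x => f x * g x) x
      = lieF0 X w f x * g x + f x * lieF0 X w' g x := by
  simp only [lieF0, transport_mul hf hg]
  ring

/-- The Lie derivative is a derivation compatible with contraction: the Jacobian terms of an upper
and a lower index cancel (`e`), and the weights add. -/
lemma lie_dot₁ {w' : ℝ} {V f : Fin n → Coord n → ℝ} (hV : ∀ i, ContDiff ℝ ∞ (V i))
    (hf : ∀ i, ContDiff ℝ ∞ (f i)) (x : Coord n) :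
    lieF0 X (w + w') (fun x => dot₁ (fun i => V i x) (fun i => f i x)) x
      = dot₁ (fun i => lieV1 X w V i x) (fun i => f i x)
        + dot₁ (fun i => V i x) (fun i => lieF1 X w' f i x) := by
  have e : ∑ i, (∑ m, pd m (X i) x * V m x) * f i x = ∑ i, V i x * ∑ m, pd i (X m) x * f m x := by
    simp only [Finset.sum_mul, Finset.mul_sum]
    rw [Finset.sum_comm]
    exact Finset.sum_congr rfl fun _ _ => Finset.sum_congr rfl fun _ _ => by ring
  simp only [lieF0, dot₁]
  rw [transport_sum (f := fun i x => V i x * f i x) _ (fun i => by fun_prop)]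
  simp only [transport_mul (hV _) (hf _), lieV1, lieF1, add_mul, sub_mul, mul_add,
    Finset.sum_add_distrib, Finset.sum_sub_distrib, e, Finset.mul_sum]
  simp only [← Finset.sum_add_distrib, ← Finset.sum_sub_distrib]
  exact Finset.sum_congr rfl fun i _ => by ring

lemma lie_dot₂ {w' : ℝ} {B f : Fin n → Fin n → Coord n → ℝ} (hB : ∀ i j, ContDiff ℝ ∞ (B i j))
    (hf : ∀ i j, ContDiff ℝ ∞ (f i j)) (x : Coord n) :
    lieF0 X (w + w') (fun x => dot₂ (fun i j => B i j x) (fun i j => f i j x)) x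
      = dot₂ (fun i j => lieV2 X w B i j x) (fun i j => f i j x)
        + dot₂ (fun i j => B i j x) (fun i j => lieF2 X w' f i j x) := by
  have e2 : ∑ i, ∑ j, (∑ m, pd m (X j) x * B i m x) * f i j x
      = ∑ i, ∑ j, B i j x * ∑ m, pd j (X m) x * f i m x := by
    refine Finset.sum_congr rfl fun i _ => ?_
    simp only [Finset.sum_mul, Finset.mul_sum]
    rw [Finset.sum_comm]
    exact Finset.sum_congr rfl fun _ _ => Finset.sum_congr rfl fun _ _ => by ring
  have e1 : ∑ i, ∑ j, (∑ m, pd m (X i) x * B m j x) * f i j x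
      = ∑ i, ∑ j, B i j x * ∑ m, pd i (X m) x * f m j x := by
    simp only [Finset.sum_mul, Finset.mul_sum]
    rw [sum_reverse₃]
    exact Finset.sum_congr rfl fun _ _ => Finset.sum_congr rfl fun _ _ =>
      Finset.sum_congr rfl fun _ _ => by ring
  simp only [lieF0, dot₂]
  rw [transport_sum (f := fun i x => ∑ j, B i j x * f i j x) _ (fun i => by fun_prop)]
  simp only [fun i => transport_sum (X := X) (f := fun j x => B i j x * f i j x) Finset.univ
    (fun j => by fun_prop) x]
  simp only [transport_mul (hB _ _) (hf _ _), lieV2, lieF2, add_mul, sub_mul, mul_add,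
    Finset.sum_add_distrib, Finset.sum_sub_distrib, e1, e2, Finset.mul_sum]
  simp only [← Finset.sum_add_distrib, ← Finset.sum_sub_distrib]
  exact Finset.sum_congr rfl fun i _ => Finset.sum_congr rfl fun j _ => by ring

lemma lie_dot₃ {w' : ℝ} {P f : Fin n → Fin n → Fin n → Coord n → ℝ}
    (hP : ∀ i j k, ContDiff ℝ ∞ (P i j k)) (hf : ∀ i j k, ContDiff ℝ ∞ (f i j k)) (x : Coord n) :
    lieF0 X (w + w') (fun x => dot₃ (fun i j k => P i j k x) (fun i j k => f i j k x)) x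
      = dot₃ (fun i j k => lieV3 X w P i j k x) (fun i j k => f i j k x)
        + dot₃ (fun i j k => P i j k x) (fun i j k => lieF3 X w' f i j k x) := by
  have e3 : ∑ i, ∑ j, ∑ k, (∑ m, pd m (X k) x * P i j m x) * f i j k x
      = ∑ i, ∑ j, ∑ k, P i j k x * ∑ m, pd k (X m) x * f i j m x := by
    refine Finset.sum_congr rfl fun i _ => Finset.sum_congr rfl fun j _ => ?_
    simp only [Finset.sum_mul, Finset.mul_sum]
    rw [Finset.sum_comm]
    exact Finset.sum_congr rfl fun _ _ => Finset.sum_congr rfl fun _ _ => by ring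
  have e2 : ∑ i, ∑ j, ∑ k, (∑ m, pd m (X j) x * P i m k x) * f i j k x
      = ∑ i, ∑ j, ∑ k, P i j k x * ∑ m, pd j (X m) x * f i m k x := by
    refine Finset.sum_congr rfl fun i _ => ?_
    simp only [Finset.sum_mul, Finset.mul_sum]
    rw [sum_reverse₃]
    exact Finset.sum_congr rfl fun _ _ => Finset.sum_congr rfl fun _ _ =>
      Finset.sum_congr rfl fun _ _ => by ring
  have e1 : ∑ i, ∑ j, ∑ k, (∑ m, pd m (X i) x * P m j k x) * f i j k x
      = ∑ i, ∑ j, ∑ k, P i j k x * ∑ m, pd i (X m) x * f m j k x := by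
    rw [Finset.sum_comm]
    conv_rhs => rw [Finset.sum_comm]
    refine Finset.sum_congr rfl fun j _ => ?_
    simp only [Finset.sum_mul, Finset.mul_sum]
    rw [sum_reverse₃]
    exact Finset.sum_congr rfl fun _ _ => Finset.sum_congr rfl fun _ _ =>
      Finset.sum_congr rfl fun _ _ => by ring
  simp only [lieF0, dot₃]
  rw [transport_sum (f := fun i x => ∑ j, ∑ k, P i j k x * f i j k x) _ (fun i => by fun_prop)]
  simp only [fun i => transport_sum (X := X) (f := fun j x => ∑ k, P i j k x * f i j k x)
    Finset.univ (fun j => by fun_prop) x]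
  simp only [fun i j => transport_sum (X := X) (f := fun k x => P i j k x * f i j k x)
    Finset.univ (fun k => by fun_prop) x]
  simp only [transport_mul (hP _ _ _) (hf _ _ _), lieV3, lieF3, add_mul, sub_mul, mul_add,
    Finset.sum_add_distrib, Finset.sum_sub_distrib, e1, e2, e3, Finset.mul_sum]
  simp only [← Finset.sum_add_distrib, ← Finset.sum_sub_distrib]
  exact Finset.sum_congr rfl fun i _ => Finset.sum_congr rfl fun j _ =>
    Finset.sum_congr rfl fun k _ => by ring

/-! ### Equivariance of the flat formula -/

/-- The zero connection has no curvature, so β₂, η₂ and η₃ drop out. -/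
lemma quantDiv_zero (κ : Coeffs) (lam del : ℝ) (P : Fin n → Fin n → Fin n → Coord n → ℝ)
    (φ : Coord n → ℝ) (x : Coord n) : quantDiv κ lam del 0 P φ x =
      dot₃ (fun i j k => P i j k x) (fun i j k => pd i (pd j (pd k φ)) x)
      + κ.α * dot₂ (fun i j => ∑ k, pd k (P i j k) x) (fun i j => pd i (pd j φ) x)
      + κ.β₁ * dot₁ (fun i => ∑ j, pd j (fun x => ∑ k, pd k (P i j k) x) x) (fun k => pd k φ x)
      + κ.η₁ * ((∑ i, pd i (fun x => ∑ j, pd j (fun x => ∑ k, pd k (P i j k) x) x) x) * φ x) := by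
  have h0 : ∀ i x, gam (0 : LocalConn n) i x = 0 := fun i x => by simp [gam]
  have c0 : cv0 (0 : LocalConn n) lam φ = fun i => pd i φ := by
    funext i x; simp [cv0, h0]
  have c1 : ∀ f, cv1 (0 : LocalConn n) lam f = fun i j => pd i (f j) := fun f => by
    funext i j x; simp [cv1, h0]
  have c2 : ∀ w f, cv2 (0 : LocalConn n) w f = fun i j k => pd i (f j k) := fun w f => by
    funext i j k x; simp [cv2, h0]
  have d3 : dv3 (0 : LocalConn n) del P = fun i j x => ∑ k, pd k (P i j k) x := by
    funext i j x; simp [dv3, h0]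
  have d2 : ∀ f, dv2 (0 : LocalConn n) del f = fun i x => ∑ j, pd j (f i j) x := fun f => by
    funext i x; simp [dv2, h0]
  have d1 : ∀ f x, dv1 (0 : LocalConn n) del f x = ∑ i, pd i (f i) x := fun f x => by
    simp [dv1, h0]
  have r : ric (0 : LocalConn n) = fun _ _ _ => 0 := by
    funext i j x
    have hz : ∀ (a : Fin n) y, pd a (0 : Coord n → ℝ) y = 0 := fun a y => pd_const a 0 y
    simp [ric_apply, hz]
  simp only [quantDiv, c0, c1, c2, d3, d2, d1, r, pd_const]
  simp [dot₃, dot₂]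
  ring

lemma lieF0_add {f g : Coord n → ℝ} (hf : ContDiff ℝ ∞ f) (hg : ContDiff ℝ ∞ g) (r : ℝ)
    (x : Coord n) : lieF0 X w (fun x => f x + r * g x) x = lieF0 X w f x + r * lieF0 X w g x := by
  have : transport X (fun x => f x + r * g x) x = transport X f x + r * transport X g x := by
    unfold transport
    rw [Finset.mul_sum, ← Finset.sum_add_distrib]
    refine Finset.sum_congr rfl fun m _ => ?_
    rw [pd_add (ContDiff.diffAt hf x) ((ContDiff.diffAt hg x).const_mul r),
      pd_const_mul r (ContDiff.diffAt hg x)]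
    ring
  simp only [lieF0, this]
  ring

/-- All commutators of the Lie derivative with derivatives and divergences are linear in the
constant c, so no terms quadratic in c and no derivatives of c appear. The defect of equivariance is
therefore made of the contractions with indices 0, 1 and 4, whose coefficients are assumed to
vanish. -/
lemma quantDiv_zero_equivariant (hX : IsProjField X c) (κ : Coeffs) (lam del : ℝ)
    {P : Fin n → Fin n → Fin n → Coord n → ℝ}
    (h12 : ∀ i j k, P i j k = P j i k) (h23 : ∀ i j k, P i j k = P i k j)
    (hP : ∀ i j k, ContDiff ℝ ∞ (P i j k)) {φ : Coord n → ℝ} (hφ : ContDiff ℝ ∞ φ)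
    (k0 : shiftCoeff κ (lam * (n + 1)) (n + 5 - del * (n + 1)) (n - 1) 0 = 0)
    (k1 : shiftCoeff κ (lam * (n + 1)) (n + 5 - del * (n + 1)) (n - 1) 1 = 0)
    (k4 : shiftCoeff κ (lam * (n + 1)) (n + 5 - del * (n + 1)) (n - 1) 4 = 0) (x : Coord n) :
    quantDiv κ lam del 0 (lieV3 X del P) φ x + quantDiv κ lam del 0 P (lieF0 X lam φ) x
      = lieF0 X (del + lam) (quantDiv κ lam del 0 P φ) x := by
  obtain ⟨a, ha⟩ : ∃ a, a = lam * (n + 1) := ⟨_, rfl⟩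
  obtain ⟨e, he⟩ : ∃ e, e = n + 5 - del * (n + 1) := ⟨_, rfl⟩
  rw [← ha, ← he] at k0 k1 k4
  have h := hX.smooth
  set D1 : Fin n → Fin n → Coord n → ℝ := fun i j x => ∑ k, pd k (P i j k) x with hD1
  set D2 : Fin n → Coord n → ℝ := fun i x => ∑ j, pd j (D1 i j) x with hD2
  set D3 : Coord n → ℝ := fun x => ∑ i, pd i (D2 i) x with hD3
  have sD1 : ∀ i j, ContDiff ℝ ∞ (D1 i j) := fun i j => by simp only [hD1]; fun_prop
  have sD2 : ∀ i, ContDiff ℝ ∞ (D2 i) := fun i => by simp only [hD2]; fun_prop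
  have sD3 : ContDiff ℝ ∞ D3 := by simp only [hD3]; fun_prop
  have yD1 : ∀ i j, D1 i j = D1 j i := fun i j => by
    simp only [hD1]; funext x; exact Finset.sum_congr rfl fun k _ => by rw [h12]
  -- derivatives of the density
  have A1 : ∀ k, pd k (lieF0 X lam φ) = fun x => lieF1 X lam (fun k => pd k φ) k x
      + a * (c k * φ x) := fun k => by
    rw [ha]; exact congrFun (pd_lieF0 hX hφ) k
  have sF1 : ∀ k, ContDiff ℝ ∞ (lieF1 X lam (fun k => pd k φ) k) := fun k => by
    unfold lieF1; fun_prop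
  have sF2 : ∀ j k, ContDiff ℝ ∞ (lieF2 X lam (fun j k => pd j (pd k φ)) j k) := fun j k => by
    unfold lieF2; fun_prop
  have A2 : ∀ j k, pd j (pd k (lieF0 X lam φ)) = fun x =>
      lieF2 X lam (fun j k => pd j (pd k φ)) j k x + (1 + a) * (c j * pd k φ x)
        + (1 + a) * (c k * pd j φ x) := fun j k => by
    funext x
    have e1 := congrFun (congrFun (congrFun
      (pd_lieF1 (w := lam) hX (f := fun k => pd k φ) (by fun_prop)) j) k) x
    rw [A1, pd_add (ContDiff.diffAt (sF1 k) x) (ContDiff.diffAt (by fun_prop) x),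
      pd_const_mul a (ContDiff.diffAt (by fun_prop) x),
      pd_const_mul (c k) (ContDiff.diffAt hφ x), e1, ← ha]
    ring
  have A3 : ∀ i j k, pd i (pd j (pd k (lieF0 X lam φ))) x =
      lieF3 X lam (fun i j k => pd i (pd j (pd k φ))) i j k x
        + ((2 + a) * (c j * pd i (pd k φ) x) + c k * pd j (pd i φ) x
          + (2 + a) * (c i * pd j (pd k φ) x) + (1 + a) * (c k * pd i (pd j φ) x)) := fun i j k => by
    have e1 := congrFun (congrFun (congrFun (congrFun
      (pd_lieF2 (w := lam) hX (f := fun j k => pd j (pd k φ)) (by fun_prop)) i) j) k) x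
    rw [A2, pd_add (ContDiff.diffAt (f := fun x => lieF2 X lam (fun j k => pd j (pd k φ)) j k x
        + (1 + a) * (c j * pd k φ x)) (by fun_prop) x) (ContDiff.diffAt (by fun_prop) x),
      pd_add (ContDiff.diffAt (sF2 j k) x) (ContDiff.diffAt (by fun_prop) x),
      pd_const_mul (1 + a) (ContDiff.diffAt (by fun_prop) x),
      pd_const_mul (1 + a) (ContDiff.diffAt (by fun_prop) x),
      pd_const_mul (c j) (ContDiff.diffAt (by fun_prop) x),
      pd_const_mul (c k) (ContDiff.diffAt (by fun_prop) x), e1, ← ha]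
    ring
  -- divergences of the symbol
  have sV2 : ∀ i j, ContDiff ℝ ∞ (lieV2 X del D1 i j) := fun i j => by
    unfold lieV2; fun_prop
  have sV1 : ∀ i, ContDiff ℝ ∞ (lieV1 X del D2 i) := fun i => by
    unfold lieV1; fun_prop
  have B1 : ∀ i j, (fun x => ∑ k, pd k (lieV3 X del P i j k) x)
      = fun x => lieV2 X del D1 i j x + (-e) * ∑ k, c k * P i j k x := fun i j => by
    funext x
    rw [div_lieV3 hX h12 h23 hP, ← he]
  have B2 : ∀ i, (fun x => ∑ j, pd j (fun x => ∑ k, pd k (lieV3 X del P i j k) x) x)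
      = fun x => lieV1 X del D2 i x + (-(2 * e - 2)) * ∑ k, c k * D1 i k x := fun i => by
    funext x
    have e1 : ∀ j, pd j (fun x => ∑ k, c k * P i j k x) x = ∑ k, c k * pd j (P i k j) x := by
      intro j
      rw [pd_sum (f := fun k x => c k * P i j k x) fun k _ => ContDiff.diffAt (by fun_prop) x]
      exact Finset.sum_congr rfl fun k _ => by
        rw [pd_const_mul _ (ContDiff.diffAt (hP i j k) x), h23]
    have e2 : ∀ j, pd j (fun x => ∑ k, pd k (lieV3 X del P i j k) x) x
        = pd j (lieV2 X del D1 i j) x + (-e) * ∑ k, c k * pd j (P i k j) x := by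
      intro j
      rw [B1, pd_add (ContDiff.diffAt (sV2 i j) x) (ContDiff.diffAt (by fun_prop) x),
        pd_const_mul (-e) (ContDiff.diffAt (by fun_prop) x), e1]
    have e3 : ∑ j, ∑ k, c k * pd j (P i k j) x = ∑ k, c k * D1 i k x := by
      rw [Finset.sum_comm]
      simp only [← Finset.mul_sum, hD1]
    have e4 : (n : ℝ) + 3 - del * (n + 1) = e - 2 := by rw [he]; ring
    simp only [e2, Finset.sum_add_distrib, ← Finset.mul_sum, e3]
    rw [div_lieV2 hX yD1 sD1, e4]
    ring
  have B3 : ∑ i, pd i (fun x => ∑ j, pd j (fun x => ∑ k, pd k (lieV3 X del P i j k) x) x) x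
      = lieF0 X del D3 x + (-(3 * e - 6)) * ∑ k, c k * D2 k x := by
    have e1 : ∀ i, pd i (fun x => ∑ k, c k * D1 i k x) x = ∑ k, c k * pd i (D1 k i) x := by
      intro i
      rw [pd_sum (f := fun k x => c k * D1 i k x) fun k _ => ContDiff.diffAt (by fun_prop) x]
      exact Finset.sum_congr rfl fun k _ => by
        rw [pd_const_mul _ (ContDiff.diffAt (sD1 i k) x), yD1]
    have e2 : ∀ i, pd i (fun x => ∑ j, pd j (fun x => ∑ k, pd k (lieV3 X del P i j k) x) x) x
        = pd i (lieV1 X del D2 i) x + (-(2 * e - 2)) * ∑ k, c k * pd i (D1 k i) x := by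
      intro i
      rw [B2, pd_add (ContDiff.diffAt (sV1 i) x) (ContDiff.diffAt (by fun_prop) x),
        pd_const_mul (-(2 * e - 2)) (ContDiff.diffAt (by fun_prop) x), e1]
    have e3 : ∑ i, ∑ k, c k * pd i (D1 k i) x = ∑ k, c k * D2 k x := by
      rw [Finset.sum_comm]
      simp only [← Finset.mul_sum, hD2]
    have e4 : (n : ℝ) + 1 - del * (n + 1) = e - 4 := by rw [he]; ring
    simp only [e2, Finset.sum_add_distrib, ← Finset.mul_sum, e3]
    rw [div_lieV1 hX sD2, e4]
    ring
  have hQ : quantDiv κ lam del 0 P φ = fun x =>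
      dot₃ (fun i j k => P i j k x) (fun i j k => pd i (pd j (pd k φ)) x)
      + κ.α * dot₂ (fun i j => D1 i j x) (fun i j => pd i (pd j φ) x)
      + κ.β₁ * dot₁ (fun i => D2 i x) (fun k => pd k φ x) + κ.η₁ * (D3 x * φ x) :=
    funext (quantDiv_zero κ lam del P φ)
  have s3 : ContDiff ℝ ∞ (fun x => dot₃ (fun i j k => P i j k x)
      (fun i j k => pd i (pd j (pd k φ)) x)) := by unfold dot₃; fun_prop
  have s2 : ContDiff ℝ ∞ (fun x => dot₂ (fun i j => D1 i j x) (fun i j => pd i (pd j φ) x)) := by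
    unfold dot₂; fun_prop
  have s1 : ContDiff ℝ ∞ (fun x => dot₁ (fun i => D2 i x) (fun k => pd k φ x)) := by
    unfold dot₁; fun_prop
  have R : lieF0 X (del + lam) (quantDiv κ lam del 0 P φ) x
      = (dot₃ (fun i j k => lieV3 X del P i j k x) (fun i j k => pd i (pd j (pd k φ)) x)
        + dot₃ (fun i j k => P i j k x)
            (fun i j k => lieF3 X lam (fun i j k => pd i (pd j (pd k φ))) i j k x))
      + κ.α * (dot₂ (fun i j => lieV2 X del D1 i j x) (fun i j => pd i (pd j φ) x)
        + dot₂ (fun i j => D1 i j x) (fun i j => lieF2 X lam (fun j k => pd j (pd k φ)) i j x))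
      + κ.β₁ * (dot₁ (fun i => lieV1 X del D2 i x) (fun k => pd k φ x)
        + dot₁ (fun i => D2 i x) (fun k => lieF1 X lam (fun k => pd k φ) k x))
      + κ.η₁ * (lieF0 X del D3 x * φ x + D3 x * lieF0 X lam φ x) := by
    rw [hQ, lieF0_add (by fun_prop) (by fun_prop), lieF0_add (by fun_prop) s1,
      lieF0_add s3 s2, lie_mul sD3 hφ,
      lie_dot₃ (f := fun i j k => pd i (pd j (pd k φ))) hP (by fun_prop),
      lie_dot₂ (f := fun i j => pd i (pd j φ)) sD1 (by fun_prop),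
      lie_dot₁ (f := fun i => pd i φ) sD2 (by fun_prop)]
  have C3 : dot₃ (fun i j k => P i j k x) (fun i j k => pd i (pd j (pd k (lieF0 X lam φ))) x)
      = dot₃ (fun i j k => P i j k x)
          (fun i j k => lieF3 X lam (fun i j k => pd i (pd j (pd k φ))) i j k x)
        + (6 + 3 * a) * dot₃ (fun i j k => P i j k x) (fun i j k => c k * pd i (pd j φ) x) := by
    rw [← dot₃_add_mul]
    refine dot₃_eq_of_symm (fun i j k => congrFun (h12 i j k) x)
      (fun i j k => congrFun (h23 i j k) x) fun i j k => ?_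
    simp only [A3]
    ring
  have C2 : dot₂ (fun i j => D1 i j x) (fun i j => pd i (pd j (lieF0 X lam φ)) x)
      = dot₂ (fun i j => D1 i j x) (fun i j => lieF2 X lam (fun j k => pd j (pd k φ)) i j x)
        + (2 + 2 * a) * dot₂ (fun i j => D1 i j x) (fun i j => c j * pd i φ x) := by
    rw [← dot₂_add_mul]
    refine dot₂_eq_of_symm (fun i j => congrFun (yD1 i j) x) fun i j => ?_
    simp only [A2]
    ring
  have C1 : dot₁ (fun i => D2 i x) (fun k => pd k (lieF0 X lam φ) x)
      = dot₁ (fun i => D2 i x) (fun k => lieF1 X lam (fun k => pd k φ) k x)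
        + a * ((∑ k, c k * D2 k x) * φ x) := by
    simp only [A1, dot₁_add_mul]
    congr 2
    rw [dot₁, Finset.sum_mul]
    exact Finset.sum_congr rfl fun k _ => by ring
  have E2 : dot₂ (fun i j => ∑ k, pd k (lieV3 X del P i j k) x) (fun i j => pd i (pd j φ) x)
      = dot₂ (fun i j => lieV2 X del D1 i j x) (fun i j => pd i (pd j φ) x)
        + (-e) * dot₃ (fun i j k => P i j k x) (fun i j k => c k * pd i (pd j φ) x) := by
    simp only [fun i j => congrFun (B1 i j) x, dot₂, dot₃, add_mul, Finset.sum_add_distrib,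
      mul_assoc (-e), ← Finset.mul_sum, Finset.sum_mul]
    congr 2
    exact Finset.sum_congr rfl fun i _ => Finset.sum_congr rfl fun j _ =>
      Finset.sum_congr rfl fun k _ => by ring
  have E1 : dot₁ (fun i => ∑ j, pd j (fun x => ∑ k, pd k (lieV3 X del P i j k) x) x)
        (fun k => pd k φ x)
      = dot₁ (fun i => lieV1 X del D2 i x) (fun k => pd k φ x)
        + (-(2 * e - 2)) * dot₂ (fun i j => D1 i j x) (fun i j => c j * pd i φ x) := by
    simp only [fun i => congrFun (B2 i) x, dot₁, dot₂, add_mul, Finset.sum_add_distrib,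
      mul_assoc (-(2 * e - 2)), ← Finset.mul_sum, Finset.sum_mul]
    congr 2
    exact Finset.sum_congr rfl fun i _ => Finset.sum_congr rfl fun j _ => by ring
  rw [R, quantDiv_zero, quantDiv_zero, E2, E1, B3]
  change _ + (dot₃ (fun i j k => P i j k x) (fun i j k => pd i (pd j (pd k (lieF0 X lam φ))) x)
    + κ.α * dot₂ (fun i j => D1 i j x) (fun i j => pd i (pd j (lieF0 X lam φ)) x)
    + κ.β₁ * dot₁ (fun i => D2 i x) (fun k => pd k (lieF0 X lam φ) x)
    + κ.η₁ * (D3 x * lieF0 X lam φ x)) = _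
  rw [C3, C2, C1]
  simp only [shiftCoeff, Matrix.cons_val] at k0 k1 k4
  linear_combination (-dot₃ (fun i j k => P i j k x) (fun i j k => c k * pd i (pd j φ) x)) * k0
    - dot₂ (fun i j => D1 i j x) (fun i j => c j * pd i φ x) * k1
    - (∑ k, c k * D2 k x) * φ x * k4

end LieDiv

/-! ### Equivariance for the flat projective structure -/

section Equivariance

variable {n : ℕ}

lemma lieD_zero (X : Fin n → Coord n → ℝ) (w : ℝ) (φ : LocalTensor n 0 0) (a b : Fin 0 → Fin n) :
    lieD X w φ a b = lieF0 X w (φ a b) := by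
  funext x
  simp [lieD, lieF0, transport, divX, mul_assoc]

lemma lieD_three (X : Fin n → Coord n → ℝ) (w : ℝ) (P : LocalTensor n 3 0) (i j k : Fin n) :
    lieD X w P ![i, j, k] ![] = lieV3 X w (fun i j k => P ![i, j, k] ![]) i j k := by
  funext x
  simp only [lieD, lieV3, transport, divX, Fin.sum_univ_three, (update_three _ _ _ _).1,
    (update_three _ _ _ _).2.1, (update_three _ _ _ _).2.2]
  simp
  ring

lemma contDiff_lieD {p q : ℕ} {X : Fin n → Coord n → ℝ} (hX : ∀ k, ContDiff ℝ ∞ (X k)) (w : ℝ)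
    {T : LocalTensor n p q} (hT : ∀ a b, ContDiff ℝ ∞ (T a b)) (a : Fin p → Fin n)
    (b : Fin q → Fin n) : ContDiff ℝ ∞ (lieD X w T a b) := by
  unfold lieD; fun_prop

lemma lieD_perm {p q : ℕ} (X : Fin n → Coord n → ℝ) (w : ℝ) {T : LocalTensor n p q}
    (hT : ∀ (σ : Equiv.Perm (Fin p)) a b, T (a ∘ σ) b = T a b) (σ : Equiv.Perm (Fin p))
    (a : Fin p → Fin n) (b : Fin q → Fin n) : lieD X w T (a ∘ σ) b = lieD X w T a b := by
  funext x
  have hu : ∀ s m, Function.update (a ∘ σ) s m = Function.update a (σ s) m ∘ σ := fun s m => by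
    rw [Function.update_comp_equiv]; simp
  simp only [lieD, hu, hT, Function.comp_apply]
  rw [Equiv.sum_comp σ fun s => ∑ m, pd m (X (a s)) x * T (Function.update a s m) b x]

/-- The condition is linear in the pair (X, c), so the spanning fields suffice. The constant and
linear ones have c = 0, and the quadratic field with factor x^m has c = dx^m. -/
lemma isProjField_of_mem {X : Fin n → Coord n → ℝ} (hX : X ∈ projectiveFields n) :
    ∃ c, IsProjField X c := by
  have hco : ∀ (i j : Fin n) (x : Coord n), pd i (fun x => x j) x = if i = j then 1 else 0 := by
    intro i j x
    have : (fun x : Coord n => x j) = EuclideanSpace.proj (𝕜 := ℝ) j := rfl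
    rw [pd, this, ContinuousLinearMap.fderiv]
    simp [eq_comm]
  have hsm : ∀ j, ContDiff ℝ ∞ (fun x : Coord n => x j) := fun j =>
    (EuclideanSpace.proj (𝕜 := ℝ) j).contDiff
  induction hX using Submodule.span_induction with
  | mem X h =>
    rcases h with (⟨l, rfl⟩ | ⟨ij, rfl⟩) | ⟨m, rfl⟩
    · refine ⟨0, fun k => contDiff_const, fun i j k x => ?_⟩
      have : pd j (fun _ : Coord n => if k = l then (1 : ℝ) else 0) = fun _ => 0 :=
        funext fun y => pd_const _ _ _
      rw [this, pd_const]
      simp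
    · refine ⟨0, fun k => ?_, fun i j k x => ?_⟩
      · by_cases h : k = ij.2 <;> simp [h, hsm, contDiff_const]
      · have : pd j (fun x : Coord n => if k = ij.2 then x ij.1 else 0)
            = fun _ => if k = ij.2 ∧ j = ij.1 then 1 else 0 := by
          funext y
          by_cases h : k = ij.2 <;> simp [h, hco, pd_const]
        rw [this, pd_const]
        simp
    · refine ⟨fun i => if i = m then 1 else 0, fun k => (hsm m).mul (hsm k), fun i j k x => ?_⟩
      have : pd j (fun x : Coord n => x m * x k) = fun x =>
          (if j = m then 1 else 0) * x k + x m * (if j = k then 1 else 0) := by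
        funext y
        rw [pd_mul (ContDiff.diffAt (hsm m) y) (ContDiff.diffAt (hsm k) y), hco, hco]
      rw [this, pd_add (ContDiff.diffAt (contDiff_const.mul (hsm k)) x)
        (ContDiff.diffAt ((hsm m).mul contDiff_const) x), pd_const_mul _ (ContDiff.diffAt (hsm k) x),
        hco]
      have e : pd i (fun x : Coord n => x m * (if j = k then (1 : ℝ) else 0)) x
          = (if i = m then 1 else 0) * (if j = k then 1 else 0) := by
        simp only [mul_comm _ (if j = k then (1 : ℝ) else 0)]
        rw [pd_const_mul _ (ContDiff.diffAt (hsm m) x), hco]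
      rw [e]
      simp only [eq_comm (a := i) (b := k), eq_comm (a := j) (b := k)]
      by_cases h1 : k = i <;> by_cases h2 : k = j <;> simp [h1, h2]
  | zero =>
    exact ⟨0, fun k => contDiff_const, fun i j k x => by
      have : pd j (0 : Coord n → ℝ) = fun _ => 0 := funext fun y => pd_const j 0 y
      simp [this, pd_const]⟩
  | add X Y _ _ hX hY =>
    obtain ⟨c, hc, hc'⟩ := hX
    obtain ⟨d, hd, hd'⟩ := hY
    refine ⟨c + d, fun k => (hc k).add (hd k), fun i j k x => ?_⟩
    have : pd j ((X + Y) k) = fun x => pd j (X k) x + pd j (Y k) x :=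
      funext fun y => pd_add (ContDiff.diffAt (hc k) y) (ContDiff.diffAt (hd k) y)
    rw [this, pd_add (ContDiff.diffAt (contDiff_pd (hc k)) x)
      (ContDiff.diffAt (contDiff_pd (hd k)) x), hc', hd']
    simp only [Pi.add_apply]
    split_ifs <;> ring
  | smul r X _ hX =>
    obtain ⟨c, hc, hc'⟩ := hX
    refine ⟨r • c, fun k => contDiff_const.mul (hc k), fun i j k x => ?_⟩
    have : pd j ((r • X) k) = fun x => r * pd j (X k) x :=
      funext fun y => pd_const_mul r (ContDiff.diffAt (hc k) y)
    rw [this, pd_const_mul r (ContDiff.diffAt (contDiff_pd (hc k)) x), hc']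
    simp only [Pi.smul_apply, smul_eq_mul]
    split_ifs <;> ring

lemma Row.mu_eq (n : ℕ) (r : Row) : r.mu n = r.del n + r.lam n := by
  have : (n : ℝ) + 1 ≠ 0 := by positivity
  cases r <;> simp only [Row.mu, Row.del, Row.lam] <;> field_simp <;> ring

/-- A connection of the flat class is a shift of the zero connection, and on a row the formula does
not see the shift, so flat equivariance applies. -/
theorem isSlEquivariant_row (hn : 1 < n) (r : Row) (t : ℝ) {Γ : LocalConn n}
    (hΓ : IsFlatClass Γ) :
    IsSlEquivariant (r.coeffs n t) (r.lam n) (r.mu n) (r.del n) Γ := by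
  obtain ⟨θ, hθ, rfl⟩ := hΓ
  intro X hX P hP hs φ hφ
  obtain ⟨c, hc⟩ := isProjField_of_mem hX
  have hΓ : ∀ k i j, ContDiff ℝ ∞ (projShift θ k i j) := fun k i j => by
    unfold projShift
    refine ContDiff.add ?_ ?_ <;> split_ifs <;> first | exact hθ _ _ | exact contDiff_const
  have key : ∀ (P : LocalTensor n 3 0) (φ : LocalTensor n 0 0),
      (∀ a b, ContDiff ℝ ∞ (P a b)) → (∀ (σ : Equiv.Perm (Fin 3)) a b, P (a ∘ σ) b = P a b) →
      (∀ a b, ContDiff ℝ ∞ (φ a b)) →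
      quantLocal (r.coeffs n t) (r.lam n) (r.del n) (projShift θ) P φ = fun _ _ =>
        quantDiv (r.coeffs n t) (r.lam n) (r.del n) 0 (fun i j k => P ![i, j, k] ![])
          (φ ![] ![]) := by
    intro P φ hP hs hφ
    funext a b x
    have e : projShift θ = sh 0 fun i => θ ![] ![i] := by
      funext k i j x
      simp [projShift, sh]
    rw [quantLocal_eq_quantDiv _ _ _ hΓ hP hs, e, quantDiv_sh_row hn r t (Γ := 0) (fun _ _ _ _ => rfl)
      (fun _ _ _ => contDiff_const) (fun i => hθ _ _) _ _ (fun i j k => hP _ _) (hφ _ _)]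
    · exact fun i j k x => congrFun (symbol_perm hs i j k).1 x
    · exact fun i j k x => congrFun (symbol_perm hs i j k).2 x
  funext a b x
  rw [key P φ hP hs hφ, key _ φ (contDiff_lieD hc.smooth _ hP) (lieD_perm X _ hs) hφ,
    key P _ hP hs (contDiff_lieD hc.smooth _ hφ)]
  have h := quantDiv_zero_equivariant hc (r.coeffs n t) (r.lam n) (r.del n)
    (fun i j k => (symbol_perm hs i j k).1) (fun i j k => (symbol_perm hs i j k).2)
    (fun i j k => hP _ _) (hφ ![] ![]) (shiftCoeff_row hn r t 0) (shiftCoeff_row hn r t 1)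
    (shiftCoeff_row hn r t 4) x
  simp only [lieD_three, Pi.sub_apply, lieD_zero, Row.mu_eq]
  rw [← h]
  ring

end Equivariance

/-! ### Tensor powers of a matrix -/

section TensorPower

variable {ι κ : Type*} [Fintype ι] [DecidableEq ι] [Fintype κ] [DecidableEq κ]

/-- The entries `∏ₛ J^{a' s}_{a s}` of the tensor power of a matrix. -/
def tpow (J : Matrix ι ι ℝ) (a' a : κ → ι) : ℝ := ∏ s, J (a' s) (a s)

/-- The derivative of `tpow` at `J` in the direction `K`. -/
def tpowDeriv (J K : Matrix ι ι ℝ) (a' a : κ → ι) : ℝ :=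
  ∑ s, (∏ t ∈ Finset.univ.erase s, J (a' t) (a t)) * K (a' s) (a s)

lemma tpow_update_right (J : Matrix ι ι ℝ) (a' a : κ → ι) (s : κ) (m : ι) :
    tpow J a' (Function.update a s m)
      = (∏ t ∈ Finset.univ.erase s, J (a' t) (a t)) * J (a' s) m := by
  rw [tpow, ← Finset.prod_erase_mul _ _ (Finset.mem_univ s), Function.update_self]
  congr 1
  refine Finset.prod_congr rfl fun t ht => ?_
  rw [Function.update_of_ne (Finset.ne_of_mem_erase ht)]

/-- The involution `(a, m) ↦ (update a s m, a s)`. -/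
def updateSwap (s : κ) : (κ → ι) × ι ≃ (κ → ι) × ι where
  toFun p := (Function.update p.1 s p.2, p.1 s)
  invFun p := (Function.update p.1 s p.2, p.1 s)
  left_inv p := by simp
  right_inv p := by simp

/-- The derivative of the tensor power of J in the direction JN is the tensor power followed by the
derivation that N induces on tensors. Exchanging the updated index with the summation index
(`updateSwap`) moves N across. -/
lemma sum_tpowDeriv_mul_right (J N : Matrix ι ι ℝ) (a' : κ → ι) (f : (κ → ι) → ℝ) :
    ∑ a, tpowDeriv J (J * N) a' a * f a
      = ∑ a, tpow J a' a * ∑ s, ∑ m, N (a s) m * f (Function.update a s m) := by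
  have h1 : ∀ a, tpowDeriv J (J * N) a' a * f a
      = ∑ s, ∑ m, tpow J a' (Function.update a s m) * N m (a s) * f a := fun a => by
    simp only [tpowDeriv, tpow_update_right, Matrix.mul_apply, Finset.sum_mul, Finset.mul_sum]
    exact Finset.sum_congr rfl fun s _ => Finset.sum_congr rfl fun m _ => by ring
  simp only [h1, Finset.mul_sum]
  rw [Finset.sum_comm, Finset.sum_comm (s := Finset.univ) (t := Finset.univ) (f := fun a s =>
    ∑ m, tpow J a' a * (N (a s) m * f (Function.update a s m)))]
  refine Finset.sum_congr rfl fun s _ => ?_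
  rw [← Fintype.sum_prod_type' (f := fun a m => tpow J a' (Function.update a s m) * N m (a s) * f a),
    ← Fintype.sum_prod_type' (f := fun a m =>
      tpow J a' a * (N (a s) m * f (Function.update a s m))),
    ← Equiv.sum_comp (updateSwap s)]
  refine Finset.sum_congr rfl fun p _ => ?_
  simp only [updateSwap, Equiv.coe_fn_mk, Function.update_idem, Function.update_self,
    Function.update_eq_self]
  ring

lemma tpow_update_left (J : Matrix ι ι ℝ) (a' a : κ → ι) (s : κ) (m : ι) :
    tpow J (Function.update a' s m) a
      = (∏ t ∈ Finset.univ.erase s, J (a' t) (a t)) * J m (a s) :=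
  tpow_update_right J.transpose a a' s m

lemma sum_tpowDeriv_mul_left (J B : Matrix ι ι ℝ) (a' : κ → ι) (f : (κ → ι) → ℝ) :
    ∑ a, tpowDeriv J (B * J) a' a * f a
      = ∑ s, ∑ m, B (a' s) m * ∑ a, tpow J (Function.update a' s m) a * f a := by
  simp only [tpowDeriv, tpow_update_left, Matrix.mul_apply, Finset.sum_mul, Finset.mul_sum]
  rw [Finset.sum_comm]
  refine Finset.sum_congr rfl fun s _ => ?_
  rw [Finset.sum_comm]
  exact Finset.sum_congr rfl fun m _ => Finset.sum_congr rfl fun a _ => by ring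

lemma tpowDeriv_sub (J K L : Matrix ι ι ℝ) (a' a : κ → ι) :
    tpowDeriv J (K - L) a' a = tpowDeriv J K a' a - tpowDeriv J L a' a := by
  simp only [tpowDeriv, Matrix.sub_apply, mul_sub, Finset.sum_sub_distrib]

/-- Transposing J exchanges the two index tuples of `tpow`, so the rules for upper indices give
those for lower ones. -/
lemma sum_tpowDeriv_transpose_right (J N : Matrix ι ι ℝ) (b : κ → ι) (f : (κ → ι) → ℝ) :
    ∑ b', tpowDeriv J (J * N) b' b * f b'
      = ∑ s, ∑ m, N m (b s) * ∑ b', tpow J b' (Function.update b s m) * f b' := by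
  have h := sum_tpowDeriv_mul_left J.transpose N.transpose b f
  rw [← Matrix.transpose_mul] at h
  exact h

lemma sum_tpowDeriv_transpose_left (J B : Matrix ι ι ℝ) (b : κ → ι) (f : (κ → ι) → ℝ) :
    ∑ b', tpowDeriv J (B * J) b' b * f b'
      = ∑ b', tpow J b' b * ∑ s, ∑ m, B m (b' s) * f (Function.update b' s m) := by
  have h := sum_tpowDeriv_mul_right J.transpose B.transpose b f
  rw [← Matrix.transpose_mul] at h
  exact h

lemma tpow_mul (J K : Matrix ι ι ℝ) (a b : κ → ι) :
    ∑ c, tpow J a c * tpow K c b = tpow (J * K) a b := by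
  simp only [tpow, Matrix.mul_apply, ← Finset.prod_mul_distrib]
  rw [Finset.prod_univ_sum, Fintype.piFinset_univ]

lemma tpow_one (a b : κ → ι) : tpow (1 : Matrix ι ι ℝ) a b = if a = b then 1 else 0 := by
  simp only [tpow, Matrix.one_apply, Finset.prod_ite_zero, funext_iff]
  simp

/-- The trace of an endomorphism of a tensor power is invariant under change of basis. -/
lemma sum_diag_eq_of_tpow {J : Matrix ι ι ℝ} (hJ : J.det ≠ 0) {c : ℝ}
    {f f' : (κ → ι) → (κ → ι) → ℝ}
    (h : ∀ a' b, ∑ a, tpow J a' a * f a b = c * ∑ b', tpow J b' b * f' a' b') :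
    ∑ a, f a a = c * ∑ a, f' a a := by
  have e1 : J * J⁻¹ = 1 := Matrix.mul_nonsing_inv _ (isUnit_iff_ne_zero.2 hJ)
  have e2 : J⁻¹ * J = 1 := Matrix.nonsing_inv_mul _ (isUnit_iff_ne_zero.2 hJ)
  have A : ∀ a b, f a b = c * ∑ a', tpow J⁻¹ a a' * ∑ b', tpow J b' b * f' a' b' := by
    intro a b
    have : ∑ a', tpow J⁻¹ a a' * ∑ d, tpow J a' d * f d b = f a b := by
      simp only [Finset.mul_sum, ← mul_assoc]
      rw [Finset.sum_comm]
      simp only [← Finset.sum_mul, tpow_mul, e2, tpow_one]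
      simp
    rw [← this, Finset.mul_sum]
    exact Finset.sum_congr rfl fun a' _ => by rw [h]; ring
  have B : ∀ a' b', ∑ a, tpow J⁻¹ a a' * (tpow J b' a * f' a' b')
      = if b' = a' then f' a' b' else 0 := by
    intro a' b'
    have : ∑ a, tpow J⁻¹ a a' * (tpow J b' a * f' a' b')
        = (∑ a, tpow J b' a * tpow J⁻¹ a a') * f' a' b' := by
      rw [Finset.sum_mul]; exact Finset.sum_congr rfl fun _ _ => by ring
    rw [this, tpow_mul, e1, tpow_one]
    split_ifs <;> simp
  simp only [A, ← Finset.mul_sum]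
  congr 1
  rw [Finset.sum_comm]
  refine Finset.sum_congr rfl fun a' _ => ?_
  simp only [Finset.mul_sum]
  rw [Finset.sum_comm]
  simp [B]

/-- The derivative of the determinant. -/
def detDeriv (J K : Matrix ι ι ℝ) : ℝ :=
  ∑ σ : Equiv.Perm ι, (Equiv.Perm.sign σ : ℝ) * tpowDeriv J K σ id

/-- Jacobi's formula. The summand for `s` is the determinant of J with column `s` replaced by that
of K, which Cramer's rule expresses through the adjugate. -/
lemma detDeriv_eq (J K : Matrix ι ι ℝ) : detDeriv J K = (J.adjugate * K).trace := by
  have h : ∀ s, (J.adjugate * K) s s = (J.updateCol s fun r => K r s).det := by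
    intro s
    rw [← Matrix.cramer_apply, Matrix.cramer_eq_adjugate_mulVec]
    simp [Matrix.mulVec, dotProduct, Matrix.mul_apply]
  simp only [detDeriv, Matrix.trace, Matrix.diag_apply, h, Matrix.det_apply', tpowDeriv,
    Finset.mul_sum]
  rw [Finset.sum_comm]
  refine Finset.sum_congr rfl fun s _ => Finset.sum_congr rfl fun σ _ => ?_
  rw [← Finset.prod_erase_mul _ _ (Finset.mem_univ s), Matrix.updateCol_self]
  congr 2
  refine Finset.prod_congr rfl fun t ht => ?_
  rw [Matrix.updateCol_ne (Finset.ne_of_mem_erase ht)]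
  rfl

/-- The direction JN - BJ is the one in which the Jacobian matrix varies, by `pd_jac`; cyclicity of
the trace removes J. -/
lemma detDeriv_sub_mul (J N B : Matrix ι ι ℝ) :
    detDeriv J (J * N - B * J) = J.det * (N.trace - B.trace) := by
  rw [detDeriv_eq, mul_sub, Matrix.trace_sub, ← mul_assoc, Matrix.adjugate_mul,
    ← mul_assoc, Matrix.trace_mul_comm (J.adjugate * B) J, ← mul_assoc, Matrix.mul_adjugate]
  simp [Matrix.trace_smul]
  ring

end TensorPower

/-! ### Changes of coordinates -/

section CoordChange

variable {n : ℕ}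

/-- The Jacobian matrix of a map. -/
def jacOf (τ : Coord n → Coord n) (x : Coord n) : Matrix (Fin n) (Fin n) ℝ :=
  Matrix.of fun i j => pd j (fun y => τ y i) x

/-- A smooth map `τ` from the open set `V` to the open set `V'` with invertible Jacobian. -/
structure IsCoordChange (V V' : Set (Coord n)) (τ : Coord n → Coord n) : Prop where
  isOpen : IsOpen V
  isOpen' : IsOpen V'
  mapsTo : Set.MapsTo τ V V'
  smooth : ContDiffOn ℝ ∞ τ V
  det_ne : ∀ x ∈ V, (jacOf τ x).det ≠ 0

/-- The tensor density transformation law of weight `w` on `V`. -/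
def TensorLaw {p q : ℕ} (V : Set (Coord n)) (τ : Coord n → Coord n) (w : ℝ)
    (T T' : LocalTensor n p q) : Prop :=
  ∀ x ∈ V, ∀ (a' : Fin p → Fin n) (b : Fin q → Fin n),
    ∑ a, tpow (jacOf τ x) a' a * T a b x
      = |(jacOf τ x).det| ^ w * ∑ b', tpow (jacOf τ x) b' b * T' a' b' (τ x)

/-- The transformation law of Christoffel symbols on `V`. -/
def ConnLaw (V : Set (Coord n)) (τ : Coord n → Coord n) (Γ Γ' : LocalConn n) : Prop :=
  ∀ x ∈ V, ∀ k i j, ∑ m, jacOf τ x k m * Γ m i j x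
    = pd i (pd j (fun y => τ y k)) x
      + ∑ l, ∑ m, jacOf τ x l i * jacOf τ x m j * Γ' k l m (τ x)

lemma pd_prod {κ : Type*} [Fintype κ] [DecidableEq κ] {i : Fin n} {f : κ → Coord n → ℝ}
    {x : Coord n} (hf : ∀ s, DifferentiableAt ℝ (f s) x) :
    pd i (fun x => ∏ s, f s x) x
      = ∑ s, (∏ t ∈ Finset.univ.erase s, f t x) * pd i (f s) x := by
  have h : HasFDerivAt (fun x => ∏ s, f s x) _ x :=
    HasFDerivAt.finsetProd (u := Finset.univ) fun s _ => (hf s).hasFDerivAt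
  rw [pd, h.fderiv]
  simp [pd]

lemma pd_comp {τ : Coord n → Coord n} {f : Coord n → ℝ} {x : Coord n} (i : Fin n)
    (hτ : DifferentiableAt ℝ τ x) (hf : DifferentiableAt ℝ f (τ x)) :
    pd i (fun y => f (τ y)) x = ∑ r, jacOf τ x r i * pd r f (τ x) := by
  have hc : ∀ r, pd i (fun y => τ y r) x = fderiv ℝ τ x (EuclideanSpace.single i 1) r := by
    intro r
    have h := ((EuclideanSpace.proj (𝕜 := ℝ) r).hasFDerivAt (x := τ x)).comp x hτ.hasFDerivAt
    have h' : HasFDerivAt (fun y => τ y r) _ x := h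
    rw [pd, h'.fderiv]
    rfl
  have h : HasFDerivAt (fun y => f (τ y)) _ x := hf.hasFDerivAt.comp x hτ.hasFDerivAt
  rw [pd, h.fderiv, ContinuousLinearMap.comp_apply]
  have e : fderiv ℝ τ x (EuclideanSpace.single i 1)
      = ∑ r, (jacOf τ x r i) • EuclideanSpace.single r (1 : ℝ) := by
    ext r
    simp [jacOf, hc, Finset.sum_apply, Pi.single_apply]
  rw [e, map_sum]
  simp [pd]

end CoordChange

/-! ### Covariance of the covariant derivative under changes of coordinates. -/

section Covariance

variable {n p q : ℕ} {V V' : Set (Coord n)} {τ : Coord n → Coord n} {Γ Γ' : LocalConn n}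

/-- The connection matrix `(Γ^m_{il})_{m,l}`. -/
def connMat (Γ : LocalConn n) (i : Fin n) (x : Coord n) : Matrix (Fin n) (Fin n) ℝ :=
  Matrix.of fun m l => Γ m i l x

/-- The connection matrix of `Γ'` in the direction of `∂ᵢ τ`. -/
def pullMat (τ : Coord n → Coord n) (Γ' : LocalConn n) (i : Fin n) (x : Coord n) :
    Matrix (Fin n) (Fin n) ℝ :=
  Matrix.of fun k m => ∑ r, jacOf τ x r i * Γ' k r m (τ x)

lemma ContDiffOn.diffAt {f : Coord n → ℝ} (hV : IsOpen V) (hf : ContDiffOn ℝ ∞ f V) {x : Coord n}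
    (hx : x ∈ V) : DifferentiableAt ℝ f x :=
  (hf.contDiffAt (hV.mem_nhds hx)).differentiableAt (by simp)

lemma IsCoordChange.contDiffOn_coord (h : IsCoordChange V V' τ) (k : Fin n) :
    ContDiffOn ℝ ∞ (fun y => τ y k) V :=
  (EuclideanSpace.proj (𝕜 := ℝ) k).contDiff.comp_contDiffOn h.smooth

lemma IsCoordChange.contDiffOn_jac (h : IsCoordChange V V' τ) (k l : Fin n) :
    ContDiffOn ℝ ∞ (fun y => jacOf τ y k l) V :=
  contDiffOn_pd h.isOpen (h.contDiffOn_coord k)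

lemma IsCoordChange.diffAt (h : IsCoordChange V V' τ) {x : Coord n} (hx : x ∈ V) :
    DifferentiableAt ℝ τ x :=
  (h.smooth.contDiffAt (h.isOpen.mem_nhds hx)).differentiableAt (by simp)

/-- The law of Christoffel symbols, solved for the second derivatives of τ, is the matrix equation
∂ᵢJ = JNᵢ - BᵢJ. The covariance of covariant derivatives and of curvature follows from it. -/
lemma pd_jac (hΓ : ConnLaw V τ Γ Γ') {x : Coord n} (hx : x ∈ V) (i k l : Fin n) :
    pd i (fun y => jacOf τ y k l) x
      = (jacOf τ x * connMat Γ i x - pullMat τ Γ' i x * jacOf τ x) k l := by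
  have h := hΓ x hx k i l
  simp only [Matrix.sub_apply, Matrix.mul_apply, connMat, pullMat, Matrix.of_apply, h]
  have e : ∑ m, (∑ r, jacOf τ x r i * Γ' k r m (τ x)) * jacOf τ x m l
      = ∑ r, ∑ m, jacOf τ x r i * jacOf τ x m l * Γ' k r m (τ x) := by
    simp only [Finset.sum_mul]
    rw [Finset.sum_comm]
    exact Finset.sum_congr rfl fun _ _ => Finset.sum_congr rfl fun _ _ => by ring
  rw [e]
  exact (add_sub_cancel_right _ _).symm

lemma pd_tpow {κ : Type*} [Fintype κ] [DecidableEq κ] (h : IsCoordChange V V' τ)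
    (hΓ : ConnLaw V τ Γ Γ') {x : Coord n} (hx : x ∈ V) (i : Fin n) (a' a : κ → Fin n) :
    pd i (fun y => tpow (jacOf τ y) a' a) x
      = tpowDeriv (jacOf τ x) (jacOf τ x * connMat Γ i x - pullMat τ Γ' i x * jacOf τ x) a' a := by
  unfold tpow
  rw [pd_prod fun s => ContDiffOn.diffAt h.isOpen (h.contDiffOn_jac _ _) hx]
  simp only [tpowDeriv, pd_jac hΓ hx]

lemma IsCoordChange.contDiffOn_tpow {κ : Type*} [Fintype κ] [DecidableEq κ]
    (h : IsCoordChange V V' τ) (a' a : κ → Fin n) :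
    ContDiffOn ℝ ∞ (fun y => tpow (jacOf τ y) a' a) V := by
  unfold tpow
  exact contDiffOn_prod fun s _ => h.contDiffOn_jac _ _

lemma IsCoordChange.contDiffOn_det (h : IsCoordChange V V' τ) :
    ContDiffOn ℝ ∞ (fun y => (jacOf τ y).det) V := by
  simp only [Matrix.det_apply']
  exact ContDiffOn.sum fun σ _ => contDiffOn_const.mul (h.contDiffOn_tpow σ id)

lemma pd_det (h : IsCoordChange V V' τ) (hΓ : ConnLaw V τ Γ Γ') {x : Coord n} (hx : x ∈ V)
    (i : Fin n) : pd i (fun y => (jacOf τ y).det) x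
      = (jacOf τ x).det * ((connMat Γ i x).trace - (pullMat τ Γ' i x).trace) := by
  rw [← detDeriv_sub_mul, detDeriv]
  have e : (fun y => (jacOf τ y).det)
      = fun y => ∑ σ : Equiv.Perm (Fin n), (Equiv.Perm.sign σ : ℝ) * tpow (jacOf τ y) σ id := by
    funext y; exact Matrix.det_apply' _
  have hd : ∀ σ : Equiv.Perm (Fin n), DifferentiableAt ℝ (fun y => tpow (jacOf τ y) σ id) x :=
    fun σ => ContDiffOn.diffAt h.isOpen (h.contDiffOn_tpow _ _) hx
  rw [e, pd_sum fun σ _ => (hd σ).const_mul _]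
  exact Finset.sum_congr rfl fun σ _ => by rw [pd_const_mul _ (hd σ), pd_tpow h hΓ hx]

lemma IsCoordChange.contDiffOn_absDet (h : IsCoordChange V V' τ) (w : ℝ) :
    ContDiffOn ℝ ∞ (fun y => |(jacOf τ y).det| ^ w) V := by
  intro x hx
  have h1 := h.contDiffOn_det.contDiffAt (h.isOpen.mem_nhds hx)
  refine ContDiffAt.contDiffWithinAt ?_
  have h2 : ContDiffAt ℝ ∞ (fun y => |(jacOf τ y).det|) x :=
    ContDiffAt.comp (g := fun z : ℝ => |z|) x (contDiffAt_abs (h.det_ne x hx)) h1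
  exact h2.rpow_const_of_ne (abs_ne_zero.2 (h.det_ne x hx))

/-- The logarithmic derivative of |det J|^w is w(tr N - tr B), exactly what the trace terms in the
two covariant derivatives have to absorb. -/
lemma pd_absDet (h : IsCoordChange V V' τ) (hΓ : ConnLaw V τ Γ Γ') {x : Coord n} (hx : x ∈ V)
    (w : ℝ) (i : Fin n) : pd i (fun y => |(jacOf τ y).det| ^ w) x
      = w * ((connMat Γ i x).trace - (pullMat τ Γ' i x).trace) * |(jacOf τ x).det| ^ w := by
  have hne := h.det_ne x hx
  have hd : HasFDerivAt (fun y => (jacOf τ y).det) _ x :=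
    (ContDiffOn.diffAt h.isOpen h.contDiffOn_det hx).hasFDerivAt
  have h1 := (Real.hasDerivAt_rpow_const (x := |(jacOf τ x).det|) (p := w)
    (Or.inl (abs_ne_zero.2 hne))).comp_hasFDerivAt x ((hasDerivAt_abs hne).comp_hasFDerivAt x hd)
  have h2 : HasFDerivAt (fun y => |(jacOf τ y).det| ^ w) _ x := h1
  have h3 := pd_det h hΓ hx i
  rw [pd] at h3
  have h4 : (SignType.sign (jacOf τ x).det : ℝ) * (jacOf τ x).det = |(jacOf τ x).det| :=
    sign_mul_self _
  rw [pd, h2.fderiv]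
  simp only [smul_apply, smul_eq_mul, h3]
  rw [Real.rpow_sub_one (abs_ne_zero.2 hne)]
  have h5 := abs_ne_zero.2 hne
  rw [← mul_assoc (SignType.sign (jacOf τ x).det : ℝ), h4]
  field_simp

lemma sum_fin_succ_fun {M : Type*} [AddCommMonoid M] (f : (Fin (q + 1) → Fin n) → M) :
    ∑ c, f c = ∑ r, ∑ b, f (Fin.cons r b) := by
  rw [← (Fin.consEquiv fun _ => Fin n).sum_comp, Fintype.sum_prod_type]
  rfl

lemma sum_sum_mul_sum {ι₁ ι₂ ι₃ : Type*} [Fintype ι₁] [Fintype ι₂] [Fintype ι₃]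
    (c : ι₁ → ι₂ → ℝ) (t : ι₃ → ℝ) (f : ι₁ → ι₂ → ι₃ → ℝ) :
    ∑ s, ∑ m, c s m * ∑ a, t a * f s m a = ∑ a, t a * ∑ s, ∑ m, c s m * f s m a := by
  simp only [Finset.mul_sum]
  rw [Finset.sum_comm (s := (Finset.univ : Finset ι₃))]
  refine Finset.sum_congr rfl fun s _ => ?_
  rw [Finset.sum_comm (s := (Finset.univ : Finset ι₃))]
  exact Finset.sum_congr rfl fun m _ => Finset.sum_congr rfl fun a _ => by ring

lemma sum_sum_sum_mul {ι₁ ι₂ ι₃ : Type*} [Fintype ι₁] [Fintype ι₂] [Fintype ι₃]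
    (t : ι₃ → ℝ) (c : ι₁ → ι₂ → ι₃ → ℝ) (f : ι₁ → ι₂ → ℝ) :
    ∑ s, ∑ m, (∑ r, t r * c s m r) * f s m = ∑ r, t r * ∑ s, ∑ m, c s m r * f s m := by
  have h := sum_sum_mul_sum (fun _ _ => (1 : ℝ)) t (fun s m r => c s m r * f s m)
  simp only [one_mul] at h
  rw [← h]
  simp only [Finset.sum_mul, mul_assoc]

/-- The covariant derivative of a tensor density transforms as a tensor density. -/
theorem TensorLaw.covD (h : IsCoordChange V V' τ) (hΓ : ConnLaw V τ Γ Γ') {w : ℝ}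
    {T T' : LocalTensor n p q} (hT : ∀ a b, ContDiffOn ℝ ∞ (T a b) V)
    (hT' : ∀ a b, ContDiffOn ℝ ∞ (T' a b) V') (law : TensorLaw V τ w T T') :
    TensorLaw V τ w (covD Γ w T) (covD Γ' w T') := by
  intro x hx a' b
  obtain ⟨i, b, rfl⟩ : ∃ i b', b = Fin.cons i b' := ⟨b 0, Fin.tail b, (Fin.cons_self_tail b).symm⟩
  have dT : ∀ a b, DifferentiableAt ℝ (T a b) x := fun a b => ContDiffOn.diffAt h.isOpen (hT a b) hx
  have dT' : ∀ a b, DifferentiableAt ℝ (T' a b) (τ x) := fun a b =>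
    ContDiffOn.diffAt h.isOpen' (hT' a b) (h.mapsTo hx)
  have dT'' : ∀ a b, DifferentiableAt ℝ (fun y => T' a b (τ y)) x := fun a b =>
    (dT' a b).comp x (h.diffAt hx)
  have dp : ∀ {κ : Type} [Fintype κ] [DecidableEq κ] (a' a : κ → Fin n),
      DifferentiableAt ℝ (fun y => tpow (jacOf τ y) a' a) x := fun a' a =>
    ContDiffOn.diffAt h.isOpen (h.contDiffOn_tpow a' a) hx
  have dD : DifferentiableAt ℝ (fun y => |(jacOf τ y).det| ^ w) x :=
    ContDiffOn.diffAt h.isOpen (h.contDiffOn_absDet w) hx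
  set J := jacOf τ x with hJ
  set N := connMat Γ i x with hN
  set B := pullMat τ Γ' i x with hB
  set D := |J.det| ^ w with hD
  have H1 : pd i (fun y => ∑ a, tpow (jacOf τ y) a' a * T a b y) x
      = ∑ a, tpowDeriv J (J * N - B * J) a' a * T a b x + ∑ a, tpow J a' a * pd i (T a b) x := by
    rw [pd_sum (f := fun a y => tpow (jacOf τ y) a' a * T a b y)
      fun a _ => (dp a' a).mul (dT a b), ← Finset.sum_add_distrib]
    refine Finset.sum_congr rfl fun a _ => ?_
    rw [pd_mul (dp a' a) (dT a b), pd_tpow h hΓ hx]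
  have H2 : pd i (fun y => |(jacOf τ y).det| ^ w * ∑ b', tpow (jacOf τ y) b' b * T' a' b' (τ y)) x
      = w * (N.trace - B.trace) * D * ∑ b', tpow J b' b * T' a' b' (τ x)
        + D * (∑ b', tpowDeriv J (J * N - B * J) b' b * T' a' b' (τ x)
          + ∑ b', tpow J b' b * ∑ r, J r i * pd r (T' a' b') (τ x)) := by
    have hs : DifferentiableAt ℝ (fun y => ∑ b', tpow (jacOf τ y) b' b * T' a' b' (τ y)) x :=
      DifferentiableAt.fun_sum fun b' _ => (dp b' b).mul (dT'' a' b')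
    rw [pd_mul dD hs, pd_absDet h hΓ hx,
      pd_sum (f := fun b' y => tpow (jacOf τ y) b' b * T' a' b' (τ y))
        fun b' _ => (dp b' b).mul (dT'' a' b'),
      ← Finset.sum_add_distrib]
    congr 2
    refine Finset.sum_congr rfl fun b' _ => ?_
    rw [pd_mul (dp b' b) (dT'' a' b'), pd_tpow h hΓ hx, pd_comp i (h.diffAt hx) (dT' a' b')]
  -- The transformation law is differentiated. Its N-parts complete the derivative of T to a
  -- covariant one and its B-parts do the same for T', which `L` and `R` make explicit.
  have H := (pd_congr (i := i) (Filter.eventually_of_mem (h.isOpen.mem_nhds hx)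
    fun y hy => law y hy a' b)).self_of_nhds
  rw [H1, H2] at H
  simp only [tpowDeriv_sub, sub_mul, Finset.sum_sub_distrib, sum_tpowDeriv_mul_right,
    sum_tpowDeriv_mul_left, sum_tpowDeriv_transpose_right, sum_tpowDeriv_transpose_left] at H
  have L : ∑ a, tpow J a' a * ProjQuant.covD Γ w T a (Fin.cons i b) x
      = ∑ a, tpow J a' a * pd i (T a b) x
        + ∑ a, tpow J a' a * ∑ s, ∑ m, N (a s) m * T (Function.update a s m) b x
        - ∑ s, ∑ m, N m (b s) * ∑ a, tpow J a' a * T a (Function.update b s m) x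
        - w * N.trace * ∑ a, tpow J a' a * T a b x := by
    rw [sum_sum_mul_sum (fun s m => N m (b s)) (tpow J a') fun s m a =>
      T a (Function.update b s m) x,
      Finset.mul_sum, ← Finset.sum_add_distrib, ← Finset.sum_sub_distrib,
      ← Finset.sum_sub_distrib]
    refine Finset.sum_congr rfl fun a _ => ?_
    simp only [ProjQuant.covD, Fin.cons_zero, Fin.tail_cons, hN, connMat, Matrix.of_apply,
      Matrix.trace, Matrix.diag_apply]
    ring
  have R : ∑ c, tpow J c (Fin.cons i b : Fin (q + 1) → Fin n) * ProjQuant.covD Γ' w T' a' c (τ x)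
      = ∑ b', tpow J b' b * ∑ r, J r i * pd r (T' a' b') (τ x)
        + ∑ s, ∑ m, B (a' s) m * ∑ b', tpow J b' b * T' (Function.update a' s m) b' (τ x)
        - ∑ b', tpow J b' b * ∑ s, ∑ m, B m (b' s) * T' a' (Function.update b' s m) (τ x)
        - w * B.trace * ∑ b', tpow J b' b * T' a' b' (τ x) := by
    rw [sum_sum_mul_sum (fun s m => B (a' s) m) (fun b' => tpow J b' b) fun s m b' =>
      T' (Function.update a' s m) b' (τ x), sum_fin_succ_fun, Finset.sum_comm, Finset.mul_sum, ← Finset.sum_add_distrib,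
      ← Finset.sum_sub_distrib, ← Finset.sum_sub_distrib]
    refine Finset.sum_congr rfl fun b' _ => ?_
    have e1 : ∑ s, ∑ m, B (a' s) m * T' (Function.update a' s m) b' (τ x)
        = ∑ r, J r i * ∑ s, ∑ m, Γ' (a' s) r m (τ x) * T' (Function.update a' s m) b' (τ x) := by
      exact sum_sum_sum_mul (fun r => J r i) (fun s m r => Γ' (a' s) r m (τ x)) _
    have e2 : ∑ s, ∑ m, B m (b' s) * T' a' (Function.update b' s m) (τ x)
        = ∑ r, J r i * ∑ s, ∑ m, Γ' m r (b' s) (τ x) * T' a' (Function.update b' s m) (τ x) := by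
      exact sum_sum_sum_mul (fun r => J r i) (fun s m r => Γ' m r (b' s) (τ x)) _
    have e3 : B.trace = ∑ r, J r i * ∑ m, Γ' m r m (τ x) := by
      
      simp only [hB, pullMat, Matrix.trace, Matrix.diag_apply, Matrix.of_apply, Finset.mul_sum]
      exact Finset.sum_comm
    have e4 : ∀ r, tpow J (Fin.cons r b' : Fin (q + 1) → Fin n) (Fin.cons i b)
        = J r i * tpow J b' b := fun r => by
      simp [tpow, Fin.prod_univ_succ]
    rw [e1, e2, e3]
    simp only [e4, Finset.mul_sum, Finset.sum_mul, ← Finset.sum_add_distrib,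
      ← Finset.sum_sub_distrib]
    refine Finset.sum_congr rfl fun r _ => ?_
    simp only [ProjQuant.covD, Fin.cons_zero, Fin.tail_cons, mul_add, mul_sub, Finset.mul_sum,
      Finset.sum_mul]
    simp only [mul_assoc, mul_left_comm]
  rw [L, R]
  have law' := law x hx
  simp only [← hJ, ← hD] at law'
  simp only [law', mul_left_comm _ D, ← Finset.mul_sum] at H ⊢
  linear_combination H

end Covariance

/-! ### Products, traces and transformation laws. -/

section Contraction

variable {n p q r q' : ℕ} {V V' : Set (Coord n)} {τ : Coord n → Coord n} {Γ Γ' : LocalConn n}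
  {w w' : ℝ}

lemma TensorLaw.form {S S' : LocalTensor n 0 r} (h : TensorLaw V τ w S S') {x : Coord n}
    (hx : x ∈ V) (b : Fin r → Fin n) :
    S ![] b x = |(jacOf τ x).det| ^ w * ∑ b', tpow (jacOf τ x) b' b * S' ![] b' (τ x) := by
  have := h x hx ![] b
  simpa [tpow, Fintype.sum_unique, Subsingleton.elim (default : Fin 0 → Fin n) ![]] using this

lemma tensorLaw_form {S S' : LocalTensor n 0 r}
    (h : ∀ x ∈ V, ∀ b,
      S ![] b x = |(jacOf τ x).det| ^ w * ∑ b', tpow (jacOf τ x) b' b * S' ![] b' (τ x)) :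
    TensorLaw V τ w S S' := by
  intro x hx a' b
  have := h x hx b
  rw [Subsingleton.elim a' ![]]
  simpa [tpow, Fintype.sum_unique, Subsingleton.elim (default : Fin 0 → Fin n) ![]] using this

lemma TensorLaw.scalar {S S' : LocalTensor n 0 0} (h : TensorLaw V τ w S S') {x : Coord n}
    (hx : x ∈ V) : S ![] ![] x = |(jacOf τ x).det| ^ w * S' ![] ![] (τ x) := by
  simpa [tpow, Fintype.sum_unique, Subsingleton.elim (default : Fin 0 → Fin n) ![]]
    using h.form hx ![]

/-- The product of a tensor with a covariant tensor. -/
def tmul (e : Fin q ⊕ Fin r ≃ Fin q') (T : LocalTensor n p q) (S : LocalTensor n 0 r) :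
    LocalTensor n p q' :=
  fun a b x => T a (fun s => b (e (Sum.inl s))) x * S ![] (fun s => b (e (Sum.inr s))) x

lemma TensorLaw.tmul (hV : ∀ x ∈ V, (jacOf τ x).det ≠ 0) (e : Fin q ⊕ Fin r ≃ Fin q')
    {T T' : LocalTensor n p q} {S S' : LocalTensor n 0 r} (hT : TensorLaw V τ w T T')
    (hS : TensorLaw V τ w' S S') : TensorLaw V τ (w + w') (tmul e T S) (tmul e T' S') := by
  intro x hx a' b
  -- The equivalence `e` distributes the lower slots between the two factors; `E` is the induced
  -- splitting of index tuples, along which `tpow` factors.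
  let E : (Fin q' → Fin n) ≃ (Fin q → Fin n) × (Fin r → Fin n) :=
    (Equiv.arrowCongr e.symm (Equiv.refl _)).trans (Equiv.sumArrowEquivProdArrow _ _ _)
  have hE : ∀ b, E b = (fun s => b (e (Sum.inl s)), fun s => b (e (Sum.inr s))) := fun b => rfl
  have hp : ∀ b', tpow (jacOf τ x) b' b
      = tpow (jacOf τ x) (E b').1 (E b).1 * tpow (jacOf τ x) (E b').2 (E b).2 := fun b' => by
    simp only [tpow, hE]
    rw [← e.prod_comp, Fintype.prod_sum_type]
  have h1 := hT x hx a' (E b).1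
  have h2 := hS.form hx (E b).2
  have h3 : ∑ b', tpow (jacOf τ x) b' b * ProjQuant.tmul e T' S' a' b' (τ x)
      = (∑ b', tpow (jacOf τ x) b' (E b).1 * T' a' b' (τ x))
        * ∑ b', tpow (jacOf τ x) b' (E b).2 * S' ![] b' (τ x) := by
    rw [Finset.sum_mul_sum, ← Fintype.sum_prod_type', ← E.sum_comp]
    refine Finset.sum_congr rfl fun b' _ => ?_
    rw [hp]
    simp only [ProjQuant.tmul, hE]
    ring
  have h4 : ∑ a, tpow (jacOf τ x) a' a * ProjQuant.tmul e T S a b x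
      = (∑ a, tpow (jacOf τ x) a' a * T a (E b).1 x) * S ![] (E b).2 x := by
    rw [Finset.sum_mul]
    exact Finset.sum_congr rfl fun a _ => (mul_assoc _ _ _).symm
  rw [h3, h4, h1, h2, Real.rpow_add (abs_pos.2 (hV x hx))]
  ring

lemma TensorLaw.trace (hV : ∀ x ∈ V, (jacOf τ x).det ≠ 0) {T T' : LocalTensor n p p}
    (hT : TensorLaw V τ w T T') {x : Coord n} (hx : x ∈ V) :
    ∑ a, T a a x = |(jacOf τ x).det| ^ w * ∑ a, T' a a (τ x) :=
  sum_diag_eq_of_tpow (hV x hx) (f := fun a b => T a b x) (f' := fun a b => T' a b (τ x))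
    fun a' b => hT x hx a' b

lemma sum_fin_three {M : Type*} [AddCommMonoid M] (f : (Fin 3 → Fin n) → M) :
    ∑ a, f a = ∑ i, ∑ j, ∑ k, f ![i, j, k] := by
  simp only [sum_fin_succ_fun, Fintype.sum_unique]
  exact Finset.sum_congr rfl fun i _ => Finset.sum_congr rfl fun j _ =>
    Finset.sum_congr rfl fun k _ => by congr 1

end Contraction

/-! ### Covariance of the curvature and of the Ricci tensor. -/

section Curvature

variable {n : ℕ} {V V' : Set (Coord n)} {τ : Coord n → Coord n} {Γ Γ' : LocalConn n}

/-- The curvature matrix `(R^i_{jkl})_{i,j}`. -/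
def curvMat (Γ : LocalConn n) (k l : Fin n) (x : Coord n) : Matrix (Fin n) (Fin n) ℝ :=
  Matrix.of fun i j => curvature Γ i j k l x

lemma curvMat_eq (Γ : LocalConn n) (k l : Fin n) (x : Coord n) :
    curvMat Γ k l x = Matrix.of (fun i j => pd k (Γ i l j) x) - Matrix.of (fun i j => pd l (Γ i k j) x)
      + (connMat Γ k x * connMat Γ l x - connMat Γ l x * connMat Γ k x) := by
  ext i j
  simp [curvMat, curvature, connMat, Matrix.mul_apply, Finset.sum_sub_distrib]

lemma IsCoordChange.contDiffOn_pull (h : IsCoordChange V V' τ) {f : Coord n → ℝ}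
    (hf : ContDiffOn ℝ ∞ f V') : ContDiffOn ℝ ∞ (fun y => f (τ y)) V :=
  hf.comp h.smooth h.mapsTo

lemma two_le_infty : (2 : WithTop ℕ∞) ≤ ∞ := WithTop.coe_le_coe.2 le_top

lemma pd_jac_comm (h : IsCoordChange V V' τ) {x : Coord n} (hx : x ∈ V) (r k l : Fin n) :
    pd k (fun y => jacOf τ y r l) x = pd l (fun y => jacOf τ y r k) x :=
  pd_comm (((h.contDiffOn_coord r).contDiffAt (h.isOpen.mem_nhds hx)).of_le two_le_infty)

/-- Integrability of ∂ᵢJ = JNᵢ - BᵢJ: equality of the mixed second derivatives of J says that J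
times the curvature of N equals the curvature of B times J. The curvature of the pulled-back
matrices B is the pullback of the curvature of Γ'. -/
theorem curvMat_law (h : IsCoordChange V V' τ) (hΓ : ConnLaw V τ Γ Γ')
    (sΓ : ∀ k i j, ContDiffOn ℝ ∞ (Γ k i j) V) (sΓ' : ∀ k i j, ContDiffOn ℝ ∞ (Γ' k i j) V')
    {x : Coord n} (hx : x ∈ V) (k l : Fin n) :
    jacOf τ x * curvMat Γ k l x
      = (∑ a, ∑ c, (jacOf τ x a k * jacOf τ x c l) • curvMat Γ' a c (τ x)) * jacOf τ x := by
  set J := jacOf τ x with hJ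
  let dN : Fin n → Fin n → Matrix (Fin n) (Fin n) ℝ := fun k l =>
    Matrix.of fun m j => pd k (Γ m l j) x
  let dB : Fin n → Fin n → Matrix (Fin n) (Fin n) ℝ := fun k l =>
    Matrix.of fun a m => pd k (fun y => pullMat τ Γ' l y a m) x
  have dJ : ∀ a b, DifferentiableAt ℝ (fun y => jacOf τ y a b) x := fun a b =>
    ContDiffOn.diffAt h.isOpen (h.contDiffOn_jac a b) hx
  have dΓ : ∀ k i j, DifferentiableAt ℝ (Γ k i j) x := fun k i j =>
    ContDiffOn.diffAt h.isOpen (sΓ k i j) hx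
  have dΓ' : ∀ k i j, DifferentiableAt ℝ (fun y => Γ' k i j (τ y)) x := fun k i j =>
    ContDiffOn.diffAt h.isOpen (h.contDiffOn_pull (sΓ' k i j)) hx
  have dpull : ∀ l a m, DifferentiableAt ℝ (fun y => pullMat τ Γ' l y a m) x := fun l a m => by
    simp only [pullMat, Matrix.of_apply]
    exact DifferentiableAt.fun_sum fun r _ => (dJ r l).mul (dΓ' a r m)
  have E : ∀ k l a j, pd k (fun y => pd l (fun z => jacOf τ z a j) y) x
      = ((J * connMat Γ k x - pullMat τ Γ' k x * J) * connMat Γ l x + J * dN k l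
        - (dB k l * J + pullMat τ Γ' l x * (J * connMat Γ k x - pullMat τ Γ' k x * J))) a j := by
    intro k l a j
    have e1 : (fun y => pd l (fun z => jacOf τ z a j) y) =ᶠ[nhds x] fun y =>
        ∑ m, jacOf τ y a m * Γ m l j y - ∑ m, pullMat τ Γ' l y a m * jacOf τ y m j := by
      filter_upwards [h.isOpen.mem_nhds hx] with y hy
      rw [pd_jac hΓ hy]
      rfl
    rw [(pd_congr e1).self_of_nhds,
      pd_sub (f := fun y => ∑ m, jacOf τ y a m * Γ m l j y)
        (g := fun y => ∑ m, pullMat τ Γ' l y a m * jacOf τ y m j)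
        (DifferentiableAt.fun_sum fun m _ => (dJ a m).mul (dΓ m l j))
        (DifferentiableAt.fun_sum fun m _ => (dpull l a m).mul (dJ m j)),
      pd_sum (f := fun m y => jacOf τ y a m * Γ m l j y) fun m _ => (dJ a m).mul (dΓ m l j),
      pd_sum (f := fun m y => pullMat τ Γ' l y a m * jacOf τ y m j)
        fun m _ => (dpull l a m).mul (dJ m j)]
    rw [Matrix.sub_apply, Matrix.add_apply, Matrix.add_apply, Matrix.mul_apply, Matrix.mul_apply,
      Matrix.mul_apply (M := dB k l), Matrix.mul_apply (M := pullMat τ Γ' l x),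
      ← Finset.sum_add_distrib, ← Finset.sum_add_distrib]
    congr 1
    · refine Finset.sum_congr rfl fun m _ => ?_
      rw [pd_mul (dJ a m) (dΓ m l j), pd_jac hΓ hx]
      rfl
    · refine Finset.sum_congr rfl fun m _ => ?_
      rw [pd_mul (dpull l a m) (dJ m j), pd_jac hΓ hx]
      rfl
  -- Symmetry in `k`, `l` of the second derivatives of J, both of them expressed by `E`.
  have E' : (J * connMat Γ k x - pullMat τ Γ' k x * J) * connMat Γ l x + J * dN k l
        - (dB k l * J + pullMat τ Γ' l x * (J * connMat Γ k x - pullMat τ Γ' k x * J))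
      = (J * connMat Γ l x - pullMat τ Γ' l x * J) * connMat Γ k x + J * dN l k
        - (dB l k * J + pullMat τ Γ' k x * (J * connMat Γ l x - pullMat τ Γ' l x * J)) := by
    ext a j
    rw [← E, ← E]
    exact pd_comm (((h.contDiffOn_jac a j).contDiffAt (h.isOpen.mem_nhds hx)).of_le
      two_le_infty)
  -- The non-tensorial terms contain ∂ₖJ^r_l, which is symmetric in `k`, `l` as a second derivative
  -- of τ. They cancel upon antisymmetrisation.
  have F : ∑ a, ∑ c, (J a k * J c l) • curvMat Γ' a c (τ x)
      = dB k l - dB l k + (pullMat τ Γ' k x * pullMat τ Γ' l x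
          - pullMat τ Γ' l x * pullMat τ Γ' k x) := by
    have G : ∀ k l a m, dB k l a m = ∑ r, pd k (fun y => jacOf τ y r l) x * Γ' a r m (τ x)
        + ∑ s, ∑ r, J s k * J r l * pd s (Γ' a r m) (τ x) := by
      intro k l a m
      rw [Finset.sum_comm, ← Finset.sum_add_distrib]
      simp only [dB, pullMat, Matrix.of_apply]
      rw [pd_sum (f := fun r y => jacOf τ y r l * Γ' a r m (τ y)) fun r _ =>
        (dJ r l).mul (dΓ' a r m)]
      refine Finset.sum_congr rfl fun r _ => ?_
      rw [pd_mul (dJ r l) (dΓ' a r m), pd_comp (f := Γ' a r m) k (h.diffAt hx)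
        (ContDiffOn.diffAt h.isOpen' (sΓ' a r m) (h.mapsTo hx)), Finset.mul_sum]
      congr 1
      exact Finset.sum_congr rfl fun s _ => by ring
    have K : ∀ k l (a m : Fin n), (pullMat τ Γ' k x * pullMat τ Γ' l x) a m
        = ∑ s, ∑ r, J s k * J r l * ∑ z, Γ' a s z (τ x) * Γ' z r m (τ x) := by
      intro k l a m
      simp only [Matrix.mul_apply, pullMat, Matrix.of_apply, Finset.sum_mul_sum]
      rw [Finset.sum_comm]
      refine Finset.sum_congr rfl fun s _ => ?_
      rw [Finset.sum_comm]
      refine Finset.sum_congr rfl fun r _ => ?_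
      rw [Finset.mul_sum]
      exact Finset.sum_congr rfl fun z _ => by ring
    have sw : ∀ f : Fin n → Fin n → ℝ, ∑ s, ∑ r, J s l * J r k * f s r
        = ∑ s, ∑ r, J s k * J r l * f r s := fun f => by
      rw [Finset.sum_comm]
      exact Finset.sum_congr rfl fun _ _ => Finset.sum_congr rfl fun _ _ => by ring
    ext a m
    simp only [Matrix.add_apply, Matrix.sub_apply, G, K, Matrix.sum_apply, Matrix.smul_apply,
      smul_eq_mul]
    rw [sw fun s r => pd s (Γ' a r m) (τ x), sw fun s r => ∑ z, Γ' a s z (τ x) * Γ' z r m (τ x)]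
    have c1 : ∑ r, pd k (fun y => jacOf τ y r l) x * Γ' a r m (τ x)
        = ∑ r, pd l (fun y => jacOf τ y r k) x * Γ' a r m (τ x) :=
      Finset.sum_congr rfl fun r _ => by rw [pd_jac_comm h hx]
    rw [c1, add_sub_add_left_eq_sub, ← Finset.sum_sub_distrib, ← Finset.sum_sub_distrib,
      ← Finset.sum_add_distrib]
    refine Finset.sum_congr rfl fun s _ => ?_
    rw [← Finset.sum_sub_distrib, ← Finset.sum_sub_distrib, ← Finset.sum_add_distrib]
    refine Finset.sum_congr rfl fun r _ => ?_
    simp only [curvMat, curvature, Matrix.of_apply, Finset.sum_sub_distrib]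
    ring
  rw [F, curvMat_eq]
  change J * (dN k l - dN l k + _) = _
  have E'' := sub_eq_zero.2 E'
  rw [← sub_eq_zero, ← E'']
  noncomm_ring

lemma sum_reorder₄ {ι : Type*} [Fintype ι] (f : ι → ι → ι → ι → ℝ) :
    ∑ r, ∑ a, ∑ c, ∑ s, f r a c s = ∑ a, ∑ s, ∑ c, ∑ r, f r a c s :=
  calc _ = ∑ a, ∑ r, ∑ c, ∑ s, f r a c s := Finset.sum_comm
    _ = ∑ a, ∑ r, ∑ s, ∑ c, f r a c s :=
      Finset.sum_congr rfl fun _ _ => Finset.sum_congr rfl fun _ _ => Finset.sum_comm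
    _ = ∑ a, ∑ s, ∑ r, ∑ c, f r a c s := Finset.sum_congr rfl fun _ _ => Finset.sum_comm
    _ = _ := Finset.sum_congr rfl fun _ _ => Finset.sum_congr rfl fun _ _ => Finset.sum_comm

/-- After multiplication of `curvMat_law` by the inverse of J, taking the trace joins one factor J
and the factor J⁻¹ into a Kronecker symbol; two factors J remain, as for a covariant two-tensor. -/
theorem ricci_law (h : IsCoordChange V V' τ) (hΓ : ConnLaw V τ Γ Γ')
    (sΓ : ∀ k i j, ContDiffOn ℝ ∞ (Γ k i j) V) (sΓ' : ∀ k i j, ContDiffOn ℝ ∞ (Γ' k i j) V') :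
    TensorLaw V τ 0 (ricci Γ) (ricci Γ') := by
  refine tensorLaw_form fun x hx b => ?_
  rw [Real.rpow_zero, one_mul]
  set J := jacOf τ x with hJ
  have e1 : J * J⁻¹ = 1 := Matrix.mul_nonsing_inv _ (isUnit_iff_ne_zero.2 (h.det_ne x hx))
  have e2 : J⁻¹ * J = 1 := Matrix.nonsing_inv_mul _ (isUnit_iff_ne_zero.2 (h.det_ne x hx))
  obtain ⟨j, k, rfl⟩ : ∃ j k, b = ![j, k] := ⟨b 0, b 1, by ext s; fin_cases s <;> rfl⟩
  have A : ∀ i, curvature Γ i j k i x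
      = ∑ a, ∑ s, J a k * J s j * ∑ c, ∑ r, (J c i * J⁻¹ i r) * curvature Γ' r s a c (τ x) := by
    intro i
    have h1 := curvMat_law h hΓ sΓ sΓ' hx k i
    have h2 : curvMat Γ k i x = J⁻¹ * ((∑ a, ∑ c, (J a k * J c i) • curvMat Γ' a c (τ x)) * J) := by
      rw [← h1, ← mul_assoc, e2, one_mul]
    have h3 := congrFun (congrFun h2 i) j
    rw [curvMat, Matrix.of_apply] at h3
    rw [h3]
    simp only [Matrix.mul_apply, Matrix.sum_apply, Matrix.smul_apply, smul_eq_mul, curvMat,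
      Matrix.of_apply, Finset.sum_mul, Finset.mul_sum]
    rw [sum_reorder₄]
    exact Finset.sum_congr rfl fun a _ => Finset.sum_congr rfl fun s _ =>
      Finset.sum_congr rfl fun c _ => Finset.sum_congr rfl fun r _ => by ring
  have B : ∑ i, curvature Γ i j k i x
      = ∑ a, ∑ s, J a k * J s j * ∑ c, curvature Γ' c s a c (τ x) := by
    simp only [A]
    rw [Finset.sum_comm]
    refine Finset.sum_congr rfl fun a _ => ?_
    rw [Finset.sum_comm]
    refine Finset.sum_congr rfl fun s _ => ?_
    rw [← Finset.mul_sum, Finset.sum_comm]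
    congr 1
    refine Finset.sum_congr rfl fun c _ => ?_
    rw [Finset.sum_comm]
    have e : ∀ r, ∑ i, J c i * J⁻¹ i r = if c = r then 1 else 0 := fun r => by
      rw [← Matrix.mul_apply, e1, Matrix.one_apply]
    simp only [← Finset.sum_mul, e]
    simp
  change ∑ i, curvature Γ i j k i x = _
  rw [B, Finset.sum_comm]
  simp only [sum_fin_succ_fun, Fintype.sum_unique]
  refine Finset.sum_congr rfl fun s _ => Finset.sum_congr rfl fun a _ => ?_
  have e : tpow J (Fin.cons s (Fin.cons a default) : Fin 2 → Fin n) ![j, k]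
      = J a k * J s j := by
    simp [tpow, Fin.prod_univ_two, mul_comm]
  rw [e]
  rfl

end Curvature

/-! ### Smoothness and covariance of the quantization formula. -/

section QuantLaw

variable {n p q r : ℕ} {V V' : Set (Coord n)} {τ : Coord n → Coord n} {Γ Γ' : LocalConn n}
  {w w' : ℝ}

lemma contDiffOn_covD (hV : IsOpen V) (hΓ : ∀ k i j, ContDiffOn ℝ ∞ (Γ k i j) V) (w : ℝ)
    {T : LocalTensor n p q} (hT : ∀ a b, ContDiffOn ℝ ∞ (T a b) V) (a : Fin p → Fin n)
    (b : Fin (q + 1) → Fin n) : ContDiffOn ℝ ∞ (covD Γ w T a b) V := by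
  unfold covD
  refine (((contDiffOn_pd hV (hT _ _)).add ?_).sub ?_).sub ?_
  · exact ContDiffOn.sum fun s _ => ContDiffOn.sum fun m _ => (hΓ _ _ _).mul (hT _ _)
  · exact ContDiffOn.sum fun s _ => ContDiffOn.sum fun m _ => (hΓ _ _ _).mul (hT _ _)
  · exact (contDiffOn_const.mul (ContDiffOn.sum fun m _ => hΓ _ _ _)).mul (hT _ _)

lemma contDiffOn_ricci (hV : IsOpen V) (hΓ : ∀ k i j, ContDiffOn ℝ ∞ (Γ k i j) V)
    (a : Fin 0 → Fin n) (b : Fin 2 → Fin n) : ContDiffOn ℝ ∞ (ricci Γ a b) V := by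
  unfold ricci curvature
  refine ContDiffOn.sum fun i _ => ((contDiffOn_pd hV (hΓ _ _ _)).sub
    (contDiffOn_pd hV (hΓ _ _ _))).add (ContDiffOn.sum fun m _ => ?_)
  exact ((hΓ _ _ _).mul (hΓ _ _ _)).sub ((hΓ _ _ _).mul (hΓ _ _ _))

lemma contDiffOn_quantLocal (κ : Coeffs) (lam del : ℝ) (hV : IsOpen V)
    (hΓ : ∀ k i j, ContDiffOn ℝ ∞ (Γ k i j) V) {P : LocalTensor n 3 0}
    (hP : ∀ a b, ContDiffOn ℝ ∞ (P a b) V) {φ : LocalTensor n 0 0}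
    (hφ : ∀ a b, ContDiffOn ℝ ∞ (φ a b) V) (a b : Fin 0 → Fin n) :
    ContDiffOn ℝ ∞ (quantLocal κ lam del Γ P φ a b) V := by
  have F1 := contDiffOn_covD hV hΓ lam hφ
  have F2 := contDiffOn_covD hV hΓ lam F1
  have F3 := contDiffOn_covD hV hΓ lam F2
  have G1 := contDiffOn_covD hV hΓ del hP
  have G2 := contDiffOn_covD hV hΓ del G1
  have G3 := contDiffOn_covD hV hΓ del G2
  have R0 := contDiffOn_ricci hV hΓ
  have R1 := contDiffOn_covD hV hΓ 0 R0
  unfold quantLocal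
  refine (((ContDiffOn.sum fun i _ => ContDiffOn.sum fun j _ => ContDiffOn.sum fun k _ => ?_).add
    (contDiffOn_const.mul (ContDiffOn.sum fun i _ => ContDiffOn.sum fun j _ =>
      ContDiffOn.sum fun k _ => ?_))).add (ContDiffOn.sum fun i _ => ContDiffOn.sum fun j _ =>
      ContDiffOn.sum fun k _ => ?_)).add ((ContDiffOn.sum fun i _ => ContDiffOn.sum fun j _ =>
      ContDiffOn.sum fun k _ => ?_).mul (hφ _ _))
  · exact (hP _ _).mul (F3 _ _)
  · exact (G1 _ _).mul (F2 _ _)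
  · exact ((contDiffOn_const.mul (G2 _ _)).add
      (contDiffOn_const.mul ((hP _ _).mul (R0 _ _)))).mul (F1 _ _)
  · exact ((contDiffOn_const.mul (G3 _ _)).add
      (contDiffOn_const.mul ((R0 _ _).mul (G1 _ _)))).add
      (contDiffOn_const.mul ((R1 _ _).mul (hP _ _)))

/-- The equivalence `e` prescribes which of the three upper indices meet the lower indices of T and
which meet those of S. The product then has as many lower as upper indices, and its trace is a
density. -/
lemma TensorLaw.contract (hV : ∀ x ∈ V, (jacOf τ x).det ≠ 0) (e : Fin q ⊕ Fin r ≃ Fin 3)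
    {T T' : LocalTensor n 3 q} {S S' : LocalTensor n 0 r} (hT : TensorLaw V τ w T T')
    (hS : TensorLaw V τ w' S S') {x : Coord n} (hx : x ∈ V) :
    ∑ i, ∑ j, ∑ k, T ![i, j, k] (fun s => ![i, j, k] (e (Sum.inl s))) x
        * S ![] (fun s => ![i, j, k] (e (Sum.inr s))) x
      = |(jacOf τ x).det| ^ w * |(jacOf τ x).det| ^ w'
        * ∑ i, ∑ j, ∑ k, T' ![i, j, k] (fun s => ![i, j, k] (e (Sum.inl s))) (τ x)
          * S' ![] (fun s => ![i, j, k] (e (Sum.inr s))) (τ x) := by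
  have h := (hT.tmul hV e hS).trace hV hx
  rw [sum_fin_three, sum_fin_three, Real.rpow_add (abs_pos.2 (hV x hx))] at h
  exact h

/-- A form consisting of seven full contractions, to which `TensorLaw.contract` applies. The factor
1 in the term of η₁ stands for a second tensor factor without indices. -/
lemma quantLocal_apply (κ : Coeffs) (lam del : ℝ) (Γ : LocalConn n) (P : LocalTensor n 3 0)
    (φ : LocalTensor n 0 0) (a b : Fin 0 → Fin n) (x : Coord n) :
    quantLocal κ lam del Γ P φ a b x
      = (∑ i, ∑ j, ∑ k, P ![i, j, k] ![] x
          * covD Γ lam (covD Γ lam (covD Γ lam φ)) ![] ![i, j, k] x)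
      + κ.α * (∑ i, ∑ j, ∑ k, covD Γ del P ![i, j, k] ![k] x
          * covD Γ lam (covD Γ lam φ) ![] ![i, j] x)
      + κ.β₁ * (∑ i, ∑ j, ∑ k, covD Γ del (covD Γ del P) ![i, j, k] ![i, j] x
          * covD Γ lam φ ![] ![k] x)
      + κ.β₂ * (∑ i, ∑ j, ∑ k, P ![i, j, k] ![] x * ricci Γ ![] ![i, j] x
          * covD Γ lam φ ![] ![k] x)
      + (κ.η₁ * (∑ i, ∑ j, ∑ k,
          covD Γ del (covD Γ del (covD Γ del P)) ![i, j, k] ![i, j, k] x * 1)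
        + κ.η₂ * (∑ i, ∑ j, ∑ k, covD Γ del P ![i, j, k] ![k] x * ricci Γ ![] ![i, j] x)
        + κ.η₃ * (∑ i, ∑ j, ∑ k, P ![i, j, k] ![] x * covD Γ 0 (ricci Γ) ![] ![i, j, k] x))
        * φ ![] ![] x := by
  simp only [quantLocal, add_mul, Finset.sum_add_distrib, Finset.mul_sum, Finset.sum_mul,
    mul_assoc, mul_one]
  simp only [mul_comm, mul_left_comm]
  ring_nf

/-- The quantization formula transforms as a density. -/
theorem quantLocal_law (κ : Coeffs) (lam del : ℝ) (h : IsCoordChange V V' τ)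
    (hΓ : ConnLaw V τ Γ Γ') (sΓ : ∀ k i j, ContDiffOn ℝ ∞ (Γ k i j) V)
    (sΓ' : ∀ k i j, ContDiffOn ℝ ∞ (Γ' k i j) V')
    {P P' : LocalTensor n 3 0} (hP : ∀ a b, ContDiffOn ℝ ∞ (P a b) V)
    (hP' : ∀ a b, ContDiffOn ℝ ∞ (P' a b) V') (lP : TensorLaw V τ del P P')
    {φ φ' : LocalTensor n 0 0} (hφ : ∀ a b, ContDiffOn ℝ ∞ (φ a b) V)
    (hφ' : ∀ a b, ContDiffOn ℝ ∞ (φ' a b) V') (lφ : TensorLaw V τ lam φ φ') {x : Coord n}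
    (hx : x ∈ V) :
    quantLocal κ lam del Γ P φ ![] ![] x
      = |(jacOf τ x).det| ^ (lam + del) * quantLocal κ lam del Γ' P' φ' ![] ![] (τ x) := by
  have hd := h.det_ne
  have F1 := lφ.covD h hΓ hφ hφ'
  have s1 := contDiffOn_covD h.isOpen sΓ lam hφ
  have s1' := contDiffOn_covD h.isOpen' sΓ' lam hφ'
  have F2 := F1.covD h hΓ s1 s1'
  have s2 := contDiffOn_covD h.isOpen sΓ lam s1
  have s2' := contDiffOn_covD h.isOpen' sΓ' lam s1'
  have F3 := F2.covD h hΓ s2 s2'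
  have G1 := lP.covD h hΓ hP hP'
  have t1 := contDiffOn_covD h.isOpen sΓ del hP
  have t1' := contDiffOn_covD h.isOpen' sΓ' del hP'
  have G2 := G1.covD h hΓ t1 t1'
  have t2 := contDiffOn_covD h.isOpen sΓ del t1
  have t2' := contDiffOn_covD h.isOpen' sΓ' del t1'
  have G3 := G2.covD h hΓ t2 t2'
  have R0 := ricci_law h hΓ sΓ sΓ'
  have R1 := R0.covD h hΓ (contDiffOn_ricci h.isOpen sΓ) (contDiffOn_ricci h.isOpen' sΓ')
  have one : TensorLaw V τ 0 (fun _ _ _ => (1 : ℝ) : LocalTensor n 0 0) (fun _ _ _ => 1) :=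
    tensorLaw_form fun x _ b => by simp [tpow]
  have a30 : ∀ i j k : Fin n, (fun s : Fin 3 => ![i, j, k]
      ((finSumFinEquiv : Fin 3 ⊕ Fin 0 ≃ Fin 3) (Sum.inl s))) = ![i, j, k] := fun i j k => by
    ext s; fin_cases s <;> rfl
  have a03 : ∀ i j k : Fin n, (fun s : Fin 3 => ![i, j, k]
      ((finSumFinEquiv : Fin 0 ⊕ Fin 3 ≃ Fin 3) (Sum.inr s))) = ![i, j, k] := fun i j k => by
    ext s; fin_cases s <;> rfl
  have a21 : ∀ i j k : Fin n, (fun s : Fin 2 => ![i, j, k]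
      ((finSumFinEquiv : Fin 2 ⊕ Fin 1 ≃ Fin 3) (Sum.inl s))) = ![i, j] := fun i j k => by
    ext s; fin_cases s <;> rfl
  have b21 : ∀ i j k : Fin n, (fun s : Fin 1 => ![i, j, k]
      ((finSumFinEquiv : Fin 2 ⊕ Fin 1 ≃ Fin 3) (Sum.inr s))) = ![k] := fun i j k => by
    ext s; fin_cases s; rfl
  have z0 : ∀ f : Fin 0 → Fin n, f = ![] := fun f => Subsingleton.elim _ _
  -- The single lower index of the derivative of P is the last one, `k`, and the pair `i`, `j` goes
  -- to the other factor. This order is not that of `finSumFinEquiv`, hence the swap.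
  let e12 : Fin 1 ⊕ Fin 2 ≃ Fin 3 := (Equiv.sumComm _ _).trans finSumFinEquiv
  have a12 : ∀ i j k : Fin n, (fun s : Fin 1 => ![i, j, k] (e12 (Sum.inl s))) = ![k] :=
    fun i j k => by ext s; fin_cases s; rfl
  have b12 : ∀ i j k : Fin n, (fun s : Fin 2 => ![i, j, k] (e12 (Sum.inr s))) = ![i, j] :=
    fun i j k => by ext s; fin_cases s <;> rfl
  have c02 : ∀ i j k : Fin n, (fun s : Fin 2 => ![i, j, k]
      ((finSumFinEquiv : Fin 2 ⊕ Fin 1 ≃ Fin 3) (Sum.inl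
        ((finSumFinEquiv : Fin 0 ⊕ Fin 2 ≃ Fin 2) (Sum.inr s))))) = ![i, j] := fun i j k => by
    ext s; fin_cases s <;> rfl
  have S0 := lP.contract hd (finSumFinEquiv : Fin 0 ⊕ Fin 3 ≃ Fin 3) F3 hx
  have S1 := G1.contract hd e12 F2 hx
  have S2 := G2.contract hd (finSumFinEquiv : Fin 2 ⊕ Fin 1 ≃ Fin 3) F1 hx
  have S3 := (lP.tmul hd (finSumFinEquiv : Fin 0 ⊕ Fin 2 ≃ Fin 2) R0).contract hd
    (finSumFinEquiv : Fin 2 ⊕ Fin 1 ≃ Fin 3) F1 hx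
  have S4 := G3.contract hd (finSumFinEquiv : Fin 3 ⊕ Fin 0 ≃ Fin 3) one hx
  have S5 := G1.contract hd e12 R0 hx
  have S6 := lP.contract hd (finSumFinEquiv : Fin 0 ⊕ Fin 3 ≃ Fin 3) R1 hx
  simp only [tmul, a30, a03, a21, b21, a12, b12, c02, z0, Real.rpow_zero, mul_one, add_zero]
    at S0 S1 S2 S3 S4 S5 S6
  have hs := lφ.scalar hx
  have hp := Real.rpow_add (abs_pos.2 (hd x hx)) lam del
  simp only [quantLocal_apply, mul_one]
  rw [S0, S1, S2, S3, S4, S5, S6, hs, hp]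
  ring

end QuantLaw

/-! ### Localisation by cutoff functions. -/

section Localisation

variable {n p q : ℕ} {U W : Set (Coord n)}

lemma exists_cutoff (hU : IsOpen U) {x : Coord n} (hx : x ∈ U) :
    ∃ (χ : Coord n → ℝ) (W : Set (Coord n)), IsOpen W ∧ x ∈ W ∧ W ⊆ U ∧ ContDiff ℝ ∞ χ ∧
      (∀ y ∈ W, χ y = 1) ∧ HasCompactSupport χ ∧ tsupport χ ⊆ U := by
  obtain ⟨r, hr, hr'⟩ := Metric.nhds_basis_closedBall.mem_iff.1 (hU.mem_nhds hx)
  let f : ContDiffBump x := ⟨r / 2, r, by positivity, by linarith⟩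
  refine ⟨f, Metric.ball x (r / 2), Metric.isOpen_ball, Metric.mem_ball_self (by positivity),
    fun y hy => hr' (Metric.ball_subset_closedBall (Metric.ball_subset_ball (by linarith) hy)),
    f.contDiff, fun y hy => f.one_of_mem_closedBall (Metric.ball_subset_closedBall hy),
    f.hasCompactSupport, ?_⟩
  rw [f.tsupport_eq]
  exact hr'

/-- A point outside U is also outside the closed support of χ, so the product vanishes identically
near it. -/
lemma contDiff_cutoff (hU : IsOpen U) {χ f : Coord n → ℝ} (hχ : ContDiff ℝ ∞ χ)
    (hs : tsupport χ ⊆ U) (hf : ContDiffOn ℝ ∞ f U) : ContDiff ℝ ∞ fun y => χ y * f y := by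
  rw [contDiff_iff_contDiffAt]
  intro y
  by_cases hy : y ∈ U
  · exact hχ.contDiffAt.mul (hf.contDiffAt (hU.mem_nhds hy))
  · have h : (fun y => χ y * f y) =ᶠ[nhds y] fun _ => 0 := by
      filter_upwards [(isClosed_tsupport χ).isOpen_compl.mem_nhds fun h => hy (hs h)] with z hz
      rw [image_eq_zero_of_notMem_tsupport hz, zero_mul]
    exact contDiffAt_const.congr_of_eventuallyEq h

lemma pd_eqOn (hW : IsOpen W) {f g : Coord n → ℝ} (h : ∀ y ∈ W, f y = g y) (i : Fin n) :
    ∀ y ∈ W, pd i f y = pd i g y := fun y hy =>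
  (pd_congr (Filter.eventually_of_mem (hW.mem_nhds hy) h)).self_of_nhds

variable {Γ Γ' : LocalConn n} {w : ℝ}

lemma covD_eqOn (hW : IsOpen W) (hΓ : ∀ k i j, ∀ y ∈ W, Γ k i j y = Γ' k i j y)
    {T T' : LocalTensor n p q} (hT : ∀ a b, ∀ y ∈ W, T a b y = T' a b y) (a : Fin p → Fin n)
    (b : Fin (q + 1) → Fin n) : ∀ y ∈ W, covD Γ w T a b y = covD Γ' w T' a b y := by
  intro y hy
  simp only [covD, pd_eqOn hW (hT _ _) _ y hy, hΓ _ _ _ y hy, hT _ _ y hy]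

lemma ricci_eqOn (hW : IsOpen W) (hΓ : ∀ k i j, ∀ y ∈ W, Γ k i j y = Γ' k i j y)
    (a : Fin 0 → Fin n) (b : Fin 2 → Fin n) : ∀ y ∈ W, ricci Γ a b y = ricci Γ' a b y := by
  intro y hy
  simp only [ricci, curvature, pd_eqOn hW (hΓ _ _ _) _ y hy, hΓ _ _ _ y hy]

/-- The formula is local: it involves only derivatives of the data, so its values on an open set
depend only on the data there. -/
lemma quantLocal_eqOn (κ : Coeffs) (lam del : ℝ) (hW : IsOpen W)
    (hΓ : ∀ k i j, ∀ y ∈ W, Γ k i j y = Γ' k i j y) {P P' : LocalTensor n 3 0}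
    (hP : ∀ a b, ∀ y ∈ W, P a b y = P' a b y) {φ φ' : LocalTensor n 0 0}
    (hφ : ∀ a b, ∀ y ∈ W, φ a b y = φ' a b y) (a b : Fin 0 → Fin n) :
    ∀ y ∈ W, quantLocal κ lam del Γ P φ a b y = quantLocal κ lam del Γ' P' φ' a b y := by
  have F1 := covD_eqOn (w := lam) hW hΓ hφ
  have F2 := covD_eqOn (w := lam) hW hΓ F1
  have F3 := covD_eqOn (w := lam) hW hΓ F2
  have G1 := covD_eqOn (w := del) hW hΓ hP
  have G2 := covD_eqOn (w := del) hW hΓ G1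
  have G3 := covD_eqOn (w := del) hW hΓ G2
  have R0 := ricci_eqOn hW hΓ
  have R1 := covD_eqOn (w := 0) hW hΓ R0
  intro y hy
  simp only [quantLocal, F1 _ _ y hy, F2 _ _ y hy, F3 _ _ y hy, G1 _ _ y hy, G2 _ _ y hy,
    G3 _ _ y hy, R0 _ _ y hy, R1 _ _ y hy, hP _ _ y hy, hφ _ _ y hy]

/-- The change of the quantization formula under a projective change of the connection. -/
theorem quantLocal_shift (κ : Coeffs) (lam del : ℝ) (hU : IsOpen U) {x : Coord n} (hx : x ∈ U)
    (sΓ : ∀ k i j, ContDiffOn ℝ ∞ (Γ k i j) U) (symm : ∀ k i j, ∀ y ∈ U, Γ k i j y = Γ k j i y)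
    {θ θ₁ : LocalTensor n 0 1} (hΓ' : ∀ k i j, ∀ y ∈ U, Γ' k i j y = Γ k i j y + projShift θ k i j y)
    (hθ : ∀ a b, ∀ y ∈ U, θ a b y = θ₁ a b y) (sθ : ∀ a b, ContDiff ℝ ∞ (θ₁ a b))
    {P P₁ : LocalTensor n 3 0} (hP : ∀ a b, ∀ y ∈ U, P a b y = P₁ a b y)
    (sP : ∀ a b, ContDiff ℝ ∞ (P₁ a b))
    (yP : ∀ (σ : Equiv.Perm (Fin 3)) a b, P₁ (a ∘ σ) b = P₁ a b)
    {φ φ₁ : LocalTensor n 0 0} (hφ : ∀ a b, ∀ y ∈ U, φ a b y = φ₁ a b y)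
    (sφ : ∀ a b, ContDiff ℝ ∞ (φ₁ a b)) :
    ∃ Γ₁ : LocalConn n, (∀ k i j, ContDiff ℝ ∞ (Γ₁ k i j)) ∧
      (∀ k i j y, Γ₁ k i j y = Γ₁ k j i y) ∧
      quantLocal κ lam del Γ' P φ ![] ![] x = quantLocal κ lam del Γ P φ ![] ![] x
        + ∑ s, shiftCoeff κ (lam * (n + 1)) (n + 5 - del * (n + 1)) (n - 1) s
          * shiftTerm lam del Γ₁ (fun i => θ₁ ![] ![i]) (fun i j k => P₁ ![i, j, k] ![])
              (φ₁ ![] ![]) x s := by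
  obtain ⟨χ, W, hW, hxW, hWU, sχ, hχ, -, tχ⟩ := exists_cutoff hU hx
  -- `quantDiv_sh` asks for Christoffel symbols that are smooth and symmetric on all of ℝⁿ.
  -- Multiplication by the cutoff provides this and changes nothing near x.
  let Γ₁ : LocalConn n := fun k i j y => χ y * Γ k i j y
  have s₁ : ∀ k i j, ContDiff ℝ ∞ (Γ₁ k i j) := fun k i j =>
    contDiff_cutoff hU sχ tχ (sΓ k i j)
  have y₁ : ∀ k i j y, Γ₁ k i j y = Γ₁ k j i y := by
    intro k i j y
    by_cases hy : y ∈ U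
    · simp only [Γ₁, symm k i j y hy]
    · simp only [Γ₁, image_eq_zero_of_notMem_tsupport fun h => hy (tχ h), zero_mul]
  refine ⟨Γ₁, s₁, y₁, ?_⟩
  have e1 : quantLocal κ lam del Γ P φ ![] ![] x = quantLocal κ lam del Γ₁ P₁ φ₁ ![] ![] x :=
    quantLocal_eqOn κ lam del hW (fun k i j y hy => by simp [Γ₁, hχ y hy])
      (fun a b y hy => hP a b y (hWU hy)) (fun a b y hy => hφ a b y (hWU hy)) _ _ x hxW
  have e2 : quantLocal κ lam del Γ' P φ ![] ![] x
      = quantLocal κ lam del (sh Γ₁ fun i => θ₁ ![] ![i]) P₁ φ₁ ![] ![] x := by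
    refine quantLocal_eqOn κ lam del hW (fun k i j y hy => ?_)
      (fun a b y hy => hP a b y (hWU hy)) (fun a b y hy => hφ a b y (hWU hy)) _ _ x hxW
    rw [hΓ' k i j y (hWU hy)]
    simp only [Γ₁, sh, projShift, hχ y hy, one_mul, hθ _ _ y (hWU hy)]
  have s₂ : ∀ k i j, ContDiff ℝ ∞ (sh Γ₁ (fun i => θ₁ ![] ![i]) k i j) := fun k i j => by
    have := s₁ k i j
    unfold sh
    split_ifs <;> fun_prop
  rw [e1, e2, quantLocal_eq_quantDiv _ _ _ s₂ sP yP, quantLocal_eq_quantDiv _ _ _ s₁ sP yP,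
    quantDiv_sh κ lam del y₁ s₁ (fun i => sθ _ _)
      (fun i j k y => congrFun (symbol_perm yP i j k).1 y)
      (fun i j k y => congrFun (symbol_perm yP i j k).2 y) (fun i j k => sP _ _) (sφ _ _)]

/-- For the coefficients of a row of the table, the quantization formula only depends on the
projective class. -/
theorem quantLocal_shift_row (hn : 1 < n) (r : Row) (t : ℝ) (hU : IsOpen U) {x : Coord n}
    (hx : x ∈ U) (sΓ : ∀ k i j, ContDiffOn ℝ ∞ (Γ k i j) U)
    (symm : ∀ k i j, ∀ y ∈ U, Γ k i j y = Γ k j i y)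
    {θ : LocalTensor n 0 1} (hΓ' : ∀ k i j, ∀ y ∈ U, Γ' k i j y = Γ k i j y + projShift θ k i j y)
    (sθ : ∀ a b, ContDiffOn ℝ ∞ (θ a b) U)
    {P : LocalTensor n 3 0} (sP : ∀ a b, ContDiffOn ℝ ∞ (P a b) U)
    (yP : ∀ (σ : Equiv.Perm (Fin 3)) a b, P (a ∘ σ) b = P a b)
    {φ : LocalTensor n 0 0} (sφ : ∀ a b, ContDiffOn ℝ ∞ (φ a b) U) :
    quantLocal (r.coeffs n t) (r.lam n) (r.del n) Γ' P φ ![] ![] x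
      = quantLocal (r.coeffs n t) (r.lam n) (r.del n) Γ P φ ![] ![] x := by
  obtain ⟨χ, W, hW, hxW, hWU, sχ, hχ, -, tχ⟩ := exists_cutoff hU hx
  obtain ⟨Γ₁, -, -, h⟩ := quantLocal_shift (r.coeffs n t) (r.lam n) (r.del n) hW hxW
    (Γ := Γ) (Γ' := Γ') (θ := θ) (θ₁ := fun a b y => χ y * θ a b y)
    (P := P) (P₁ := fun a b y => χ y * P a b y) (φ := φ) (φ₁ := fun a b y => χ y * φ a b y)
    (fun k i j => (sΓ k i j).mono hWU) (fun k i j y hy => symm k i j y (hWU hy))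
    (fun k i j y hy => hΓ' k i j y (hWU hy))
    (fun a b y hy => by simp [hχ y hy]) (fun a b => contDiff_cutoff hU sχ tχ (sθ a b))
    (fun a b y hy => by simp [hχ y hy]) (fun a b => contDiff_cutoff hU sχ tχ (sP a b))
    (fun σ a b => by simp only [yP])
    (fun a b y hy => by simp [hχ y hy]) (fun a b => contDiff_cutoff hU sχ tχ (sφ a b))
  rw [h]
  simp [shiftCoeff_row hn]

end Localisation

/-! ### Transition maps of charts and their cocycle relations. -/

section Charts

variable {n : ℕ} {M : Type*} [TopologicalSpace M] [ChartedSpace (Coord n) M]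

lemma jacOf_comp {τ σ : Coord n → Coord n} {x : Coord n} (hτ : DifferentiableAt ℝ τ x)
    (hσ : DifferentiableAt ℝ σ (τ x)) :
    jacOf (fun y => σ (τ y)) x = jacOf σ (τ x) * jacOf τ x := by
  ext i j
  have h : DifferentiableAt ℝ (fun y => σ y i) (τ x) :=
    (EuclideanSpace.proj (𝕜 := ℝ) i).differentiableAt.comp (τ x) hσ
  rw [Matrix.mul_apply]
  refine (pd_comp j hτ h).trans (Finset.sum_congr rfl fun r _ => mul_comm _ _)

lemma jacOf_congr {τ σ : Coord n → Coord n} {x : Coord n} (h : τ =ᶠ[nhds x] σ) :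
    jacOf τ x = jacOf σ x := by
  ext i j
  exact (pd_congr (h.mono fun y hy => by rw [hy])).self_of_nhds

lemma pd_coord (i j : Fin n) (x : Coord n) : pd i (fun x => x j) x = if i = j then 1 else 0 := by
  have : (fun x : Coord n => x j) = EuclideanSpace.proj (𝕜 := ℝ) j := rfl
  rw [pd, this, ContinuousLinearMap.fderiv]
  simp [eq_comm]

lemma jacOf_id (x : Coord n) : jacOf (fun y => y) x = 1 := by
  ext i j
  simp [jacOf, pd_coord, Matrix.one_apply, eq_comm]

lemma jac_eq (c c' : Chart n M) (x : Coord n) : jac c c' x = jacOf (transition c c') x := rfl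

lemma mem_overlap {c c' : Chart n M} {x : Coord n} :
    x ∈ overlap c c' ↔ x ∈ c.1.target ∧ c.1.symm x ∈ c'.1.source := by
  simp [overlap]

lemma isOpen_overlap (c c' : Chart n M) : IsOpen (overlap c c') :=
  (c.1.symm.trans c'.1).open_source

lemma overlap_subset (c c' : Chart n M) : overlap c c' ⊆ c.1.target := fun _ hx =>
  (mem_overlap.1 hx).1

lemma transition_mem_overlap {c c' : Chart n M} {x : Coord n} (hx : x ∈ overlap c c') :
    transition c c' x ∈ overlap c' c := by
  obtain ⟨h1, h2⟩ := mem_overlap.1 hx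
  refine mem_overlap.2 ⟨c'.1.map_source h2, ?_⟩
  rw [transition, c'.1.left_inv h2]
  exact c.1.map_target h1

lemma transition_transition {c c' c'' : Chart n M} {x : Coord n} (hx : x ∈ overlap c c') :
    transition c' c'' (transition c c' x) = transition c c'' x := by
  rw [transition, transition, c'.1.left_inv (mem_overlap.1 hx).2]
  rfl

lemma transition_self {c : Chart n M} {x : Coord n} (hx : x ∈ c.1.target) :
    transition c c x = x := c.1.right_inv hx

lemma transition_mem_overlap_iff {c c' c'' : Chart n M} {x : Coord n} (hx : x ∈ overlap c c') :
    transition c c' x ∈ overlap c' c'' ↔ x ∈ overlap c c'' := by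
  have h := mem_overlap.1 (transition_mem_overlap hx)
  rw [mem_overlap, mem_overlap]
  have e : c'.1.symm (transition c c' x) = c.1.symm x := c'.1.left_inv (mem_overlap.1 hx).2
  rw [e]
  simp [h.1, (mem_overlap.1 hx).1]

lemma contDiffOn_transition (c c' : Chart n M) :
    ContDiffOn ℝ ∞ (transition c c') (overlap c c') := by
  have h := StructureGroupoid.compatible_of_mem_maximalAtlas c.2 c'.2
  rw [contDiffGroupoid, mem_groupoid_of_pregroupoid] at h
  have h1 := h.1
  simp only [contDiffPregroupoid] at h1
  have e : transition c c' = fun x => c'.1 (c.1.symm x) := rfl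
  rw [e]
  simpa [overlap, Function.comp_def] using h1

lemma differentiableAt_transition {c c' : Chart n M} {x : Coord n} (hx : x ∈ overlap c c') :
    DifferentiableAt ℝ (transition c c') x :=
  ((contDiffOn_transition c c').contDiffAt ((isOpen_overlap c c').mem_nhds hx)).differentiableAt
    (by simp)

lemma jac_self {c : Chart n M} {x : Coord n} (hx : x ∈ c.1.target) : jac c c x = 1 := by
  rw [jac_eq, ← jacOf_id x]
  exact jacOf_congr (Filter.eventually_of_mem (c.1.open_target.mem_nhds hx)
    fun y hy => transition_self hy)

lemma overlap_self (c : Chart n M) : overlap c c = c.1.target := by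
  ext x
  rw [mem_overlap]
  exact ⟨fun h => h.1, fun h => ⟨h, c.1.map_target h⟩⟩

lemma jac_mul_jac {c c' c'' : Chart n M} {x : Coord n} (hx : x ∈ overlap c c')
    (hx' : x ∈ overlap c c'') : jac c' c'' (transition c c' x) * jac c c' x = jac c c'' x := by
  rw [jac_eq, jac_eq, ← jacOf_comp (differentiableAt_transition hx)
    (differentiableAt_transition ((transition_mem_overlap_iff hx).2 hx'))]
  exact jacOf_congr (Filter.eventually_of_mem ((isOpen_overlap c c').mem_nhds hx)
    fun y hy => transition_transition hy)

/-- The cocycle relation for going to the chart `c'` and back exhibits an inverse matrix. -/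
lemma det_jac_ne {c c' : Chart n M} {x : Coord n} (hx : x ∈ overlap c c') :
    (jac c c' x).det ≠ 0 := by
  have hc : x ∈ overlap c c := by rw [overlap_self]; exact overlap_subset c c' hx
  have h := congrArg Matrix.det (jac_mul_jac hx hc)
  rw [jac_self (overlap_subset c c' hx), Matrix.det_mul, Matrix.det_one] at h
  exact right_ne_zero_of_mul_eq_one h

lemma inv_jac {c c' : Chart n M} {x : Coord n} (hx : x ∈ overlap c c') :
    (jac c c' x)⁻¹ = jac c' c (transition c c' x) := by
  have hc : x ∈ overlap c c := by rw [overlap_self]; exact overlap_subset c c' hx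
  have h := jac_mul_jac hx hc
  rw [jac_self (overlap_subset c c' hx)] at h
  exact Matrix.inv_eq_left_inv h

lemma isCoordChange_transition (c c' : Chart n M) :
    IsCoordChange (overlap c c') c'.1.target (transition c c') where
  isOpen := isOpen_overlap c c'
  isOpen' := c'.1.open_target
  mapsTo _ hx := overlap_subset c' c (transition_mem_overlap hx)
  smooth := contDiffOn_transition c c'
  det_ne _ hx := det_jac_ne hx

lemma TensorDensity.law {p q : ℕ} {w : ℝ} (T : TensorDensity n M p q w) (c c' : Chart n M) :
    TensorLaw (overlap c c') (transition c c') w (T.1 c) (T.1 c') :=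
  T.2.2.2 c c'

lemma Connection.connLaw (D : Connection n M) (c c' : Chart n M) :
    ConnLaw (overlap c c') (transition c c') (D.Γ c) (D.Γ c') :=
  D.law c c'

/-! ### Extension of compactly supported tensors -/

section Extend

variable {p q : ℕ}

lemma sum_mul_sum_sum {α β γ : Type*} [Fintype α] [Fintype β] [Fintype γ] (u : α → ℝ) (D : ℝ)
    (f : α → β → γ → ℝ) :
    ∑ a, u a * (D * ∑ i, ∑ j, f a i j) = D * ∑ i, ∑ j, ∑ a, u a * f a i j := by
  simp only [Finset.mul_sum]
  rw [Finset.sum_comm]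
  refine Finset.sum_congr rfl fun i _ => ?_
  rw [Finset.sum_comm]
  exact Finset.sum_congr rfl fun j _ => Finset.sum_congr rfl fun a _ => by ring

/-- The tensor density on `M` with components `T₀` in the chart `c₀`. -/
def extendTensor (c₀ : Chart n M) (w : ℝ) (T₀ : LocalTensor n p q) : Chart n M → LocalTensor n p q :=
  open Classical in fun c a b x =>
    if x ∈ overlap c c₀ then
      |(jac c c₀ x).det| ^ w * ∑ a', ∑ b', tpow (jac c c₀ x)⁻¹ a a' * tpow (jac c c₀ x) b' b
        * T₀ a' b' (transition c c₀ x)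
    else 0

lemma extendTensor_self (c₀ : Chart n M) (w : ℝ) (T₀ : LocalTensor n p q) (a : Fin p → Fin n)
    (b : Fin q → Fin n) {x : Coord n} (hx : x ∈ c₀.1.target) :
    extendTensor c₀ w T₀ c₀ a b x = T₀ a b x := by
  have h : x ∈ overlap c₀ c₀ := by rwa [overlap_self]
  simp only [extendTensor, if_pos h, jac_self hx, inv_one, tpow_one, transition_self hx]
  simp

/-- The Jacobian to `c₀` factors through `c'`, and both tensor powers and |det|^w are
multiplicative. At points outside the domain of `c₀` both sides are zero. -/
lemma extendTensor_law (c₀ : Chart n M) (w : ℝ) (T₀ : LocalTensor n p q) (c c' : Chart n M)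
    {x : Coord n} (hx : x ∈ overlap c c') (a' : Fin p → Fin n) (b : Fin q → Fin n) :
    ∑ a, tpow (jac c c' x) a' a * extendTensor c₀ w T₀ c a b x
      = |(jac c c' x).det| ^ w
        * ∑ b', tpow (jac c c' x) b' b * extendTensor c₀ w T₀ c' a' b' (transition c c' x) := by
  by_cases h0 : x ∈ overlap c c₀
  swap
  · have h1 : transition c c' x ∉ overlap c' c₀ := fun h => h0 ((transition_mem_overlap_iff hx).1 h)
    simp [extendTensor, h0, h1]
  have h1 := (transition_mem_overlap_iff hx).2 h0
  simp only [extendTensor, if_pos h0, if_pos h1, transition_transition hx]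
  have hJ := jac_mul_jac hx h0
  set K := jac c c' x
  set L := jac c' c₀ (transition c c' x)
  have hK : IsUnit K.det := isUnit_iff_ne_zero.2 (det_jac_ne hx)
  rw [← hJ]
  have e1 : ∀ a'', ∑ a, tpow K a' a * tpow (L * K)⁻¹ a a'' = tpow L⁻¹ a' a'' := fun a'' => by
    rw [tpow_mul, Matrix.mul_inv_rev, ← mul_assoc, Matrix.mul_nonsing_inv _ hK, one_mul]
  rw [Matrix.det_mul, abs_mul, Real.mul_rpow (abs_nonneg _) (abs_nonneg _),
    sum_mul_sum_sum, sum_mul_sum_sum, mul_comm (|L.det| ^ w), mul_assoc]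
  congr 2
  refine Finset.sum_congr rfl fun i _ => Finset.sum_congr rfl fun j _ => ?_
  have e2 : tpow (L * K) j b = ∑ b', tpow K b' b * tpow L j b' := by
    rw [← tpow_mul]
    exact Finset.sum_congr rfl fun _ _ => mul_comm _ _
  rw [← e1, e2, hJ]
  simp only [Finset.sum_mul, Finset.mul_sum]
  rw [Finset.sum_comm]
  exact Finset.sum_congr rfl fun _ _ => Finset.sum_congr rfl fun _ _ => by ring

/-- On the domain of `c₀` the components are products of smooth functions. A point outside this
domain avoids the compact image of K, which is closed because M is Hausdorff, so the extension
vanishes near that point. -/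
lemma contDiffOn_extendTensor [T2Space M] (c₀ : Chart n M) (w : ℝ) {T₀ : LocalTensor n p q}
    (hT : ∀ a b, ContDiff ℝ ∞ (T₀ a b)) {K : Set (Coord n)} (hK : IsCompact K)
    (hK' : K ⊆ c₀.1.target) (h0 : ∀ a b, ∀ y ∉ K, T₀ a b y = 0) (c : Chart n M)
    (a : Fin p → Fin n) (b : Fin q → Fin n) :
    ContDiffOn ℝ ∞ (extendTensor c₀ w T₀ c a b) c.1.target := by
  intro x hx
  by_cases hxo : x ∈ overlap c c₀
  · have hI := isCoordChange_transition c c₀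
    have h1 : ContDiffOn ℝ ∞ (fun x => |(jac c c₀ x).det| ^ w * ∑ a', ∑ b',
        tpow (jac c c₀ x)⁻¹ a a' * tpow (jac c c₀ x) b' b * T₀ a' b' (transition c c₀ x))
        (overlap c c₀) := by
      have h2 : ∀ a' : Fin p → Fin n, ContDiffOn ℝ ∞ (fun x => tpow (jac c c₀ x)⁻¹ a a')
          (overlap c c₀) := fun a' => by
        refine (((isCoordChange_transition c₀ c).contDiffOn_tpow a a').comp hI.smooth
          fun y hy => transition_mem_overlap hy).congr fun y hy => ?_
        rw [inv_jac hy]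
        rfl
      refine (hI.contDiffOn_absDet w).mul (ContDiffOn.sum fun a' _ => ContDiffOn.sum fun b' _ =>
        ((h2 a').mul (hI.contDiffOn_tpow b' b)).mul
          ((hT a' b').comp_contDiffOn hI.smooth))
    refine ContDiffAt.contDiffWithinAt ?_
    refine (h1.contDiffAt ((isOpen_overlap c c₀).mem_nhds hxo)).congr_of_eventuallyEq ?_
    filter_upwards [(isOpen_overlap c c₀).mem_nhds hxo] with y hy
    simp only [extendTensor, if_pos hy]
  · have hC : IsCompact (c₀.1.symm '' K) :=
      hK.image_of_continuousOn (c₀.1.continuousOn_symm.mono hK')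
    have hn : c.1.symm x ∈ (c₀.1.symm '' K)ᶜ := by
      rintro ⟨y, hy, e⟩
      exact hxo (mem_overlap.2 ⟨hx, e ▸ c₀.1.map_target (hK' hy)⟩)
    refine ContDiffAt.contDiffWithinAt (contDiffAt_const (c := (0 : ℝ)) |>.congr_of_eventuallyEq ?_)
    filter_upwards [(c.1.continuousAt_symm hx).preimage_mem_nhds
      (hC.isClosed.isOpen_compl.mem_nhds hn)] with y hy
    simp only [extendTensor]
    split_ifs with hyo
    · have : transition c c₀ y ∉ K := fun h =>
        hy ⟨_, h, c₀.1.left_inv (mem_overlap.1 hyo).2⟩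
      simp [h0 _ _ _ this]
    · rfl

lemma extendTensor_mem [T2Space M] (c₀ : Chart n M) (w : ℝ) {T₀ : LocalTensor n p q}
    (hT : ∀ a b, ContDiff ℝ ∞ (T₀ a b)) {K : Set (Coord n)} (hK : IsCompact K)
    (hK' : K ⊆ c₀.1.target) (h0 : ∀ a b, ∀ y ∉ K, T₀ a b y = 0) :
    extendTensor c₀ w T₀ ∈ TensorDensity n M p q w := by
  refine ⟨contDiffOn_extendTensor c₀ w hT hK hK' h0, fun c a b x hx => ?_,
    fun c c' x hx a' b => extendTensor_law c₀ w T₀ c c' hx a' b⟩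
  rw [extendTensor, if_neg fun h => hx (overlap_subset _ _ h)]

lemma extendTensor_perm (c₀ : Chart n M) (w : ℝ) {T₀ : LocalTensor n p q}
    (hT : ∀ (σ : Equiv.Perm (Fin p)) a b, T₀ (a ∘ σ) b = T₀ a b) (c : Chart n M)
    (σ : Equiv.Perm (Fin p)) (a : Fin p → Fin n) (b : Fin q → Fin n) :
    extendTensor c₀ w T₀ c (a ∘ σ) b = extendTensor c₀ w T₀ c a b := by
  funext x
  simp only [extendTensor]
  split_ifs
  · congr 1
    rw [← (Equiv.arrowCongr σ.symm (Equiv.refl (Fin n))).sum_comp]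
    refine Finset.sum_congr rfl fun a' _ => Finset.sum_congr rfl fun b' _ => ?_
    have e : (Equiv.arrowCongr σ.symm (Equiv.refl (Fin n))) a' = a' ∘ σ := rfl
    rw [e, hT]
    congr 2
    exact Equiv.prod_comp σ fun s => (jac c c₀ x)⁻¹ (a s) (a' s)
  · rfl

end Extend

end Charts

/-! ### Shifted connections, dilated charts and compactly supported tensors. -/

section ManifoldTests

variable {n : ℕ} {M : Type*} [TopologicalSpace M] [ChartedSpace (Coord n) M]

lemma contDiffOn_projShift {U : Set (Coord n)} {θ : LocalTensor n 0 1}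
    (hθ : ∀ a b, ContDiffOn ℝ ∞ (θ a b) U) (k i j : Fin n) :
    ContDiffOn ℝ ∞ (projShift θ k i j) U := by
  unfold projShift
  refine ContDiffOn.add ?_ ?_ <;> split_ifs <;> first | exact hθ _ _ | exact contDiffOn_const

/-- The projectively equivalent connection given by a one-form. -/
def Connection.shift (D : Connection n M) (θ : TensorDensity n M 0 1 0) : Connection n M where
  Γ c k i j x := D.Γ c k i j x + projShift (θ.1 c) k i j x
  smooth c k i j := (D.smooth c k i j).add (contDiffOn_projShift (θ.2.1 c) k i j)
  symm c k i j x hx := by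
    rw [D.symm c k i j x hx, projShift, projShift, add_comm (if k = i then _ else (0 : ℝ))]
  law c c' x hx k i j := by
    have hθ : ∀ j, θ.1 c ![] ![j] x
        = ∑ m, jac c c' x m j * θ.1 c' ![] ![m] (transition c c' x) := fun j => by
      have h := (TensorDensity.law θ c c').form hx ![j]
      rw [Real.rpow_zero, one_mul, sum_fin_succ_fun] at h
      rw [h]
      simp only [Fintype.sum_unique]
      refine Finset.sum_congr rfl fun m _ => ?_
      simp [tpow, jac_eq, Fin.cons_zero]
      exact Or.inl rfl
    have e1 : ∑ m, jac c c' x k m * projShift (θ.1 c) m i j x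
        = jac c c' x k i * θ.1 c ![] ![j] x + jac c c' x k j * θ.1 c ![] ![i] x := by
      simp [projShift, mul_add, Finset.sum_add_distrib]
    have e2 : ∑ l, ∑ m, jac c c' x l i * jac c c' x m j
          * projShift (θ.1 c') k l m (transition c c' x)
        = jac c c' x k i * θ.1 c ![] ![j] x + jac c c' x k j * θ.1 c ![] ![i] x := by
      simp only [projShift, mul_add, Finset.sum_add_distrib, hθ, mul_ite, mul_zero]
      rw [Finset.sum_comm (s := (Finset.univ : Finset (Fin n)))]
      simp [Finset.mul_sum, mul_assoc, mul_left_comm, mul_comm]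
    simp only [mul_add, Finset.sum_add_distrib, D.law c c' x hx k i j]
    rw [e1, e2]
    ring

lemma projEquiv_shift (D : Connection n M) (θ : TensorDensity n M 0 1 0) :
    ProjEquiv D (D.shift θ) := ⟨θ, fun _ _ _ _ _ _ => rfl⟩

lemma projEquiv_refl (D : Connection n M) : ProjEquiv D D :=
  ⟨0, fun c x _ k i j => by
    have : projShift ((0 : TensorDensity n M 0 1 0).1 c) k i j x = 0 := by
      simp [projShift]
    rw [this, add_zero]⟩

/-- The dilation of `ℝⁿ` by the factor two. -/
def dilation (n : ℕ) : OpenPartialHomeomorph (Coord n) (Coord n) :=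
  (Homeomorph.smulOfNeZero (2 : ℝ) two_ne_zero).toOpenPartialHomeomorph

lemma dilation_mem (n : ℕ) : dilation n ∈ contDiffGroupoid ∞ (𝓡 n) := by
  rw [contDiffGroupoid, mem_groupoid_of_pregroupoid]
  constructor
  · have : ContDiff ℝ ∞ fun x : Coord n => (2 : ℝ) • x := contDiff_const_smul _
    simpa [contDiffPregroupoid, dilation, Function.comp_def] using this.contDiffOn (s := Set.univ)
  · have : ContDiff ℝ ∞ fun x : Coord n => (2 : ℝ)⁻¹ • x := contDiff_const_smul _
    have h : ContDiffOn ℝ ∞ (dilation n).symm Set.univ := this.contDiffOn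
    simpa [contDiffPregroupoid, dilation, Function.comp_def] using h

/-- The chart `2 c`. -/
def Chart.dilate (c : Chart n M) : Chart n M :=
  ⟨c.1.trans (dilation n), by
    intro e he
    obtain ⟨h1, h2⟩ := c.2 e he
    have hd := dilation_mem n
    have hd' : (dilation n).symm ∈ contDiffGroupoid ∞ (𝓡 n) :=
      (contDiffGroupoid ∞ (𝓡 n)).symm hd
    constructor
    · rw [OpenPartialHomeomorph.trans_symm_eq_symm_trans_symm, OpenPartialHomeomorph.trans_assoc]
      exact (contDiffGroupoid ∞ (𝓡 n)).trans hd' h1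
    · rw [← OpenPartialHomeomorph.trans_assoc]
      exact (contDiffGroupoid ∞ (𝓡 n)).trans h2 hd⟩

lemma overlap_dilate (c : Chart n M) : overlap c c.dilate = c.1.target := by
  ext x
  rw [mem_overlap]
  refine ⟨fun h => h.1, fun h => ⟨h, ?_⟩⟩
  simp [Chart.dilate, dilation, c.1.map_target h]

/-- For positive n this determinant is positive and different from 1, so comparing a nonzero density
in `c` and `c.dilate` detects its weight. -/
lemma det_jac_dilate (c : Chart n M) {x : Coord n} (hx : x ∈ c.1.target) :
    (jac c c.dilate x).det = 2 ^ n := by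
  have h : jac c c.dilate x = (2 : ℝ) • 1 := by
    rw [jac_eq, jacOf_congr (σ := fun y => (2 : ℝ) • y)
      (Filter.eventually_of_mem (c.1.open_target.mem_nhds hx) fun y hy => ?_)]
    · ext i j
      have e : (fun y : Coord n => ((2 : ℝ) • y) i) = fun y => 2 * y i := rfl
      have hd : DifferentiableAt ℝ (fun y : Coord n => y i) x :=
        (EuclideanSpace.proj (𝕜 := ℝ) i).differentiableAt
      simp only [jacOf, Matrix.of_apply]
      rw [e, pd_const_mul 2 hd, pd_coord]
      simp [Matrix.one_apply, eq_comm]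
    · have := c.1.right_inv hy
      simp [transition, Chart.dilate, dilation, this]
  rw [h, Matrix.det_smul, Matrix.det_one]
  simp

/-- Compactly supported components in a chart extend to a tensor density on `M`. -/
lemma exists_tensorDensity [T2Space M] {p q : ℕ} (w : ℝ) (c : Chart n M) {χ : Coord n → ℝ}
    (hχ : ContDiff ℝ ∞ χ) (h1 : HasCompactSupport χ) (h2 : tsupport χ ⊆ c.1.target)
    {T₀ : LocalTensor n p q} (hT : ∀ a b, ContDiff ℝ ∞ (T₀ a b)) :
    ∃ T : TensorDensity n M p q w, (∀ a b, ∀ x ∈ c.1.target, T.1 c a b x = χ x * T₀ a b x) ∧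
      ((∀ (σ : Equiv.Perm (Fin p)) a b, T₀ (a ∘ σ) b = T₀ a b) →
        ∀ c' (σ : Equiv.Perm (Fin p)) a b, T.1 c' (a ∘ σ) b = T.1 c' a b) := by
  have hm : extendTensor c w (fun a b x => χ x * T₀ a b x) ∈ TensorDensity n M p q w :=
    extendTensor_mem c w (fun a b => hχ.mul (hT a b)) h1.isCompact h2 fun a b y hy => by
      rw [image_eq_zero_of_notMem_tsupport hy, zero_mul]
  have hself : ∀ a b, ∀ x ∈ c.1.target,
      extendTensor c w (fun a b x => χ x * T₀ a b x) c a b x = χ x * T₀ a b x :=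
    fun a b x hx => extendTensor_self c w _ a b hx
  refine ⟨⟨_, hm⟩, hself, fun hs c' σ a b => ?_⟩
  exact extendTensor_perm c w (T₀ := fun a b x => χ x * T₀ a b x)
    (fun σ a b => by simp only [hs]) c' σ a b

end ManifoldTests

/-! ### Linearity of the formula in the symbol and in the density. -/

section Linearity

variable {n p q : ℕ} {W : Set (Coord n)} {Γ : LocalConn n} {w : ℝ}

lemma covD_add_mul (hW : IsOpen W) {T T₁ T₂ : LocalTensor n p q} {r : ℝ}
    (h₁ : ∀ a b, ContDiffOn ℝ ∞ (T₁ a b) W) (h₂ : ∀ a b, ContDiffOn ℝ ∞ (T₂ a b) W)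
    (h : ∀ a b, ∀ y ∈ W, T a b y = T₁ a b y + r * T₂ a b y) (a : Fin p → Fin n)
    (b : Fin (q + 1) → Fin n) :
    ∀ y ∈ W, covD Γ w T a b y = covD Γ w T₁ a b y + r * covD Γ w T₂ a b y := by
  intro y hy
  have e : pd (b 0) (T a (Fin.tail b)) y
      = pd (b 0) (T₁ a (Fin.tail b)) y + r * pd (b 0) (T₂ a (Fin.tail b)) y := by
    have d₁ := ContDiffOn.diffAt hW (h₁ a (Fin.tail b)) hy
    have d₂ := ContDiffOn.diffAt hW (h₂ a (Fin.tail b)) hy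
    rw [pd_eqOn hW (h a (Fin.tail b)) (b 0) y hy, pd_add d₁ (d₂.const_mul r), pd_const_mul r d₂]
  simp only [covD, e, h _ _ y hy, mul_add, Finset.sum_add_distrib, mul_left_comm _ r,
    ← Finset.mul_sum]
  ring

variable {P P₁ P₂ : LocalTensor n 3 0} {φ φ₁ φ₂ : LocalTensor n 0 0} {r : ℝ}

lemma quantLocal_add_mul_right (κ : Coeffs) (lam del : ℝ) (hW : IsOpen W)
    (sΓ : ∀ k i j, ContDiffOn ℝ ∞ (Γ k i j) W)
    (h₁ : ∀ a b, ContDiffOn ℝ ∞ (φ₁ a b) W) (h₂ : ∀ a b, ContDiffOn ℝ ∞ (φ₂ a b) W)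
    (h : ∀ a b, ∀ y ∈ W, φ a b y = φ₁ a b y + r * φ₂ a b y) (a b : Fin 0 → Fin n) :
    ∀ y ∈ W, quantLocal κ lam del Γ P φ a b y
      = quantLocal κ lam del Γ P φ₁ a b y + r * quantLocal κ lam del Γ P φ₂ a b y := by
  have F1 := covD_add_mul (Γ := Γ) (w := lam) hW h₁ h₂ h
  have s₁ := contDiffOn_covD hW sΓ lam h₁
  have s₂ := contDiffOn_covD hW sΓ lam h₂
  have F2 := covD_add_mul (Γ := Γ) (w := lam) hW s₁ s₂ F1
  have F3 := covD_add_mul (Γ := Γ) (w := lam) hW (contDiffOn_covD hW sΓ lam s₁)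
    (contDiffOn_covD hW sΓ lam s₂) F2
  intro y hy
  simp only [quantLocal_apply, F1 _ _ y hy, F2 _ _ y hy, F3 _ _ y hy, h _ _ y hy, mul_add,
    Finset.sum_add_distrib, mul_left_comm _ r, ← Finset.mul_sum]
  ring

lemma quantLocal_add_mul_left (κ : Coeffs) (lam del : ℝ) (hW : IsOpen W)
    (sΓ : ∀ k i j, ContDiffOn ℝ ∞ (Γ k i j) W)
    (h₁ : ∀ a b, ContDiffOn ℝ ∞ (P₁ a b) W) (h₂ : ∀ a b, ContDiffOn ℝ ∞ (P₂ a b) W)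
    (h : ∀ a b, ∀ y ∈ W, P a b y = P₁ a b y + r * P₂ a b y) (a b : Fin 0 → Fin n) :
    ∀ y ∈ W, quantLocal κ lam del Γ P φ a b y
      = quantLocal κ lam del Γ P₁ φ a b y + r * quantLocal κ lam del Γ P₂ φ a b y := by
  have F1 := covD_add_mul (Γ := Γ) (w := del) hW h₁ h₂ h
  have s₁ := contDiffOn_covD hW sΓ del h₁
  have s₂ := contDiffOn_covD hW sΓ del h₂
  have F2 := covD_add_mul (Γ := Γ) (w := del) hW s₁ s₂ F1
  have F3 := covD_add_mul (Γ := Γ) (w := del) hW (contDiffOn_covD hW sΓ del s₁)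
    (contDiffOn_covD hW sΓ del s₂) F2
  intro y hy
  simp only [quantLocal_apply, F1 _ _ y hy, F2 _ _ y hy, F3 _ _ y hy, h _ _ y hy, add_mul, mul_add,
    mul_assoc, Finset.sum_add_distrib, mul_left_comm _ r, ← Finset.mul_sum]
  ring

end Linearity

/-! ### Differential operators of order at most two. -/

section LowOrder

variable {n : ℕ} {U : Set (Coord n)}

/-- `A` is a linear differential operator with smooth coefficients on `U`, of order at most `m`
if `m ≤ 2`. -/
def IsLowOrder (U : Set (Coord n)) (m : ℕ) (A : (Coord n → ℝ) → Coord n → ℝ) : Prop :=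
  ∃ (a₂ : Fin n → Fin n → Coord n → ℝ) (a₁ : Fin n → Coord n → ℝ) (a₀ : Coord n → ℝ),
    (∀ i j, ContDiffOn ℝ ∞ (a₂ i j) U) ∧ (∀ i, ContDiffOn ℝ ∞ (a₁ i) U) ∧
    ContDiffOn ℝ ∞ a₀ U ∧ (m ≤ 1 → ∀ i j x, a₂ i j x = 0) ∧ (m = 0 → ∀ i x, a₁ i x = 0) ∧
    ∀ f, ContDiffOn ℝ ∞ f U → ∀ x ∈ U, A f x = thirdOrder (fun _ _ _ _ => 0) a₂ a₁ a₀ f x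

variable {m m' : ℕ} {A B : (Coord n → ℝ) → Coord n → ℝ}

lemma IsLowOrder.congr (hA : IsLowOrder U m A)
    (h : ∀ f, ContDiffOn ℝ ∞ f U → ∀ x ∈ U, B f x = A f x) : IsLowOrder U m B := by
  obtain ⟨a₂, a₁, a₀, h₂, h₁, h₀, z₂, z₁, hf⟩ := hA
  exact ⟨a₂, a₁, a₀, h₂, h₁, h₀, z₂, z₁, fun f sf x hx => (h f sf x hx).trans (hf f sf x hx)⟩

lemma IsLowOrder.mono (hA : IsLowOrder U m A) (h : m ≤ m') : IsLowOrder U m' A := by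
  obtain ⟨a₂, a₁, a₀, h₂, h₁, h₀, z₂, z₁, hf⟩ := hA
  exact ⟨a₂, a₁, a₀, h₂, h₁, h₀, fun h' => z₂ (h.trans h'), fun h' => z₁ (by omega), hf⟩

lemma IsLowOrder.add (hA : IsLowOrder U m A) (hB : IsLowOrder U m B) :
    IsLowOrder U m fun f x => A f x + B f x := by
  obtain ⟨a₂, a₁, a₀, h₂, h₁, h₀, z₂, z₁, hf⟩ := hA
  obtain ⟨b₂, b₁, b₀, k₂, k₁, k₀, y₂, y₁, kf⟩ := hB
  refine ⟨fun i j x => a₂ i j x + b₂ i j x, fun i x => a₁ i x + b₁ i x, fun x => a₀ x + b₀ x,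
    fun i j => (h₂ i j).add (k₂ i j), fun i => (h₁ i).add (k₁ i), h₀.add k₀,
    fun h i j x => by simp only [z₂ h, y₂ h, add_zero], fun h i x => by simp only [z₁ h, y₁ h, add_zero],
    fun f sf x hx => ?_⟩
  beta_reduce
  rw [hf f sf x hx, kf f sf x hx]
  simp only [thirdOrder, add_mul, Finset.sum_add_distrib, zero_mul, Finset.sum_const_zero]
  ring

lemma IsLowOrder.mul {g : Coord n → ℝ} (hg : ContDiffOn ℝ ∞ g U) (hA : IsLowOrder U m A) :
    IsLowOrder U m fun f x => g x * A f x := by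
  obtain ⟨a₂, a₁, a₀, h₂, h₁, h₀, z₂, z₁, hf⟩ := hA
  refine ⟨fun i j x => g x * a₂ i j x, fun i x => g x * a₁ i x, fun x => g x * a₀ x,
    fun i j => hg.mul (h₂ i j), fun i => hg.mul (h₁ i), hg.mul h₀,
    fun h i j x => by simp only [z₂ h, mul_zero], fun h i x => by simp only [z₁ h, mul_zero],
    fun f sf x hx => ?_⟩
  beta_reduce
  rw [hf f sf x hx]
  simp only [thirdOrder, mul_assoc, ← Finset.mul_sum, zero_mul, Finset.sum_const_zero]
  ring

lemma isLowOrder_zero (U : Set (Coord n)) (m : ℕ) : IsLowOrder U m fun _ _ => 0 :=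
  ⟨fun _ _ _ => 0, fun _ _ => 0, fun _ => 0, fun _ _ => contDiffOn_const,
    fun _ => contDiffOn_const, contDiffOn_const, fun _ _ _ _ => rfl, fun _ _ _ => rfl,
    fun f _ x _ => by simp [thirdOrder]⟩

lemma isLowOrder_id (U : Set (Coord n)) (m : ℕ) : IsLowOrder U m fun f x => f x :=
  ⟨fun _ _ _ => 0, fun _ _ => 0, fun _ => 1, fun _ _ => contDiffOn_const,
    fun _ => contDiffOn_const, contDiffOn_const, fun _ _ _ _ => rfl, fun _ _ _ => rfl,
    fun f _ x _ => by simp [thirdOrder]⟩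

lemma IsLowOrder.sum {ι : Type*} (s : Finset ι) {A : ι → (Coord n → ℝ) → Coord n → ℝ}
    (hA : ∀ i, IsLowOrder U m (A i)) : IsLowOrder U m fun f x => ∑ i ∈ s, A i f x := by
  classical
  induction s using Finset.induction_on with
  | empty => simpa using isLowOrder_zero U m
  | insert i s hi ih => simpa only [Finset.sum_insert hi] using (hA i).add ih

/-- By the Leibniz rule the first-order coefficients become second-order ones in row `i`, and the
derivatives of the coefficients contribute to lower order. The bound on m keeps the result within
order two. -/
lemma IsLowOrder.pd (hU : IsOpen U) (hm : m ≤ 1) (hA : IsLowOrder U m A) (i : Fin n) :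
    IsLowOrder U (m + 1) fun f => ProjQuant.pd i (A f) := by
  obtain ⟨a₂, a₁, a₀, h₂, h₁, h₀, z₂, z₁, hf⟩ := hA
  refine ⟨fun k j x => if k = i then a₁ j x else 0,
    fun j x => ProjQuant.pd i (a₁ j) x + if j = i then a₀ x else 0, ProjQuant.pd i a₀,
    fun k j => ?_, fun j => ?_, contDiffOn_pd hU h₀, fun h k j x => ?_, fun h => by omega,
    fun f sf x hx => ?_⟩
  · beta_reduce
    split_ifs
    exacts [h₁ j, contDiffOn_const]
  · refine (contDiffOn_pd hU (h₁ j)).add ?_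
    split_ifs
    exacts [h₀, contDiffOn_const]
  · simp [z₁ (show m = 0 by omega)]
  · have e : ∀ y ∈ U, A f y = (∑ j, a₁ j y * ProjQuant.pd j f y) + a₀ y * f y := fun y hy => by
      rw [hf f sf y hy]
      simp [thirdOrder, z₂ hm]
    have d₁ := fun j => ContDiffOn.diffAt hU (h₁ j) hx
    have d₀ := ContDiffOn.diffAt hU h₀ hx
    have df := ContDiffOn.diffAt hU sf hx
    have dp := fun j => ContDiffOn.diffAt hU (contDiffOn_pd (i := j) hU sf) hx
    beta_reduce
    rw [pd_eqOn hU e i x hx,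
      pd_add (f := fun y => ∑ j, a₁ j y * ProjQuant.pd j f y) (g := fun y => a₀ y * f y)
        (DifferentiableAt.fun_sum fun j _ => (d₁ j).mul (dp j)) (d₀.mul df), pd_mul d₀ df,
      pd_sum (f := fun j y => a₁ j y * ProjQuant.pd j f y) fun j _ => (d₁ j).mul (dp j)]
    simp only [pd_mul (d₁ _) (dp _), thirdOrder, Finset.sum_add_distrib, add_mul, ite_mul, zero_mul,
      Finset.sum_const_zero]
    simp only [Finset.sum_ite_irrel, Finset.sum_const_zero, Finset.sum_ite_eq', Finset.mem_univ,
      if_true]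
    ring

lemma isLowOrder_pd (hU : IsOpen U) (i : Fin n) : IsLowOrder U 1 fun f => pd i f :=
  (isLowOrder_id U 0).pd hU (by norm_num) i

lemma isLowOrder_pd_pd (hU : IsOpen U) (i j : Fin n) : IsLowOrder U 2 fun f => pd i (pd j f) :=
  (isLowOrder_pd hU j).pd hU le_rfl i

end LowOrder

/-! ### The principal symbol of the quantization formula. -/

section Operator

variable {n : ℕ} {U : Set (Coord n)} {Γ : LocalConn n}

lemma IsLowOrder.sub {m : ℕ} {A B : (Coord n → ℝ) → Coord n → ℝ} (hA : IsLowOrder U m A)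
    (hB : IsLowOrder U m B) : IsLowOrder U m fun f x => A f x - B f x :=
  (hA.add (hB.mul (contDiffOn_const (c := (-1 : ℝ))))).congr fun f _ x _ => by ring

lemma contDiffOn_gam (hΓ : ∀ k i j, ContDiffOn ℝ ∞ (Γ k i j) U) (i : Fin n) :
    ContDiffOn ℝ ∞ (gam Γ i) U := by
  unfold gam
  exact ContDiffOn.sum fun m _ => hΓ _ _ _

/-- The quantization formula is a third-order operator on densities, with principal symbol `P`. -/
theorem quantLocal_eq_thirdOrder (κ : Coeffs) (lam del : ℝ) (hU : IsOpen U)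
    (hΓ : ∀ k i j, ContDiffOn ℝ ∞ (Γ k i j) U) {P : LocalTensor n 3 0}
    (hP : ∀ a b, ContDiffOn ℝ ∞ (P a b) U) :
    ∃ (a₂ : Fin n → Fin n → Coord n → ℝ) (a₁ : Fin n → Coord n → ℝ) (a₀ : Coord n → ℝ),
      (∀ i j, ContDiffOn ℝ ∞ (a₂ i j) U) ∧ (∀ i, ContDiffOn ℝ ∞ (a₁ i) U) ∧
      ContDiffOn ℝ ∞ a₀ U ∧ ∀ φ : LocalTensor n 0 0, ContDiffOn ℝ ∞ (φ ![] ![]) U → ∀ x ∈ U,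
        quantLocal κ lam del Γ P φ ![] ![] x
          = thirdOrder (fun i j k => P ![i, j, k] ![]) a₂ a₁ a₀ (φ ![] ![]) x := by
  let F₁ : Fin n → (Coord n → ℝ) → Coord n → ℝ := fun k f => cv0 Γ lam f k
  let F₂ : Fin n → Fin n → (Coord n → ℝ) → Coord n → ℝ := fun j k f => cv1 Γ lam (cv0 Γ lam f) j k
  let F₃ : Fin n → Fin n → Fin n → (Coord n → ℝ) → Coord n → ℝ := fun i j k f =>
    cv2 Γ lam (cv1 Γ lam (cv0 Γ lam f)) i j k
  have hg := contDiffOn_gam hΓ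
  have id0 := isLowOrder_id U
  have s₁ : ∀ k f, ContDiffOn ℝ ∞ f U → ContDiffOn ℝ ∞ (F₁ k f) U := fun k f hf =>
    (contDiffOn_pd hU hf).sub ((contDiffOn_const.mul (hg k)).mul hf)
  have s₂ : ∀ j k f, ContDiffOn ℝ ∞ f U → ContDiffOn ℝ ∞ (F₂ j k f) U := fun j k f hf =>
    ((contDiffOn_pd hU (s₁ k f hf)).sub (ContDiffOn.sum fun m _ => (hΓ m j k).mul (s₁ m f hf))).sub
      ((contDiffOn_const.mul (hg j)).mul (s₁ k f hf))
  -- An iterated covariant derivative differs from the iterated partial derivative by an operator of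
  -- lower order; `L₁`, `L₂`, `L₃` establish this inductively. This is why the third-order
  -- coefficients are exactly the components of P.
  have L₁ : ∀ k, IsLowOrder U 0 fun f x => F₁ k f x - pd k f x := fun k =>
    ((id0 0).mul ((contDiffOn_const (c := -lam)).mul (hg k))).congr fun f _ x _ => by
      simp only [F₁, cv0]; ring
  have K₁ : ∀ k, IsLowOrder U 1 (F₁ k) := fun k =>
    (((L₁ k).mono zero_le_one).add (isLowOrder_pd hU k)).congr fun f _ x _ => by ring
  have L₂ : ∀ j k, IsLowOrder U 1 fun f x => F₂ j k f x - pd j (pd k f) x := fun j k =>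
    ((((L₁ k).pd hU zero_le_one j).sub
      (IsLowOrder.sum Finset.univ fun m => (K₁ m).mul (hΓ m j k))).sub
      ((K₁ k).mul ((contDiffOn_const (c := lam)).mul (hg j)))).congr fun f hf x hx => by
        rw [pd_sub (ContDiffOn.diffAt hU (s₁ k f hf) hx)
          (ContDiffOn.diffAt hU (contDiffOn_pd hU hf) hx)]
        simp only [F₂, cv1]
        ring
  have K₂ : ∀ j k, IsLowOrder U 2 (F₂ j k) := fun j k =>
    (((L₂ j k).mono one_le_two).add (isLowOrder_pd_pd hU j k)).congr fun f _ x _ => by ring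
  have L₃ : ∀ i j k, IsLowOrder U 2 fun f x => F₃ i j k f x - pd i (pd j (pd k f)) x :=
    fun i j k => (((((L₂ j k).pd hU le_rfl i).sub
      (IsLowOrder.sum Finset.univ fun m => (K₂ m k).mul (hΓ m i j))).sub
      (IsLowOrder.sum Finset.univ fun m => (K₂ j m).mul (hΓ m i k))).sub
      ((K₂ j k).mul ((contDiffOn_const (c := lam)).mul (hg i)))).congr fun f hf x hx => by
        rw [pd_sub (ContDiffOn.diffAt hU (s₂ j k f hf) hx)
          (ContDiffOn.diffAt hU (contDiffOn_pd hU (contDiffOn_pd hU hf)) hx)]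
        simp only [F₃, cv2]
        ring
  have G1 := contDiffOn_covD hU hΓ del hP
  have G2 := contDiffOn_covD hU hΓ del G1
  have G3 := contDiffOn_covD hU hΓ del G2
  have R0 := contDiffOn_ricci hU hΓ
  have R1 := contDiffOn_covD hU hΓ 0 R0
  -- All of the formula except P^{ijk}∂ᵢ∂ⱼ∂ₖ, collected into one operator of order at most two.
  have T := (((IsLowOrder.sum Finset.univ fun i => IsLowOrder.sum Finset.univ fun j =>
      IsLowOrder.sum Finset.univ fun k => (L₃ i j k).mul (hP ![i, j, k] ![])).add
    ((IsLowOrder.sum Finset.univ fun i => IsLowOrder.sum Finset.univ fun j =>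
      IsLowOrder.sum Finset.univ fun k => (K₂ i j).mul (G1 ![i, j, k] ![k])).mul
      (contDiffOn_const (c := κ.α)))).add
    ((IsLowOrder.sum Finset.univ fun i => IsLowOrder.sum Finset.univ fun j =>
      IsLowOrder.sum Finset.univ fun k => (K₁ k).mul
        ((contDiffOn_const (c := κ.β₁)).mul (G2 ![i, j, k] ![i, j]) |>.add
          ((contDiffOn_const (c := κ.β₂)).mul ((hP ![i, j, k] ![]).mul (R0 ![] ![i, j]))))).mono
      one_le_two)).add
    ((id0 2).mul (ContDiffOn.sum (s := Finset.univ) fun i _ => ContDiffOn.sum (s := Finset.univ)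
      fun j _ => ContDiffOn.sum (s := Finset.univ) fun k _ =>
      (((contDiffOn_const (c := κ.η₁)).mul (G3 ![i, j, k] ![i, j, k])).add
        ((contDiffOn_const (c := κ.η₂)).mul ((R0 ![] ![i, j]).mul (G1 ![i, j, k] ![k])))).add
        ((contDiffOn_const (c := κ.η₃)).mul ((R1 ![] ![i, j, k]).mul (hP ![i, j, k] ![])))))
  obtain ⟨a₂, a₁, a₀, h₂, h₁, h₀, -, -, h⟩ := T
  refine ⟨a₂, a₁, a₀, h₂, h₁, h₀, fun φ hφ x hx => ?_⟩
  have H := h (φ ![] ![]) hφ x hx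
  have F1 : ∀ k, covD Γ lam φ ![] ![k] = F₁ k (φ ![] ![]) := fun k =>
    covD_zero_zero Γ lam φ ![] ![k]
  have F2 : ∀ i j, covD Γ lam (covD Γ lam φ) ![] ![i, j] = F₂ i j (φ ![] ![]) :=
    fun i j => by rw [covD_zero_one]; simp only [F1]; rfl
  have F3 : ∀ i j k, covD Γ lam (covD Γ lam (covD Γ lam φ)) ![] ![i, j, k] = F₃ i j k (φ ![] ![]) :=
    fun i j k => by rw [covD_zero_two]; simp only [F2]; rfl
  simp only [thirdOrder, zero_mul, Finset.sum_const_zero, mul_sub, Finset.sum_sub_distrib] at H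
  simp only [quantLocal, F1, F2, F3, thirdOrder]
  linear_combination H

end Operator

/-! ### The quantization map on the manifold. -/

section Quantization

variable {n : ℕ} {M : Type*} [TopologicalSpace M] [ChartedSpace (Coord n) M]
  {lam mu del : ℝ}

/-- The components of the density obtained from the quantization formula. -/
def quantComp (κ : Coeffs) (lam del : ℝ) (D : Connection n M) (P : Chart n M → LocalTensor n 3 0)
    (φ : Chart n M → LocalTensor n 0 0) : Chart n M → LocalTensor n 0 0 :=
  open Classical in fun c _ _ x =>
    if x ∈ c.1.target then quantLocal κ lam del (D.Γ c) (P c) (φ c) ![] ![] x else 0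

lemma quantComp_apply (κ : Coeffs) (D : Connection n M) (P : Chart n M → LocalTensor n 3 0)
    (φ : Chart n M → LocalTensor n 0 0) {c : Chart n M} {x : Coord n} (hx : x ∈ c.1.target)
    (a b : Fin 0 → Fin n) :
    quantComp κ lam del D P φ c a b x = quantLocal κ lam del (D.Γ c) (P c) (φ c) ![] ![] x :=
  if_pos hx

lemma quantLocal_transition (κ : Coeffs) (D : Connection n M) (P : Symbol3 n M del)
    (φ : Density n M lam) {c c' : Chart n M} {x : Coord n} (hx : x ∈ overlap c c') :
    quantLocal κ lam del (D.Γ c) (P.1 c) (φ.1 c) ![] ![] x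
      = |(jac c c' x).det| ^ (lam + del)
        * quantLocal κ lam del (D.Γ c') (P.1 c') (φ.1 c') ![] ![] (transition c c' x) :=
  quantLocal_law κ lam del (isCoordChange_transition c c') (D.connLaw c c')
    (fun k i j => (D.smooth c k i j).mono (overlap_subset c c')) (D.smooth c')
    (fun a b => (P.2.1.1 c a b).mono (overlap_subset c c')) (P.2.1.1 c')
    (P.2.1.2.2 c c')
    (fun a b => (φ.2.1 c a b).mono (overlap_subset c c')) (φ.2.1 c')
    (φ.2.2.2 c c') hx

lemma quantComp_mem (κ : Coeffs) (D : Connection n M) (hmu : mu = lam + del)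
    (P : Symbol3 n M del) (φ : Density n M lam) :
    quantComp κ lam del D P.1 φ.1 ∈ Density n M mu := by
  refine ⟨fun c a b => ?_, fun c a b x hx => if_neg hx, fun c c' => tensorLaw_form fun x hx b => ?_⟩
  · exact (contDiffOn_quantLocal κ lam del c.1.open_target (D.smooth c) (P.2.1.1 c) (φ.2.1 c)
      ![] ![]).congr fun x hx => quantComp_apply κ D P.1 φ.1 hx a b
  · have h := quantLocal_transition κ D P φ hx
    have hx' := overlap_subset c' c (transition_mem_overlap hx)
    simp only [quantComp_apply κ D P.1 φ.1 (overlap_subset c c' hx), quantComp_apply κ D P.1 φ.1 hx']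
    rw [h, hmu]
    simp [tpow, jac_eq]

/-- The operator obtained from the quantization formula for a fixed symbol. -/
def quantOp (κ : Coeffs) (D : Connection n M) (hmu : mu = lam + del) (P : Symbol3 n M del) :
    Density n M lam →ₗ[ℝ] Density n M mu where
  toFun φ := ⟨quantComp κ lam del D P.1 φ.1, quantComp_mem κ D hmu P φ⟩
  map_add' φ ψ := by
    apply Subtype.ext
    funext c a b x
    change quantComp κ lam del D P.1 (φ.1 + ψ.1) c a b x
      = quantComp κ lam del D P.1 φ.1 c a b x + quantComp κ lam del D P.1 ψ.1 c a b x
    simp only [quantComp]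
    split_ifs with hx
    · have := quantLocal_add_mul_right (P := P.1 c) (φ := (φ.1 + ψ.1) c) (r := 1) κ lam del
        c.1.open_target (D.smooth c) (φ.2.1 c) (ψ.2.1 c) (fun a b y _ => by simp) ![] ![] x hx
      rw [this, one_mul]
    · simp
  map_smul' r φ := by
    apply Subtype.ext
    funext c a b x
    change quantComp κ lam del D P.1 (r • φ.1) c a b x
      = r * quantComp κ lam del D P.1 φ.1 c a b x
    simp only [quantComp]
    split_ifs with hx
    -- With all densities zero, additivity shows that the formula vanishes at φ = 0. Homogeneity is
    -- then linearity with zero as the first summand.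
    · have h0 := quantLocal_add_mul_right (P := P.1 c) (φ := 0) (φ₁ := 0) (φ₂ := 0) (r := 1) κ lam
        del c.1.open_target (D.smooth c) (fun _ _ => contDiffOn_const)
        (fun _ _ => contDiffOn_const) (fun a b y _ => by simp) ![] ![] x hx
      have h := quantLocal_add_mul_right (P := P.1 c) (φ := (r • φ.1) c) (φ₁ := 0) (r := r) κ lam
        del c.1.open_target (D.smooth c) (fun _ _ => contDiffOn_const) (φ.2.1 c)
        (fun a b y _ => by simp) ![] ![] x hx
      rw [h]
      linarith
    · simp

/-- The quantization map written with the connection `D`. -/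
def quantMap (κ : Coeffs) (D : Connection n M) (hmu : mu = lam + del) :
    Symbol3 n M del →ₗ[ℝ] DiffOp3 n M lam mu where
  toFun P := ⟨quantOp κ D hmu P, fun c => by
    obtain ⟨a₂, a₁, a₀, h₂, h₁, h₀, h⟩ := quantLocal_eq_thirdOrder κ lam del c.1.open_target
      (D.smooth c) (P.2.1.1 c)
    exact ⟨_, a₂, a₁, a₀, fun i j k => P.2.1.1 c _ _, h₂, h₁, h₀, fun φ x hx =>
      (quantComp_apply κ D P.1 φ.1 hx ![] ![]).trans (h (φ.1 c) (φ.2.1 c _ _) x hx)⟩⟩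
  map_add' P R := by
    apply Subtype.ext
    apply LinearMap.ext
    intro φ
    apply Subtype.ext
    funext c a b x
    change quantComp κ lam del D (P.1 + R.1) φ.1 c a b x
      = quantComp κ lam del D P.1 φ.1 c a b x + quantComp κ lam del D R.1 φ.1 c a b x
    simp only [quantComp]
    split_ifs with hx
    · have := quantLocal_add_mul_left (φ := φ.1 c) (P := (P.1 + R.1) c) (r := 1) κ lam del
        c.1.open_target (D.smooth c) (P.2.1.1 c) (R.2.1.1 c) (fun a b y _ => by simp) ![] ![] x hx
      rw [this, one_mul]
    · simp
  map_smul' r P := by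
    apply Subtype.ext
    apply LinearMap.ext
    intro φ
    apply Subtype.ext
    funext c a b x
    change quantComp κ lam del D (r • P.1) φ.1 c a b x
      = r * quantComp κ lam del D P.1 φ.1 c a b x
    simp only [quantComp]
    split_ifs with hx
    · have h0 := quantLocal_add_mul_left (φ := φ.1 c) (P := 0) (P₁ := 0) (P₂ := 0) (r := 1) κ lam
        del c.1.open_target (D.smooth c) (fun _ _ => contDiffOn_const)
        (fun _ _ => contDiffOn_const) (fun a b y _ => by simp) ![] ![] x hx
      have h := quantLocal_add_mul_left (φ := φ.1 c) (P := (r • P.1) c) (P₁ := 0) (r := r) κ lam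
        del c.1.open_target (D.smooth c) (fun _ _ => contDiffOn_const) (P.2.1.1 c)
        (fun a b y _ => by simp) ![] ![] x hx
      rw [h]
      linarith
    · simp

lemma quantMap_apply (κ : Coeffs) (D : Connection n M) (hmu : mu = lam + del)
    (P : Symbol3 n M del) (φ : Density n M lam) {c : Chart n M} {x : Coord n}
    (hx : x ∈ c.1.target) : ((quantMap κ D hmu P).1 φ).1 c ![] ![] x
      = quantLocal κ lam del (D.Γ c) (P.1 c) (φ.1 c) ![] ![] x :=
  quantComp_apply κ D P.1 φ.1 hx ![] ![]

theorem isProjQuantization_quantMap (hn : 1 < n) (r : Row) (t : ℝ) (D : Connection n M)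
    (hmu : r.mu n = r.lam n + r.del n) :
    IsProjQuantization (r.coeffs n t) D (quantMap (r.coeffs n t) D hmu) := by
  refine ⟨fun P c => ?_, ?_⟩
  · obtain ⟨a₂, a₁, a₀, h₂, h₁, h₀, h⟩ := quantLocal_eq_thirdOrder (r.coeffs n t) (r.lam n)
      (r.del n) c.1.open_target (D.smooth c) (P.2.1.1 c)
    exact ⟨a₂, a₁, a₀, h₂, h₁, h₀, fun φ x hx =>
      (quantMap_apply _ D hmu P φ hx).trans (h (φ.1 c) (φ.2.1 c _ _) x hx)⟩
  · rintro D' ⟨θ, hθ⟩ P φ c x hx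
    rw [quantMap_apply _ D hmu P φ hx]
    exact (quantLocal_shift_row hn r t c.1.open_target hx (D.smooth c)
      (fun k i j y hy => D.symm c k i j y hy) (fun k i j y hy => hθ c y hy k i j) (θ.2.1 c)
      (P.2.1.1 c) (P.2.2 c) (φ.2.1 c)).symm

end Quantization

/-! ### Powers of a centred coordinate as test tensors. -/

section PowerTests

variable {n : ℕ}

/-- The coordinate `x^o` centred at `x₀`. -/
def centred (o : Fin n) (x₀ : Coord n) : Coord n → ℝ := fun y => y o - x₀ o

/-- The Kronecker symbol. -/
def kron (o i : Fin n) : ℝ := if i = o then 1 else 0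

variable {o : Fin n} {x₀ : Coord n} {Γ : LocalConn n} {w : ℝ}

@[simp] lemma centred_self (o : Fin n) (x₀ : Coord n) : centred o x₀ x₀ = 0 := sub_self _

@[simp] lemma kron_self (o : Fin n) : kron o o = 1 := if_pos rfl

lemma sum_kron_mul (o : Fin n) (f : Fin n → ℝ) : ∑ i, kron o i * f i = f o := by
  simp [kron]

@[fun_prop]
lemma contDiff_centred (o : Fin n) (x₀ : Coord n) : ContDiff ℝ ∞ (centred o x₀) :=
  (EuclideanSpace.proj (𝕜 := ℝ) o).contDiff.sub contDiff_const

lemma pd_centred (i o : Fin n) (x₀ y : Coord n) : pd i (centred o x₀) y = kron o i := by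
  have h : DifferentiableAt ℝ (fun y : Coord n => y o) y :=
    (EuclideanSpace.proj (𝕜 := ℝ) o).differentiableAt
  have e : centred o x₀ = fun y : Coord n => y o - x₀ o := rfl
  rw [e, pd_sub h (differentiableAt_const _), pd_const, pd_coord, sub_zero, kron]

lemma pd_pow_mul (m : ℕ) {g : Coord n → ℝ} (hg : ContDiff ℝ ∞ g) (i : Fin n) (y : Coord n) :
    pd i (fun y => centred o x₀ y ^ (m + 1) * g y) y
      = centred o x₀ y ^ m * ((m + 1) * kron o i * g y + centred o x₀ y * pd i g y) := by
  have hp : pd i (fun y => centred o x₀ y ^ (m + 1)) y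
      = (m + 1) * centred o x₀ y ^ m * kron o i := by
    have hd : DifferentiableAt ℝ (centred o x₀) y := ContDiff.diffAt (by fun_prop) y
    have h := hd.hasFDerivAt.pow (m + 1)
    have h' : HasFDerivAt (fun y => centred o x₀ y ^ (m + 1)) _ y := h
    rw [pd, h'.fderiv]
    have := pd_centred i o x₀ y
    rw [pd] at this
    simp [this]
  rw [pd_mul (ContDiff.diffAt (by fun_prop) y) (ContDiff.diffAt hg y), hp]
  ring

/-- Keeping the power of u as a factor lets the rule be applied repeatedly. At u = 0, fewer than m
derivatives of u^m g give zero. Exactly m derivatives give m! times g and a product of factors du,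
with no contribution of Γ. -/
lemma cv0_pow_mul (m : ℕ) {g : Coord n → ℝ} (hg : ContDiff ℝ ∞ g) :
    cv0 Γ w (fun y => centred o x₀ y ^ (m + 1) * g y) = fun i y => centred o x₀ y ^ m
      * ((m + 1) * kron o i * g y + centred o x₀ y * cv0 Γ w g i y) := by
  funext i y
  simp only [cv0, pd_pow_mul m hg]
  ring

lemma cv1_pow_mul (m : ℕ) {g : Fin n → Coord n → ℝ} (hg : ∀ i, ContDiff ℝ ∞ (g i)) :
    cv1 Γ w (fun j y => centred o x₀ y ^ (m + 1) * g j y) = fun i j y => centred o x₀ y ^ m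
      * ((m + 1) * kron o i * g j y + centred o x₀ y * cv1 Γ w g i j y) := by
  funext i j y
  simp only [cv1, pd_pow_mul m (hg _), mul_left_comm _ (centred o x₀ y ^ (m + 1)),
    ← Finset.mul_sum]
  ring

lemma cv2_pow_mul (m : ℕ) {g : Fin n → Fin n → Coord n → ℝ} (hg : ∀ i j, ContDiff ℝ ∞ (g i j)) :
    cv2 Γ w (fun j k y => centred o x₀ y ^ (m + 1) * g j k y) = fun i j k y =>
      centred o x₀ y ^ m
        * ((m + 1) * kron o i * g j k y + centred o x₀ y * cv2 Γ w g i j k y) := by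
  funext i j k y
  simp only [cv2, pd_pow_mul m (hg _ _), mul_left_comm _ (centred o x₀ y ^ (m + 1)),
    ← Finset.mul_sum]
  ring

lemma dv3_pow_mul (m : ℕ) {g : Fin n → Fin n → Fin n → Coord n → ℝ}
    (hg : ∀ i j k, ContDiff ℝ ∞ (g i j k)) :
    dv3 Γ w (fun i j k y => centred o x₀ y ^ (m + 1) * g i j k y) = fun i j y =>
      centred o x₀ y ^ m * ((m + 1) * g i j o y + centred o x₀ y * dv3 Γ w g i j y) := by
  funext i j y
  rw [← sum_kron_mul o fun k => g i j k y]
  simp only [dv3, pd_pow_mul m (hg _ _ _), mul_left_comm _ (centred o x₀ y ^ (m + 1)),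
    ← Finset.mul_sum]
  rw [mul_add, Finset.mul_sum, Finset.mul_sum, Finset.mul_sum, Finset.mul_sum,
    ← Finset.sum_add_distrib]
  exact Finset.sum_congr rfl fun k _ => by ring

lemma dv2_pow_mul (m : ℕ) {g : Fin n → Fin n → Coord n → ℝ} (hg : ∀ i j, ContDiff ℝ ∞ (g i j)) :
    dv2 Γ w (fun i j y => centred o x₀ y ^ (m + 1) * g i j y) = fun i y =>
      centred o x₀ y ^ m * ((m + 1) * g i o y + centred o x₀ y * dv2 Γ w g i y) := by
  funext i y
  rw [← sum_kron_mul o fun k => g i k y]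
  simp only [dv2, pd_pow_mul m (hg _ _), mul_left_comm _ (centred o x₀ y ^ (m + 1)),
    ← Finset.mul_sum]
  rw [mul_add, Finset.mul_sum, Finset.mul_sum, Finset.mul_sum, Finset.mul_sum,
    ← Finset.sum_add_distrib]
  exact Finset.sum_congr rfl fun k _ => by ring

lemma dv1_pow_mul (m : ℕ) {g : Fin n → Coord n → ℝ} (hg : ∀ i, ContDiff ℝ ∞ (g i)) :
    dv1 Γ w (fun i y => centred o x₀ y ^ (m + 1) * g i y) = fun y =>
      centred o x₀ y ^ m * ((m + 1) * g o y + centred o x₀ y * dv1 Γ w g y) := by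
  funext y
  rw [← sum_kron_mul o fun k => g k y]
  simp only [dv1, pd_pow_mul m (hg _), mul_left_comm _ (centred o x₀ y ^ (m + 1)),
    ← Finset.mul_sum]
  rw [mul_add, Finset.mul_sum, Finset.mul_sum, Finset.mul_sum, Finset.mul_sum,
    ← Finset.sum_add_distrib]
  exact Finset.sum_congr rfl fun k _ => by ring

/-! Values at the centre. -/

variable (o x₀)

/-- The density `u^m`. -/
def testφ (m : ℕ) : LocalTensor n 0 0 := fun _ _ y => centred o x₀ y ^ m * 1

/-- The one-form `u^q dx^o`. -/
def testθ (q : ℕ) : LocalTensor n 0 1 := fun _ b y => centred o x₀ y ^ q * kron o (b 0)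

/-- The symbol `u^p (∂_o)³`. -/
def testP (p : ℕ) : LocalTensor n 3 0 := fun a _ y => centred o x₀ y ^ p * ∏ s, kron o (a s)

variable {o x₀}

lemma contDiff_testφ (m : ℕ) (a b : Fin 0 → Fin n) : ContDiff ℝ ∞ (testφ o x₀ m a b) := by
  unfold testφ; fun_prop

lemma contDiff_testθ (q : ℕ) (a : Fin 0 → Fin n) (b : Fin 1 → Fin n) :
    ContDiff ℝ ∞ (testθ o x₀ q a b) := by
  unfold testθ; fun_prop

lemma contDiff_testP (p : ℕ) (a : Fin 3 → Fin n) (b : Fin 0 → Fin n) :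
    ContDiff ℝ ∞ (testP o x₀ p a b) := by
  unfold testP; fun_prop

lemma testP_perm (p : ℕ) (σ : Equiv.Perm (Fin 3)) (a : Fin 3 → Fin n) (b : Fin 0 → Fin n) :
    testP o x₀ p (a ∘ σ) b = testP o x₀ p a b := by
  funext y
  simp only [testP, Function.comp_apply, Equiv.prod_comp σ fun s => kron o (a s)]

variable (o x₀) in
/-- The components of `testP`. -/
def symP (p : ℕ) (i j k : Fin n) : Coord n → ℝ := fun y =>
  centred o x₀ y ^ p * (kron o i * kron o j * kron o k)

variable (o x₀) in
/-- The components of `testθ`. -/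
def formθ (q : ℕ) (i : Fin n) : Coord n → ℝ := fun y => centred o x₀ y ^ q * kron o i

variable (o x₀) in
/-- The component of `testφ`. -/
def funφ (m : ℕ) : Coord n → ℝ := fun y => centred o x₀ y ^ m * 1

lemma testP_eq (p : ℕ) : (fun i j k => testP o x₀ p ![i, j, k] ![]) = symP o x₀ p := by
  funext i j k y
  simp [testP, symP, Fin.prod_univ_three]

lemma testθ_eq (q : ℕ) : (fun i => testθ o x₀ q ![] ![i]) = formθ o x₀ q := rfl

lemma testφ_eq (m : ℕ) : testφ o x₀ m ![] ![] = funφ o x₀ m := rfl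

lemma funφ_self (m : ℕ) : funφ o x₀ m x₀ = if m = 0 then 1 else 0 := by
  simp [funφ, zero_pow_eq]

lemma formθ_self (q : ℕ) (i : Fin n) : formθ o x₀ q i x₀ = if q = 0 then kron o i else 0 := by
  simp [formθ, zero_pow_eq]

lemma symP_self (p : ℕ) (i j k : Fin n) :
    symP o x₀ p i j k x₀ = if p = 0 then kron o i * kron o j * kron o k else 0 := by
  simp [symP, zero_pow_eq]

lemma cv0_funφ_self (m : ℕ) (i : Fin n) :
    cv0 Γ w (funφ o x₀ (m + 1)) i x₀ = if m = 0 then kron o i else 0 := by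
  unfold funφ
  rw [cv0_pow_mul m (by fun_prop)]
  by_cases h : m = 0 <;> simp [h]

lemma cv1_cv0_funφ_self (hΓ : ∀ k i j, ContDiff ℝ ∞ (Γ k i j)) (m : ℕ) (i j : Fin n) :
    cv1 Γ w (cv0 Γ w (funφ o x₀ (m + 2))) i j x₀ = if m = 0 then 2 * (kron o i * kron o j) else 0 := by
  unfold funφ
  rw [cv0_pow_mul (m + 1) (by fun_prop), cv1_pow_mul m (by fun_prop)]
  by_cases h : m = 0
  · simp [h]; ring
  · simp [h]

lemma cv2_cv1_cv0_funφ_self (hΓ : ∀ k i j, ContDiff ℝ ∞ (Γ k i j)) (i j k : Fin n) :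
    cv2 Γ w (cv1 Γ w (cv0 Γ w (funφ o x₀ 3))) i j k x₀
      = 6 * (kron o i * kron o j * kron o k) := by
  unfold funφ
  rw [cv0_pow_mul 2 (by fun_prop), cv1_pow_mul 1 (by fun_prop), cv2_pow_mul 0 (by fun_prop)]
  simp
  ring

lemma cv1_formθ_self (q : ℕ) (i j : Fin n) :
    cv1 Γ w (formθ o x₀ (q + 1)) i j x₀ = if q = 0 then kron o i * kron o j else 0 := by
  unfold formθ
  rw [cv1_pow_mul q (by fun_prop)]
  by_cases h : q = 0 <;> simp [h]

lemma cv2_cv1_formθ_self (hΓ : ∀ k i j, ContDiff ℝ ∞ (Γ k i j)) (i j k : Fin n) :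
    cv2 Γ w (cv1 Γ w (formθ o x₀ 2)) i j k x₀ = 2 * (kron o i * kron o j * kron o k) := by
  unfold formθ
  rw [cv1_pow_mul 1 (by fun_prop), cv2_pow_mul 0 (by fun_prop)]
  simp
  ring

lemma dv3_symP_self (p : ℕ) (i j : Fin n) :
    dv3 Γ w (symP o x₀ (p + 1)) i j x₀ = if p = 0 then kron o i * kron o j else 0 := by
  unfold symP
  rw [dv3_pow_mul p (by fun_prop)]
  by_cases h : p = 0 <;> simp [h]

lemma dv2_dv3_symP_self (hΓ : ∀ k i j, ContDiff ℝ ∞ (Γ k i j)) (p : ℕ) (i : Fin n) :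
    dv2 Γ w (dv3 Γ w (symP o x₀ (p + 2))) i x₀ = if p = 0 then 2 * kron o i else 0 := by
  unfold symP
  rw [dv3_pow_mul (p + 1) (by fun_prop), dv2_pow_mul p (by fun_prop)]
  by_cases h : p = 0
  · simp [h]; norm_num
  · simp [h]

lemma dv1_dv2_dv3_symP_self (hΓ : ∀ k i j, ContDiff ℝ ∞ (Γ k i j)) :
    dv1 Γ w (dv2 Γ w (dv3 Γ w (symP o x₀ 3))) x₀ = 6 := by
  unfold symP
  rw [dv3_pow_mul 2 (by fun_prop), dv2_pow_mul 1 (by fun_prop), dv1_pow_mul 0 (by fun_prop)]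
  simp
  norm_num

end PowerTests

/-! ### Values of the formula and of its change on the tests. -/

section TestValues

variable {n : ℕ} {o : Fin n} {x₀ : Coord n} {Γ : LocalConn n}

lemma dot₃_kron (o : Fin n) (X : Fin n → Fin n → Fin n → ℝ) :
    dot₃ (fun i j k => kron o i * kron o j * kron o k) X = X o o o := by
  simp only [dot₃, mul_assoc, ← Finset.mul_sum, sum_kron_mul]

lemma dot₂_kron (o : Fin n) (X : Fin n → Fin n → ℝ) :
    dot₂ (fun i j => kron o i * kron o j) X = X o o := by
  simp only [dot₂, mul_assoc, ← Finset.mul_sum, sum_kron_mul]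

lemma dot₁_kron (o : Fin n) (c : ℝ) (X : Fin n → ℝ) :
    dot₁ (fun i => c * kron o i) X = c * X o := by
  simp only [dot₁, mul_assoc, ← Finset.mul_sum, sum_kron_mul]

@[simp] lemma dot₃_zero_left (X : Fin n → Fin n → Fin n → ℝ) : dot₃ (fun _ _ _ => 0) X = 0 := by
  simp [dot₃]

@[simp] lemma dot₂_zero_left (X : Fin n → Fin n → ℝ) : dot₂ (fun _ _ => 0) X = 0 := by
  simp [dot₂]

@[simp] lemma dot₁_zero_left (X : Fin n → ℝ) : dot₁ (fun _ => 0) X = 0 := by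
  simp [dot₁]

@[simp] lemma dot₃_zero_right (X : Fin n → Fin n → Fin n → ℝ) : dot₃ X (fun _ _ _ => 0) = 0 := by
  simp [dot₃]

@[simp] lemma dot₂_zero_right (X : Fin n → Fin n → ℝ) : dot₂ X (fun _ _ => 0) = 0 := by
  simp [dot₂]

@[simp] lemma dot₁_zero_right (X : Fin n → ℝ) : dot₁ X (fun _ => 0) = 0 := by
  simp [dot₁]

variable (κ : Coeffs) (lam del : ℝ)

/-- The vanishing orders p of P and m of φ add up to three, the largest number of derivatives
available, so only the term distributing them exactly as (p, m) survives. The terms with curvature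
have too few derivatives left. -/
lemma quantDiv_test_zero_three (hΓ : ∀ k i j, ContDiff ℝ ∞ (Γ k i j)) : quantDiv κ lam del Γ (symP o x₀ 0) (funφ o x₀ 3) x₀
    = 6 := by
  simp [quantDiv, symP_self, funφ_self, cv1_cv0_funφ_self hΓ 1,
    cv2_cv1_cv0_funφ_self hΓ, dot₃_kron, cv0_funφ_self 2]

lemma quantDiv_test_one_two (hΓ : ∀ k i j, ContDiff ℝ ∞ (Γ k i j)) :
    quantDiv κ lam del Γ (symP o x₀ 1) (funφ o x₀ 2) x₀ = 2 * κ.α := by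
  simp [quantDiv, symP_self, funφ_self, cv1_cv0_funφ_self hΓ 0, dv3_symP_self 0, cv0_funφ_self 1,
    dot₂_kron, mul_comm]

lemma quantDiv_test_two_one (hΓ : ∀ k i j, ContDiff ℝ ∞ (Γ k i j)) :
    quantDiv κ lam del Γ (symP o x₀ 2) (funφ o x₀ 1) x₀ = 2 * κ.β₁ := by
  simp [quantDiv, symP_self, funφ_self, dv2_dv3_symP_self hΓ 0, dv3_symP_self 1, cv0_funφ_self 0,
    dot₁_kron, mul_comm]

lemma quantDiv_test_three_zero (hΓ : ∀ k i j, ContDiff ℝ ∞ (Γ k i j)) :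
    quantDiv κ lam del Γ (symP o x₀ 3) (funφ o x₀ 0) x₀ = 6 * κ.η₁ := by
  simp [quantDiv, symP_self, funφ_self, dv1_dv2_dv3_symP_self hΓ, dv2_dv3_symP_self hΓ 1,
    dv3_symP_self 2, mul_comm]

variable (f : Fin 11 → ℝ)

/-- The exponents (p, m, q) of P, φ and θ, listed in this order in the names, satisfy p+m+q = 2. A
term with a single θ and no curvature carries two derivatives in all and survives only if they fall
as (p, m, q). The terms with more factors θ or with curvature have too few derivatives. Thus each of
the six single-θ coefficients is isolated by one choice of exponents. -/
lemma sum_shiftTerm_zero_two_zero (hΓ : ∀ k i j, ContDiff ℝ ∞ (Γ k i j)) :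
    ∑ s, f s * shiftTerm lam del Γ (formθ o x₀ 0) (symP o x₀ 0) (funφ o x₀ 2) x₀ s = f 0 * 2 := by
  simp [Fin.sum_univ_succ, shiftTerm, symP_self, funφ_self, formθ_self, cv0_funφ_self 1,
    cv1_cv0_funφ_self hΓ 0, dot₃_kron]

lemma sum_shiftTerm_one_one_zero :
    ∑ s, f s * shiftTerm lam del Γ (formθ o x₀ 0) (symP o x₀ 1) (funφ o x₀ 1) x₀ s = f 1 := by
  simp [Fin.sum_univ_succ, shiftTerm, symP_self, funφ_self, formθ_self, cv0_funφ_self 0,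
    dv3_symP_self 0, dot₂_kron]

lemma sum_shiftTerm_zero_one_one :
    ∑ s, f s * shiftTerm lam del Γ (formθ o x₀ 1) (symP o x₀ 0) (funφ o x₀ 1) x₀ s = f 2 := by
  simp [Fin.sum_univ_succ, shiftTerm, symP_self, funφ_self, formθ_self, cv0_funφ_self 0,
    cv1_formθ_self 0, dot₃_kron]

lemma sum_shiftTerm_two_zero_zero (hΓ : ∀ k i j, ContDiff ℝ ∞ (Γ k i j)) :
    ∑ s, f s * shiftTerm lam del Γ (formθ o x₀ 0) (symP o x₀ 2) (funφ o x₀ 0) x₀ s = f 4 * 2 := by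
  simp [Fin.sum_univ_succ, shiftTerm, symP_self, funφ_self, formθ_self, dv3_symP_self 1,
    dv2_dv3_symP_self hΓ 0, dot₁_kron]

lemma sum_shiftTerm_one_zero_one :
    ∑ s, f s * shiftTerm lam del Γ (formθ o x₀ 1) (symP o x₀ 1) (funφ o x₀ 0) x₀ s = f 5 := by
  simp [Fin.sum_univ_succ, shiftTerm, symP_self, funφ_self, formθ_self, dv3_symP_self 0,
    cv1_formθ_self 0, dot₂_kron]

lemma sum_shiftTerm_zero_zero_two (hΓ : ∀ k i j, ContDiff ℝ ∞ (Γ k i j)) :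
    ∑ s, f s * shiftTerm lam del Γ (formθ o x₀ 2) (symP o x₀ 0) (funφ o x₀ 0) x₀ s = f 7 * 2 := by
  simp [Fin.sum_univ_succ, shiftTerm, symP_self, funφ_self, formθ_self, cv1_formθ_self 1,
    cv2_cv1_formθ_self hΓ, dot₃_kron]

end TestValues

/-! ### Necessary conditions obtained by testing on the manifold. -/

section ManifoldValues

variable {n : ℕ} {M : Type*} [TopologicalSpace M] [ChartedSpace (Coord n) M]

/-- Near the point the connection is replaced by a cut-off one, smooth on all of ℝⁿ and independent
of the exponents, so that the monomial values apply. -/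
lemma quantLocal_test (κ : Coeffs) (lam del : ℝ) (D : Connection n M) (c : Chart n M) {o : Fin n}
    {x₀ : Coord n} {W : Set (Coord n)} (hW : IsOpen W) (hx : x₀ ∈ W) (hWc : W ⊆ c.1.target) :
    ∃ Γ : LocalConn n, (∀ k i j, ContDiff ℝ ∞ (Γ k i j)) ∧
      ∀ (p m : ℕ) (P : LocalTensor n 3 0) (φ : LocalTensor n 0 0),
        (∀ a b, ∀ y ∈ W, P a b y = testP o x₀ p a b y) →
        (∀ a b, ∀ y ∈ W, φ a b y = testφ o x₀ m a b y) →
        quantLocal κ lam del (D.Γ c) P φ ![] ![] x₀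
          = quantDiv κ lam del Γ (symP o x₀ p) (funφ o x₀ m) x₀ := by
  obtain ⟨χ, W', hW', hxW', hWU, sχ, hχ, -, tχ⟩ := exists_cutoff hW hx
  have sΓ : ∀ k i j, ContDiff ℝ ∞ fun y => χ y * D.Γ c k i j y := fun k i j =>
    contDiff_cutoff hW sχ tχ ((D.smooth c k i j).mono hWc)
  refine ⟨fun k i j y => χ y * D.Γ c k i j y, sΓ, fun p m P φ hP hφ => ?_⟩
  rw [quantLocal_eqOn κ lam del hW' (Γ' := fun k i j y => χ y * D.Γ c k i j y)
    (fun k i j y hy => by rw [hχ y hy, one_mul]) (fun a b y hy => hP a b y (hWU hy))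
    (fun a b y hy => hφ a b y (hWU hy)) _ _ x₀ hxW',
    quantLocal_eq_quantDiv _ _ _ sΓ (contDiff_testP p) (testP_perm p), testP_eq, testφ_eq]

variable [T2Space M]

/-- Test tensors on `M` which are monomials near a point of a chart. -/
lemma exists_tests (c : Chart n M) (o : Fin n) {x₀ : Coord n} (hx : x₀ ∈ c.1.target)
    (lam del : ℝ) :
    ∃ W, IsOpen W ∧ x₀ ∈ W ∧ W ⊆ c.1.target ∧
      (∀ p, ∃ P : Symbol3 n M del, ∀ a b, ∀ y ∈ W, P.1 c a b y = testP o x₀ p a b y) ∧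
      (∀ m, ∃ φ : Density n M lam, ∀ a b, ∀ y ∈ W, φ.1 c a b y = testφ o x₀ m a b y) ∧
      ∀ q, ∃ θ : TensorDensity n M 0 1 0, ∀ a b, ∀ y ∈ W, θ.1 c a b y = testθ o x₀ q a b y := by
  obtain ⟨χ, W, hW, hxW, hWU, sχ, hχ, cχ, tχ⟩ := exists_cutoff c.1.open_target hx
  refine ⟨W, hW, hxW, hWU, fun p => ?_, fun m => ?_, fun q => ?_⟩
  · obtain ⟨T, h1, h2⟩ := exists_tensorDensity del c sχ cχ tχ
      (contDiff_testP (o := o) (x₀ := x₀) p)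
    exact ⟨⟨T.1, T.2, h2 (testP_perm p)⟩, fun a b y hy => by
      rw [h1 a b y (hWU hy), hχ y hy, one_mul]⟩
  · obtain ⟨T, h1, -⟩ := exists_tensorDensity lam c sχ cχ tχ
      (contDiff_testφ (o := o) (x₀ := x₀) m)
    exact ⟨T, fun a b y hy => by rw [h1 a b y (hWU hy), hχ y hy, one_mul]⟩
  · obtain ⟨T, h1, -⟩ := exists_tensorDensity 0 c sχ cχ tχ
      (contDiff_testθ (o := o) (x₀ := x₀) q)
    exact ⟨T, fun a b y hy => by rw [h1 a b y (hWU hy), hχ y hy, one_mul]⟩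

lemma coeffs_congr_of_quantLocal_eq {κ κ' : Coeffs} {lam del : ℝ} (D : Connection n M)
    (c : Chart n M) (o : Fin n) {x₀ : Coord n} (hx : x₀ ∈ c.1.target)
    (h : ∀ (P : Symbol3 n M del) (φ : Density n M lam),
      quantLocal κ lam del (D.Γ c) (P.1 c) (φ.1 c) ![] ![] x₀
        = quantLocal κ' lam del (D.Γ c) (P.1 c) (φ.1 c) ![] ![] x₀) :
    κ.α = κ'.α ∧ κ.β₁ = κ'.β₁ ∧ κ.η₁ = κ'.η₁ := by
  obtain ⟨W, hW, hxW, hWc, tP, tφ, -⟩ := exists_tests c o hx lam del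
  obtain ⟨Γ, sΓ, e⟩ := quantLocal_test κ lam del D c (o := o) hW hxW hWc
  obtain ⟨Γ', sΓ', e'⟩ := quantLocal_test κ' lam del D c (o := o) hW hxW hWc
  have key : ∀ p m, quantDiv κ lam del Γ (symP o x₀ p) (funφ o x₀ m) x₀
      = quantDiv κ' lam del Γ' (symP o x₀ p) (funφ o x₀ m) x₀ := fun p m => by
    obtain ⟨P, hP⟩ := tP p
    obtain ⟨φ, hφ⟩ := tφ m
    rw [← e p m _ _ hP hφ, ← e' p m _ _ hP hφ, h]
  have k1 := key 1 2
  have k2 := key 2 1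
  have k3 := key 3 0
  rw [quantDiv_test_one_two κ lam del sΓ, quantDiv_test_one_two κ' lam del sΓ'] at k1
  rw [quantDiv_test_two_one κ lam del sΓ, quantDiv_test_two_one κ' lam del sΓ'] at k2
  rw [quantDiv_test_three_zero κ lam del sΓ, quantDiv_test_three_zero κ' lam del sΓ'] at k3
  exact ⟨by linarith, by linarith, by linarith⟩

/-- Different parameters give different maps in each row of the table. -/
lemma quantMap_row_injective [IsManifold (𝓡 n) ∞ M] [Nonempty M] (hn : 1 < n) (r : Row)
    (D : Connection n M) (hmu : r.mu n = r.lam n + r.del n) :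
    Function.Injective fun t => quantMap (r.coeffs n t) D hmu := by
  intro t t' h
  obtain ⟨z⟩ := ‹Nonempty M›
  let c : Chart n M := ⟨chartAt (Coord n) z, IsManifold.chart_mem_maximalAtlas z⟩
  have hx : c.1 z ∈ c.1.target := mem_chart_target (Coord n) z
  have hc := coeffs_congr_of_quantLocal_eq (κ := r.coeffs n t) (κ' := r.coeffs n t')
    (lam := r.lam n) (del := r.del n) D c ⟨0, by omega⟩ hx fun P φ => by
      rw [← quantMap_apply _ D hmu P φ hx, ← quantMap_apply _ D hmu P φ hx]
      simp only at h
      rw [h]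
  obtain ⟨h1, h2, h3⟩ := hc
  -- In every row t is, up to a nonzero factor, one of α, β₁, η₁.
  cases r <;> simp only [Row.coeffs] at h1 h2 h3 <;> first | exact h1 | exact h3 | skip
  all_goals linarith

/-- The necessary conditions on the constants for projective invariance. -/
lemma shiftCoeff_eq_zero {κ : Coeffs} {lam del : ℝ} (D : Connection n M)
    (c : Chart n M) (o : Fin n) {x₀ : Coord n} (hx : x₀ ∈ c.1.target)
    (h : ∀ (θ : TensorDensity n M 0 1 0) (P : Symbol3 n M del) (φ : Density n M lam),
      quantLocal κ lam del ((D.shift θ).Γ c) (P.1 c) (φ.1 c) ![] ![] x₀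
        = quantLocal κ lam del (D.Γ c) (P.1 c) (φ.1 c) ![] ![] x₀) :
    ∀ s ∈ ({0, 1, 2, 4, 5, 7} : Set (Fin 11)),
      shiftCoeff κ (lam * (n + 1)) (n + 5 - del * (n + 1)) (n - 1) s = 0 := by
  obtain ⟨W, hW, hxW, hWc, tP, tφ, tθ⟩ := exists_tests c o hx lam del
  have key : ∀ p m q, ∃ Γ : LocalConn n, (∀ k i j, ContDiff ℝ ∞ (Γ k i j)) ∧
      ∑ s, shiftCoeff κ (lam * (n + 1)) (n + 5 - del * (n + 1)) (n - 1) s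
        * shiftTerm lam del Γ (formθ o x₀ q) (symP o x₀ p) (funφ o x₀ m) x₀ s = 0 := by
    intro p m q
    obtain ⟨P, hP⟩ := tP p
    obtain ⟨φ, hφ⟩ := tφ m
    obtain ⟨θ, hθ⟩ := tθ q
    obtain ⟨Γ, sΓ, -, e⟩ := quantLocal_shift κ lam del hW hxW (Γ := D.Γ c)
      (Γ' := (D.shift θ).Γ c) (fun k i j => (D.smooth c k i j).mono hWc)
      (fun k i j y hy => D.symm c k i j y (hWc hy)) (fun k i j y _ => rfl) hθ (contDiff_testθ q)
      hP (contDiff_testP p) (testP_perm p) hφ (contDiff_testφ m)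
    rw [h, left_eq_add, testθ_eq, testP_eq, testφ_eq] at e
    exact ⟨Γ, sΓ, e⟩
  -- For each index the exponents (p, m, q) count the derivatives on P, φ and θ in the corresponding
  -- contraction.
  rintro s (rfl | rfl | rfl | rfl | rfl | rfl)
  · obtain ⟨Γ, sΓ, e⟩ := key 0 2 0
    rw [sum_shiftTerm_zero_two_zero lam del _ sΓ] at e
    linarith
  · obtain ⟨Γ, sΓ, e⟩ := key 1 1 0
    rwa [sum_shiftTerm_one_one_zero lam del] at e
  · obtain ⟨Γ, sΓ, e⟩ := key 0 1 1
    rwa [sum_shiftTerm_zero_one_one lam del] at e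
  · obtain ⟨Γ, sΓ, e⟩ := key 2 0 0
    rw [sum_shiftTerm_two_zero_zero lam del _ sΓ] at e
    linarith
  · obtain ⟨Γ, sΓ, e⟩ := key 1 0 1
    rwa [sum_shiftTerm_one_zero_one lam del] at e
  · obtain ⟨Γ, sΓ, e⟩ := key 0 0 2
    rw [sum_shiftTerm_zero_zero_two lam del _ sΓ] at e
    linarith

/-- The symbol ∂_o³ applied to u³ gives the value 6 at the centre. Passing to the dilated chart,
this value scales with weight μ because the result is a μ-density, and with weight λ+δ by the
covariance of the formula. As the determinant is 2^n with n positive, the weights agree. -/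
lemma mu_eq_of_isGivenBy {κ : Coeffs} {lam mu del : ℝ} {D : Connection n M}
    {Q : Symbol3 n M del →ₗ[ℝ] DiffOp3 n M lam mu} (hQ : IsGivenBy κ D Q) (c : Chart n M)
    (o : Fin n) {x₀ : Coord n} (hx : x₀ ∈ c.1.target) : mu = lam + del := by
  obtain ⟨W, hW, hxW, hWc, tP, tφ, -⟩ := exists_tests c o hx lam del
  obtain ⟨Γ, sΓ, e⟩ := quantLocal_test κ lam del D c (o := o) hW hxW hWc
  obtain ⟨P, hP⟩ := tP 0
  obtain ⟨φ, hφ⟩ := tφ 3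
  have e1 := e 0 3 _ _ hP hφ
  rw [quantDiv_test_zero_three κ lam del sΓ] at e1
  have ho : x₀ ∈ overlap c c.dilate := by rwa [overlap_dilate]
  have hx' := overlap_subset c.dilate c (transition_mem_overlap ho)
  have e2 := (TensorDensity.law ((Q P).1 φ) c c.dilate).scalar ho
  rw [hQ P φ c x₀ hx, hQ P φ c.dilate _ hx', ← jac_eq] at e2
  have e3 := quantLocal_transition κ D P φ ho
  rw [e1, det_jac_dilate c hx] at e2 e3
  have hn : n ≠ 0 := fun h => by subst h; exact o.elim0
  have h2 : (1 : ℝ) < 2 ^ n := one_lt_pow₀ one_lt_two hn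
  rw [abs_of_pos (by positivity)] at e2 e3
  have hv : quantLocal κ lam del (D.Γ c.dilate) (P.1 c.dilate) (φ.1 c.dilate) ![] ![]
      (transition c c.dilate x₀) ≠ 0 := by
    intro h0
    rw [h0, mul_zero] at e2
    norm_num at e2
  have e4 := mul_right_cancel₀ hv (e2.symm.trans e3)
  exact (Real.rpow_right_inj (by positivity) h2.ne').1 e4

end ManifoldValues

/-! ### The table as the solution set of the invariance equations -/

/-- For the three exceptional values of `δ`, the constants for which the leading coefficients of the
change of the quantization formula vanish are those of the table. -/
lemma exists_row_of_shiftCoeff_eq_zero {n : ℕ} (hn : 1 < n) {κ : Coeffs} {lam del : ℝ}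
    (hdel : del = (n + 3) / (n + 1) ∨ del = (n + 4) / (n + 1) ∨ del = (n + 5) / (n + 1))
    (h : ∀ s ∈ ({0, 1, 2, 4, 5, 7} : Set (Fin 11)),
      shiftCoeff κ (lam * (n + 1)) (n + 5 - del * (n + 1)) (n - 1) s = 0) :
    ∃ (r : Row) (t : ℝ), del = r.del n ∧ lam = r.lam n ∧ κ = r.coeffs n t := by
  have hN : (n + 1 : ℝ) ≠ 0 := by positivity
  have hr : (1 - n : ℝ) ≠ 0 := by
    have : (1 : ℝ) < n := by exact_mod_cast hn
    linarith
  have hr3 : (3 - 3 * n : ℝ) ≠ 0 := by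
    have : (3 - 3 * n : ℝ) = 3 * (1 - n) := by ring
    rw [this]
    exact mul_ne_zero three_ne_zero hr
  have e0 := h 0 (by simp)
  have e1 := h 1 (by simp)
  have e2 := h 2 (by simp)
  have e4 := h 4 (by simp)
  have e5 := h 5 (by simp)
  have e7 := h 7 (by simp)
  obtain ⟨a, ha⟩ : ∃ a, a = lam * (n + 1) := ⟨_, rfl⟩
  obtain ⟨e, he⟩ : ∃ e, e = n + 5 - del * (n + 1) := ⟨_, rfl⟩
  rw [← ha, ← he] at e0 e1 e2 e4 e5 e7
  simp only [shiftCoeff, Matrix.cons_val] at e0 e1 e2 e4 e5 e7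
  have hl : lam = a / (n + 1) := by rw [ha, mul_div_cancel_right₀ _ hN]
  have hd : del * (n + 1) = n + 5 - e := by rw [he]; ring
  obtain ⟨α, β₁, β₂, η₁, η₂, η₃⟩ := κ
  dsimp only at e0 e1 e2 e4 e5 e7
  rcases hdel with rfl | rfl | rfl
  · rw [div_mul_cancel₀ _ hN] at hd
    -- Here 3e-6 = 0: equation 4 no longer contains η₁ and reads aβ₁ = 0, which gives the three
    -- roots. The free constant is η₁.
    obtain rfl : e = 2 := by linarith
    obtain rfl : α = (6 + 3 * a) / 2 := by linarith
    obtain rfl : β₁ = (6 + 3 * a) / 2 * (1 + a) := by linarith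
    have : a * (a + 1) * (a + 2) = 0 := by linarith
    rcases mul_eq_zero.1 this with h1 | h1
    · rcases mul_eq_zero.1 h1 with rfl | h1
      · refine ⟨.r6, η₁, rfl, by simpa [Row.lam] using hl, ?_⟩
        ext <;> simp only [Row.coeffs] <;> first | linarith | (field_simp; linarith)
      · obtain rfl : a = -1 := by linarith
        refine ⟨.r5, η₁, rfl, hl, ?_⟩
        ext <;> simp only [Row.coeffs] <;> first | linarith | (field_simp; linarith)
    · obtain rfl : a = -2 := by linarith
      refine ⟨.r4, η₁, rfl, hl, ?_⟩
      ext <;> simp only [Row.coeffs] <;> first | linarith | (field_simp; linarith)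
  · rw [div_mul_cancel₀ _ hN] at hd
    -- Here 2e-2 = 0: equation 1 no longer contains β₁ and reads α(2+2a) = 0, and β₁ is free.
    obtain rfl : e = 1 := by linarith
    obtain rfl : α = 6 + 3 * a := by linarith
    have : (a + 1) * (a + 2) = 0 := by linarith
    rcases mul_eq_zero.1 this with h1 | h1
    · obtain rfl : a = -1 := by linarith
      refine ⟨.r3, β₁, rfl, hl, ?_⟩
      ext <;> simp only [Row.coeffs] <;> first | linarith | (field_simp; linarith)
    · obtain rfl : a = -2 := by linarith
      refine ⟨.r2, β₁, rfl, hl, ?_⟩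
      ext <;> simp only [Row.coeffs] <;> first | linarith | (field_simp; linarith)
  · rw [div_mul_cancel₀ _ hN] at hd
    -- Equation 0 no longer contains α and forces a = -2; the free constant is α.
    obtain rfl : e = 0 := by linarith
    obtain rfl : a = -2 := by linarith
    refine ⟨.r1, α, rfl, hl, ?_⟩
    ext <;> simp only [Row.coeffs] <;> first | linarith | (field_simp; linarith)

end ProjQuant

end

open ProjQuant in
theorem proposition2p2 (n : ℕ) (hn : 1 < n) :
    (∀ (M : Type*) [TopologicalSpace M] [ChartedSpace (Coord n) M] [IsManifold (𝓡 n) ∞ M]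
        [T2Space M] [Nonempty M] (D : Connection n M),
      (∀ r : Row, ∃ Q : ℝ → (Symbol3 n M (r.del n) →ₗ[ℝ] DiffOp3 n M (r.lam n) (r.mu n)),
        Function.Injective Q ∧ ∀ t, IsProjQuantization (r.coeffs n t) D (Q t)) ∧
      (∀ del : ℝ, (del = (n + 3) / (n + 1) ∨ del = (n + 4) / (n + 1) ∨ del = (n + 5) / (n + 1)) →
        ∀ (lam mu : ℝ) (κ : Coeffs),
          (∃ Q : Symbol3 n M del →ₗ[ℝ] DiffOp3 n M lam mu, IsProjQuantization κ D Q) →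
          ∃ (r : Row) (t : ℝ),
            del = r.del n ∧ lam = r.lam n ∧ mu = r.mu n ∧ κ = r.coeffs n t)) ∧
    (∀ (r : Row) (t : ℝ) (Γ : LocalConn n), IsFlatClass Γ →
      IsSlEquivariant (r.coeffs n t) (r.lam n) (r.mu n) (r.del n) Γ) := by
  refine ⟨?_, fun r t Γ hΓ => isSlEquivariant_row hn r t hΓ⟩
  intro M _ _ _ _ _ D
  refine ⟨fun r => ?_, ?_⟩
  · have hmu : r.mu n = r.lam n + r.del n := by rw [Row.mu_eq, add_comm]
    exact ⟨_, quantMap_row_injective hn r D hmu,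
      fun t => isProjQuantization_quantMap hn r t D hmu⟩
  · rintro del hdel lam mu κ ⟨Q, hQ⟩
    obtain ⟨z⟩ := ‹Nonempty M›
    have hx := mem_chart_target (Coord n) z
    have h0 := hQ.2 D (projEquiv_refl D)
    let c : Chart n M := ⟨chartAt (Coord n) z, IsManifold.chart_mem_maximalAtlas z⟩
    -- The formulas written with D and with each of its shifts agree, because both compute the same
    -- map Q.
    obtain ⟨r, t, h1, h2, h3⟩ := exists_row_of_shiftCoeff_eq_zero hn hdel
      (shiftCoeff_eq_zero (κ := κ) (lam := lam) (del := del) D c ⟨0, by omega⟩ hx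
        fun θ P φ => ((hQ.2 _ (projEquiv_shift D θ) P φ c _ hx).symm.trans (h0 P φ c _ hx)))
    refine ⟨r, t, h1, h2, ?_, h3⟩
    rw [mu_eq_of_isGivenBy h0 c ⟨0, by omega⟩ hx, h1, h2, Row.mu_eq, add_comm]
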